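/- Let $\alpha>0$, $\alpha\notin\mathbb Z$, $\beta>0$. For $n\ge 0$, $t\ge 0$ let $$D_n(t,\alpha,\beta)=\det\Big(\int_0^1 x^{j+k}\,x^{\alpha}(1-x)^{\beta}e^{-t/x}\,dx\Big)_{j,k=0}^{n-1},$$ which is positive. Then, for every $s\in(0,\infty)$, the limits $$\Delta(s)=\lim_{n\to\infty}\frac{D_n(\frac{s}{2n^2},\alpha,\beta)}{D_n(0,\alpha,\beta)}>0,\qquad \mathcal H(s)=\lim_{n\to\infty}s\frac{d}{ds}\ln\frac{D_n(\frac{s}{2n^2},\alpha,\beta)}{D_n(0,\alpha,\beta)}$$ exist (with the logarithms differentiable in $s$), and $\mathcal H(s)=s\frac{d}{ds}\ln\Delta(s)$. For some $\rho>0$, $\mathcal H$ continues from $(0,\rho)$ to an analytic function on $\{|\arg s|<\pi,\ 0<|s|<\rho\}$, and there $$\mathcal H(s)=-\frac{s}{2\alpha}+\frac{s^2}{4\alpha^2(\alpha^2-1)}+\mathcal O(s^3)+\frac{\pi s^{\alpha+1}}{2^{\alpha+1}(\alpha+1)\Gamma^3(\alpha+1)\sin(\alpha\pi)}\big(1+\mathcal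 O(s)\big)+\mathcal O\big(s^{2(\alpha+1)}\big)$$ as $s\to0$, with principal powers of $s$. Here the terms $\mathcal O(s^3)$ and $\mathcal O(s)$ are analytic functions of $s$ at $s=0$ of these orders (so that the non-power term $s^{\alpha+1}$ is separated from the power series for every $\alpha$), and the bound $\mathcal O(s^{2(\alpha+1)})$ is uniform in $|\arg s|<\pi$. -/

import Mathlib

open Filter Topology Asymptotics

/-- The Pollaczek-Jacobi type weight `x ^ α * (1 - x) ^ β * exp (-t / x)` on `[0, 1]`. -/
noncomputable def pjWeight (t α β x : ℝ) : ℝ :=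
  x ^ α * (1 - x) ^ β * Real.exp (-t / x)

/-- The Hankel determinant `D_n(t, α, β)` of the moments of the weight. -/
noncomputable def hankelDet (n : ℕ) (t α β : ℝ) : ℝ :=
  Matrix.det (Matrix.of fun j k : Fin n =>
    ∫ x in (0 : ℝ)..1, x ^ ((j : ℕ) + (k : ℕ)) * pjWeight t α β x)

/-- The normalized determinant at `t = s / (2 n ^ 2)`. -/
noncomputable def scaledRatio (α β : ℝ) (n : ℕ) (s : ℝ) : ℝ :=
  hankelDet n (s / (2 * (n : ℝ) ^ 2)) α β / hankelDet n 0 α β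

/-- `s * d/ds log (D_n(s / (2 n ^ 2), α, β) / D_n(0, α, β))`. -/
noncomputable def scaledLogDeriv (α β : ℝ) (n : ℕ) (s : ℝ) : ℝ :=
  s * deriv (fun u : ℝ => Real.log (scaledRatio α β n u)) s

/-- The coefficient of `s ^ (α + 1)`. -/
noncomputable def specialCoeff (α : ℝ) : ℝ :=
  Real.pi /
    ((2 : ℝ) ^ (α + 1) * (α + 1) * Real.Gamma (α + 1) ^ 3 * Real.sin (α * Real.pi))

/-!
A unipotent change of columns replaces the moments in `D_n(t)` by moments of truncated
exponentials, which expand into convergent series with terms `t ^ m` and `t ^ (α + 1 + m)`.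
Lagrange interpolation at the equispaced nodes `α + 1 + i` expresses the new columns through those
of the Hankel matrix at `t = 0`, so `D_n(t) / D_n(0) = det (1 + M)`, where in the variables
`x = 1 / n`, `σ = n ^ 2 * t` and `τ ~ σ ^ (α + 1)` the entries of `M` are continuous up to `x = 0`
and bounded uniformly in `x`, with fast decay in the indices. Summing principal minors gives a
limit determinant that is entire in `σ` and `τ`, and after `σ = exp ζ / 2` the convergence is
locally bounded in `ζ = log s`, so derivatives converge as well by Cauchy's formula.

The limit `Δ` is positive because `D_n` is log-convex in `t`: this gives `Δ(s) ^ 2 ≤ Δ(2 * s)`,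
and `Δ(s) → 1` as `s → 0`. Expanding the limit determinant to first order in `τ` gives
`Δ(s) = P(s) + g * s ^ (α + 1) * Q(s) + O(s ^ (2 * (α + 1)))` with entire `P`, `Q`, and the
asymptotics of the logarithmic derivative follow from the first Taylor coefficients of `P`, `Q`.
-/

section BetaSeries

open Finset (range)

open scoped Nat

/-- The rising factorial `(z)_N = z (z + 1) ⋯ (z + N - 1)`. -/
noncomputable def risingFactorial (z : ℝ) (N : ℕ) : ℝ := (ascPochhammer ℝ N).eval z

theorem risingFactorial_zero (z : ℝ) : risingFactorial z 0 = 1 := by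
  simp [risingFactorial]

theorem risingFactorial_succ (z : ℝ) (N : ℕ) :
    risingFactorial z (N + 1) = risingFactorial z N * (z + N) :=
  ascPochhammer_succ_eval N z

theorem risingFactorial_add (z : ℝ) (M N : ℕ) :
    risingFactorial z (M + N) = risingFactorial z M * risingFactorial (z + M) N := by
  simp [risingFactorial, ← ascPochhammer_mul]

theorem risingFactorial_eq_prod (z : ℝ) (N : ℕ) :
    risingFactorial z N = ∏ l ∈ range N, (z + l) := by
  induction N with
  | zero => exact risingFactorial_zero z
  | succ N ih => rw [risingFactorial_succ, Finset.prod_range_succ, ih]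

theorem risingFactorial_pos {z : ℝ} (hz : 0 < z) (N : ℕ) : 0 < risingFactorial z N :=
  ascPochhammer_pos N z hz

theorem risingFactorial_ne_zero {z : ℝ} (hz : ∀ r : ℕ, z + r ≠ 0) (N : ℕ) :
    risingFactorial z N ≠ 0 := by
  rw [risingFactorial_eq_prod]
  exact Finset.prod_ne_zero_iff.2 fun l _ => hz l

/-- The coefficient of `x ^ r` in the binomial series of `(1 - x) ^ β`. -/
noncomputable def binomCoeff (β : ℝ) (r : ℕ) : ℝ := risingFactorial (-β) r / r !

theorem factorial_mul_binomCoeff (β : ℝ) (r : ℕ) :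
    r ! * binomCoeff β r = risingFactorial (-β) r :=
  mul_div_cancel₀ _ (by positivity)

theorem binomCoeff_succ (β : ℝ) (r : ℕ) :
    ((r : ℝ) + 1) * binomCoeff β (r + 1) = (r - β) * binomCoeff β r := by
  rw [binomCoeff, binomCoeff, risingFactorial_succ, Nat.factorial_succ]
  push_cast
  field_simp
  ring

theorem binomCoeff_eq_multichoose (β : ℝ) (r : ℕ) :
    binomCoeff β r = Ring.multichoose (-β) r := by
  have h := Ring.factorial_nsmul_multichoose_eq_ascPochhammer (-β) r
  rw [nsmul_eq_mul, Polynomial.ascPochhammer_smeval_eq_eval] at h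
  rw [binomCoeff, div_eq_iff (by positivity), mul_comm]
  exact h.symm

theorem hasSum_binomCoeff_mul_pow (β : ℝ) {x : ℝ} (hx : |x| < 1) :
    HasSum (fun r => binomCoeff β r * x ^ r) ((1 - x) ^ β) := by
  have hx0 : 0 ≤ 1 - x := by linarith [le_abs_self x]
  have h := (Real.one_div_one_sub_rpow_hasFPowerSeriesOnBall_zero (-β)).hasSum (y := x)
    (by simpa [enorm_eq_nnnorm, ← NNReal.coe_lt_coe] using hx)
  simpa [FormalMultilinearSeries.ofScalars_apply_eq, ← Ring.multichoose_eq,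
    ← binomCoeff_eq_multichoose, Real.rpow_neg hx0, mul_comm] using h

theorem mul_sum_abs_binomCoeff {β : ℝ} {N : ℕ} (hN : β ≤ N) (K : ℕ) :
    β * ∑ r ∈ range K, |binomCoeff β (r + N)| =
      N * |binomCoeff β N| - (K + N : ℕ) * |binomCoeff β (K + N)| := by
  induction K with
  | zero => simp
  | succ K ih =>
    have h := congrArg abs (binomCoeff_succ β (K + N))
    rw [abs_mul, abs_mul, abs_of_nonneg (show (0 : ℝ) ≤ (K + N : ℕ) + 1 by positivity),
      abs_of_nonneg (show (0 : ℝ) ≤ (K + N : ℕ) - β by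
        push_cast; linarith [Nat.cast_nonneg (α := ℝ) K])] at h
    rw [Finset.sum_range_succ, mul_add, ih, show K + 1 + N = K + N + 1 by ring]
    push_cast at h ⊢
    linarith

theorem summable_abs_binomCoeff {β : ℝ} (hβ : 0 < β) : Summable fun r => |binomCoeff β r| := by
  obtain ⟨N, hN⟩ := exists_nat_ge β
  rw [← summable_nat_add_iff N]
  refine summable_of_sum_range_le (c := N * |binomCoeff β N| / β) (fun _ => abs_nonneg _)
    fun K => ?_
  rw [le_div_iff₀ hβ, mul_comm, mul_sum_abs_binomCoeff hN]
  have : 0 ≤ ((K + N : ℕ) : ℝ) * |binomCoeff β (K + N)| := by positivity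
  linarith

theorem exists_le_abs_add_nat {z : ℝ} (hz : ∀ r : ℕ, z + r ≠ 0) :
    ∃ δ : ℝ, 0 < δ ∧ ∀ r : ℕ, δ ≤ |z + r| := by
  have hmem : -z ∈ (Set.range ((↑) : ℕ → ℝ))ᶜ := by
    rintro ⟨r, hr⟩
    exact hz r (by linarith)
  obtain ⟨δ, hδ, hball⟩ := Metric.isOpen_iff.1
    Nat.isClosedEmbedding_coe_real.isClosed_range.isOpen_compl _ hmem
  refine ⟨δ, hδ, fun r => not_lt.1 fun h => hball ?_ ⟨r, rfl⟩⟩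
  rwa [Metric.mem_ball, Real.dist_eq, sub_neg_eq_add, add_comm]

theorem exists_le_abs_sub_int {z : ℝ} (hz : ∀ k : ℤ, z ≠ k) :
    ∃ δ : ℝ, 0 < δ ∧ ∀ k : ℤ, δ ≤ |z - k| :=
  ⟨|z - round z|, abs_pos.2 (sub_ne_zero.2 (hz _)), fun k => round_le z k⟩

theorem add_natCast_add_natCast_ne_zero {z : ℝ} (hz : ∀ r : ℕ, z + r ≠ 0) (M r : ℕ) :
    z + M + r ≠ 0 := by
  simpa [add_assoc] using hz (M + r)

theorem summable_div_add_natCast {e : ℕ → ℝ} (he : Summable fun r => |e r|) {z : ℝ}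
    (hz : ∀ r : ℕ, z + r ≠ 0) : Summable fun r : ℕ => e r / (z + r) := by
  obtain ⟨δ, hδ, h⟩ := exists_le_abs_add_nat hz
  refine .of_norm_bounded (he.div_const δ) fun r => ?_
  rw [Real.norm_eq_abs, abs_div]
  gcongr
  exact h r

/-- The partial fraction series of the beta function `B (z, β + 1)`, which continues it to all
real `z` other than `0, -1, -2, …`. -/
noncomputable def betaSeries (β z : ℝ) : ℝ := ∑' r : ℕ, binomCoeff β r / (z + r)

theorem natCast_mul_binomCoeff_div {β z : ℝ} {r : ℕ} (hz : z + r ≠ 0) :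
    r * binomCoeff β r / (z + r) = binomCoeff β r - z * (binomCoeff β r / (z + r)) := by
  field_simp
  ring

theorem summable_natCast_mul_binomCoeff_div {β z : ℝ} (hβ : 0 < β) (hz : ∀ r : ℕ, z + r ≠ 0) :
    Summable fun r : ℕ => r * binomCoeff β r / (z + r) :=
  ((summable_abs_binomCoeff hβ).of_abs.sub
    ((summable_div_add_natCast (summable_abs_binomCoeff hβ) hz).mul_left z)).congr
    fun r => (natCast_mul_binomCoeff_div (hz r)).symm

theorem mul_betaSeries {β z : ℝ} (hβ : 0 < β) (hz : ∀ r : ℕ, z + r ≠ 0) :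
    z * betaSeries β z =
      ∑' r, binomCoeff β r - ∑' r : ℕ, r * binomCoeff β r / (z + r) := by
  have hsum := summable_abs_binomCoeff hβ
  simp_rw [natCast_mul_binomCoeff_div (hz _)]
  rw [hsum.of_abs.tsum_sub ((summable_div_add_natCast hsum hz).mul_left z), tsum_mul_left,
    sub_sub_cancel, betaSeries]

theorem mul_betaSeries_eq_mul_betaSeries_add_one {β z : ℝ} (hβ : 0 < β)
    (hz : ∀ r : ℕ, z + r ≠ 0) :
    z * betaSeries β z = (z + β + 1) * betaSeries β (z + 1) := by
  have hz1 : ∀ r : ℕ, z + 1 + r ≠ 0 := by simpa using add_natCast_add_natCast_ne_zero hz 1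
  have hsum := summable_abs_binomCoeff hβ
  have hs := summable_natCast_mul_binomCoeff_div hβ hz
  have hterm (r : ℕ) : (r + 1 : ℕ) * binomCoeff β (r + 1) / (z + (r + 1 : ℕ)) =
      binomCoeff β r - (z + β + 1) * (binomCoeff β r / (z + 1 + r)) := by
    have h := hz1 r
    rw [show z + (r + 1 : ℕ) = z + 1 + r by push_cast; ring, Nat.cast_add_one, binomCoeff_succ]
    field_simp
    ring
  rw [mul_betaSeries hβ hz, hs.tsum_eq_zero_add]
  simp_rw [hterm]
  rw [hsum.of_abs.tsum_sub ((summable_div_add_natCast hsum hz1).mul_left _), tsum_mul_left,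
    Nat.cast_zero, zero_mul, zero_div, zero_add, sub_sub_cancel, betaSeries]

theorem risingFactorial_mul_betaSeries {β : ℝ} (hβ : 0 < β) {z : ℝ} (hz : ∀ r : ℕ, z + r ≠ 0)
    (M : ℕ) :
    risingFactorial z M * betaSeries β z =
      risingFactorial (β + 1 + z) M * betaSeries β (z + M) := by
  induction M with
  | zero => simp [risingFactorial_zero]
  | succ M ih =>
    have h := mul_betaSeries_eq_mul_betaSeries_add_one hβ (add_natCast_add_natCast_ne_zero hz M)
    rw [risingFactorial_succ, risingFactorial_succ, Nat.cast_add_one, ← add_assoc]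
    linear_combination (z + M) * ih + risingFactorial (β + 1 + z) M * h

end BetaSeries

section Interpolation

open Finset (range)

open scoped Nat

theorem risingFactorial_one (N : ℕ) : risingFactorial 1 N = N ! :=
  ascPochhammer_eval_one ℝ N

theorem risingFactorial_eq_prod_sub (z : ℝ) (N : ℕ) :
    risingFactorial (z + 1 - N) N = ∏ l ∈ range N, (z - l) := by
  rw [← descPochhammer_eval_eq_prod_range, descPochhammer_eval_eq_ascPochhammer, risingFactorial,
    sub_add_eq_add_sub]

theorem risingFactorial_neg (z : ℝ) (N : ℕ) :
    risingFactorial (-z) N = (-1) ^ N * risingFactorial (z + 1 - N) N := by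
  rw [risingFactorial, ascPochhammer_eval_neg_eq_descPochhammer,
    descPochhammer_eval_eq_ascPochhammer, risingFactorial, sub_add_eq_add_sub]

theorem factorial_mul_risingFactorial (N M : ℕ) :
    N ! * risingFactorial (N + 1) M = (N + M)! := by
  rw [← risingFactorial_one, ← risingFactorial_one, risingFactorial_add, add_comm (1 : ℝ)]

theorem prod_range_erase {M : Type*} [CommMonoid M] (f : ℕ → M) (i k : ℕ) :
    ∏ j ∈ (range (i + k + 1)).erase i, f j =
      (∏ j ∈ range i, f j) * ∏ j ∈ range k, f (i + 1 + j) := by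
  have hdisj : ∀ j ∈ range i, Function.update f i 1 j = f j := fun j hj =>
    Function.update_of_ne (Finset.mem_range.1 hj).ne _ _
  calc ∏ j ∈ (range (i + k + 1)).erase i, f j
      = ∏ j ∈ range (i + 1 + k), Function.update f i 1 j := by
        rw [← Finset.prod_erase (a := i) _ (Function.update_self i 1 f), add_right_comm]
        exact Finset.prod_congr rfl fun j hj =>
          (Function.update_of_ne (Finset.ne_of_mem_erase hj) _ _).symm
    _ = _ := by
        rw [Finset.prod_range_add, Finset.prod_range_succ, Function.update_self, mul_one,
          Finset.prod_congr rfl hdisj]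
        congr 1
        exact Finset.prod_congr rfl fun j _ => Function.update_of_ne (by omega) _ _

theorem nodalWeight_range_add (a : ℝ) {N i : ℕ} (hi : i ≤ N) :
    Lagrange.nodalWeight (range (N + 1)) (fun k : ℕ => a + k) i =
      (-1) ^ (N - i) / (i ! * (N - i)!) := by
  obtain ⟨M, rfl⟩ := Nat.exists_eq_add_of_le hi
  have hlow := risingFactorial_eq_prod_sub (i : ℝ) i
  rw [add_sub_cancel_left, risingFactorial_one] at hlow
  have hhigh : ∏ k ∈ range M, ((i : ℝ) - (i + 1 + k : ℕ)) = (-1) ^ M * M ! := by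
    rw [← risingFactorial_one, risingFactorial_eq_prod, ← Finset.card_range M,
      ← Finset.prod_const, Finset.card_range, ← Finset.prod_mul_distrib]
    exact Finset.prod_congr rfl fun k _ => by push_cast; ring
  simp only [Lagrange.nodalWeight, add_sub_add_left_eq_sub, Finset.prod_inv_distrib]
  rw [prod_range_erase, hhigh, ← hlow, Nat.add_sub_cancel_left]
  have hsign : ((-1 : ℝ) ^ M) ^ 2 = 1 := by rw [← pow_mul', pow_mul, neg_one_sq, one_pow]
  field_simp
  rw [hsign]

theorem eval_nodal_range_add (a x : ℝ) (N : ℕ) :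
    (Lagrange.nodal (range N) (fun k : ℕ => a + k)).eval x =
      (-1) ^ N * risingFactorial (a - x) N := by
  rw [Lagrange.eval_nodal, risingFactorial_eq_prod]
  conv_rhs => rw [← Finset.card_range N, ← Finset.prod_const, Finset.card_range]
  rw [← Finset.prod_mul_distrib]
  exact Finset.prod_congr rfl fun k _ => by ring

theorem eval_eq_sum_eval_add_natCast {p : Polynomial ℝ} {N : ℕ} (hp : p.degree < (N + 1 : ℕ))
    {a x : ℝ} (hx : ∀ i : ℕ, a - x + i ≠ 0) :
    p.eval x = ∑ i ∈ range (N + 1), p.eval (a + i) *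
      ((-1) ^ i / (i ! * (N - i)!) * (risingFactorial (a - x) (N + 1) / (a - x + i))) := by
  have hinj : Set.InjOn (fun i : ℕ => a + (i : ℝ)) (range (N + 1)) := fun _ _ _ _ h => by
    simpa using h
  have hnode : ∀ i ∈ range (N + 1), x ≠ a + i := fun i _ h => hx i (by linarith)
  conv_lhs => rw [Lagrange.eq_interpolate (f := p) hinj (by rwa [Finset.card_range]),
    Lagrange.eval_interpolate_not_at_node _ hnode, eval_nodal_range_add, Finset.mul_sum]
  refine Finset.sum_congr rfl fun i hi => ?_
  have hiN : i ≤ N := Nat.lt_succ_iff.1 (Finset.mem_range.1 hi)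
  have hsign : (-1 : ℝ) ^ (N + 1) * (-1) ^ (N - i) = -(-1) ^ i := by
    obtain ⟨M, rfl⟩ := Nat.exists_eq_add_of_le hiN
    rw [Nat.add_sub_cancel_left, ← pow_add, show i + M + 1 + M = i + 1 + 2 * M by ring, pow_add,
      pow_mul, neg_one_sq, one_pow, pow_succ]
    ring
  rw [nodalWeight_range_add a hiN, ← neg_sub (a + (i : ℝ)) x, add_sub_right_comm, inv_neg]
  linear_combination (-(risingFactorial (a - x) (N + 1) / (i ! * (N - i)!) *
    (a - x + i)⁻¹ * p.eval (a + i))) * hsign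

/-- The polynomial `(z)_j (z + j + β + 1)_{N - j}`. Up to the factor `interpConst β N z`, which
does not depend on `j`, its value is `betaSeries β (z + j)`; interpolating it at the nodes
`α + 1 + i` inverts the Hankel matrix at `t = 0`. -/
noncomputable def interpPoly (β : ℝ) (N j : ℕ) : Polynomial ℝ :=
  ascPochhammer ℝ j *
    (ascPochhammer ℝ (N - j)).comp (Polynomial.X + Polynomial.C (j + (β + 1)))

/-- The common factor of the values `betaSeries β (z + j)` for `j ≤ N`; see `interpPoly`. -/
noncomputable def interpConst (β : ℝ) (N : ℕ) (z : ℝ) : ℝ :=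
  betaSeries β (z + N) / risingFactorial z N

theorem eval_interpPoly (β : ℝ) (N j : ℕ) (z : ℝ) :
    (interpPoly β N j).eval z =
      risingFactorial z j * risingFactorial (β + 1 + (z + j)) (N - j) := by
  simp only [interpPoly, Polynomial.eval_mul, Polynomial.eval_comp, Polynomial.eval_add,
    Polynomial.eval_X, Polynomial.eval_C, risingFactorial]
  rw [← add_assoc z, add_comm (β + 1)]

theorem degree_interpPoly_lt (β : ℝ) {N j : ℕ} (hj : j ≤ N) :
    (interpPoly β N j).degree < (N + 1 : ℕ) := by
  refine Polynomial.degree_le_natDegree.trans_lt (Nat.cast_lt.2 (Nat.lt_succ_of_le ?_))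
  refine Polynomial.natDegree_mul_le.trans ?_
  rw [Polynomial.natDegree_comp, Polynomial.natDegree_X_add_C, ascPochhammer_natDegree,
    ascPochhammer_natDegree]
  omega

theorem betaSeries_eq_interpConst_mul {β z : ℝ} (hβ : 0 < β) (hz : ∀ r : ℕ, z + r ≠ 0) {N j : ℕ}
    (hj : j ≤ N) :
    betaSeries β (z + j) = interpConst β N z * (interpPoly β N j).eval z := by
  obtain ⟨M, rfl⟩ := Nat.exists_eq_add_of_le hj
  have h := risingFactorial_mul_betaSeries hβ (add_natCast_add_natCast_ne_zero hz j) M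
  have hj0 := risingFactorial_ne_zero hz j
  have hM0 := risingFactorial_ne_zero (add_natCast_add_natCast_ne_zero hz j) M
  rw [interpConst, eval_interpPoly, risingFactorial_add, Nat.add_sub_cancel_left, Nat.cast_add,
    ← add_assoc z]
  field_simp
  linear_combination h

theorem risingFactorial_mul_interpConst {β z : ℝ} (hβ : 0 < β) (hz : ∀ r : ℕ, z + r ≠ 0)
    (N M : ℕ) :
    risingFactorial z M * interpConst β N z =
      risingFactorial (β + 1 + (z + N)) M * interpConst β N (z + M) := by
  have h := risingFactorial_mul_betaSeries hβ (add_natCast_add_natCast_ne_zero hz N) M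
  have hN0 := risingFactorial_ne_zero hz N
  have hNM := risingFactorial_ne_zero (add_natCast_add_natCast_ne_zero hz M) N
  have hcomm : risingFactorial z N * risingFactorial (z + N) M =
      risingFactorial z M * risingFactorial (z + M) N := by
    rw [← risingFactorial_add, add_comm, risingFactorial_add]
  rw [interpConst, interpConst, add_right_comm z]
  field_simp
  linear_combination risingFactorial z N * h - betaSeries β (z + N) * hcomm

theorem factorial_mul_risingFactorial_neg_add (j r : ℕ) :
    r ! * risingFactorial (-(j + r : ℕ)) j = (-1) ^ j * (j + r)! := by
  rw [risingFactorial_neg, Nat.cast_add, show (j : ℝ) + r + 1 - j = r + 1 by ring, add_comm j,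
    ← factorial_mul_risingFactorial]
  ring

theorem binomCoeff_mul_risingFactorial (β : ℝ) (r N : ℕ) :
    r ! * binomCoeff β r * risingFactorial (β + 1) N =
      (-1) ^ r * risingFactorial (β + 1 - r) (r + N) := by
  rw [factorial_mul_binomCoeff, risingFactorial_neg, risingFactorial_add, sub_add_cancel, mul_assoc]

-- At `z = -R` the interpolated polynomial is, as a function of `j`, the sequence
-- `binomCoeff β (R - j)` that the singular terms of the moments carry.
theorem binomCoeff_mul_eq_eval_interpPoly (β : ℝ) {N j : ℕ} (hj : j ≤ N) (R : ℕ) :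
    (if j ≤ R then binomCoeff β (R - j) else 0) * risingFactorial (β + 1) N =
      (interpPoly β N j).eval (-R : ℝ) *
        ((-1) ^ R / R ! * risingFactorial (β + N + 1 - R) R) := by
  split_ifs with hR
  · obtain ⟨r, rfl⟩ := Nat.exists_eq_add_of_le hR
    obtain ⟨M, rfl⟩ := Nat.exists_eq_add_of_le' hj
    have hbinom := binomCoeff_mul_risingFactorial β r (M + j)
    have hfact := factorial_mul_risingFactorial_neg_add j r
    rw [eval_interpPoly, Nat.add_sub_cancel, Nat.add_sub_cancel_left,
      show β + 1 + (-((j + r : ℕ) : ℝ) + j) = β + 1 - r by push_cast; ring,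
      show β + (M + j : ℕ) + 1 - (j + r : ℕ) = β + 1 - r + M by push_cast; ring]
    rw [show r + (M + j) = M + (j + r) by ring, risingFactorial_add (β + 1 - r)] at hbinom
    have hsign : (-1 : ℝ) ^ (j + r) * (-1) ^ j = (-1) ^ r := by
      rw [← pow_add, show j + r + j = r + 2 * j by ring, pow_add, pow_mul, neg_one_sq, one_pow,
        mul_one]
    field_simp
    refine mul_left_cancel₀ (a := (r ! : ℝ)) (by positivity) ?_
    linear_combination ((j + r)! : ℝ) * hbinom
      - (-1) ^ (j + r) * risingFactorial (β + 1 - r) M *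
        risingFactorial (β + 1 - r + M) (j + r) * hfact
      - (j + r)! * risingFactorial (β + 1 - r) M *
        risingFactorial (β + 1 - r + M) (j + r) * hsign
  · have hzero : risingFactorial (-(R : ℝ)) j = 0 := by
      rw [risingFactorial_eq_prod]
      exact Finset.prod_eq_zero (i := R) (by simpa using hR) (neg_add_cancel _)
    rw [eval_interpPoly, hzero, zero_mul, zero_mul, zero_mul]

end Interpolation

section IncompleteGamma

open MeasureTheory

open scoped Nat

theorem continuousOn_rpow_mul_exp_neg_div {c w : ℝ} (hc : c ≠ 0) (hw : 0 < w) :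
    ContinuousOn (fun x : ℝ => x ^ c * Real.exp (-w / x)) (Set.Ici 0) := by
  intro x hx
  rcases (Set.mem_Ici.1 hx).eq_or_lt with rfl | hx
  · rw [← continuousWithinAt_Ioi_iff_Ici]
    have h : Tendsto (fun x : ℝ => x ^ c * Real.exp (-w / x)) (𝓝[>] 0) (𝓝 0) := by
      refine ((tendsto_rpow_mul_exp_neg_mul_atTop_nhds_zero (-c) w hw).comp
        tendsto_inv_nhdsGT_zero).congr' ?_
      filter_upwards [self_mem_nhdsWithin] with x hx
      simp only [Function.comp]
      rw [Real.inv_rpow (le_of_lt hx), Real.rpow_neg (le_of_lt hx), inv_inv, div_eq_mul_inv]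
    simpa [ContinuousWithinAt, Real.zero_rpow hc] using h
  · refine ContinuousAt.continuousWithinAt ?_
    exact (Real.continuousAt_rpow_const _ _ (Or.inl hx.ne')).mul
      (Real.continuous_exp.continuousAt.comp (continuousAt_const.div continuousAt_id hx.ne'))

theorem intervalIntegrable_rpow_mul_exp_neg_div {c w : ℝ} (hc : c ≠ 0) (hw : 0 < w) :
    IntervalIntegrable (fun x : ℝ => x ^ c * Real.exp (-w / x)) volume 0 1 :=
  ((continuousOn_rpow_mul_exp_neg_div hc hw).mono (by
    rw [Set.uIcc_of_le zero_le_one]; exact Set.Icc_subset_Ici_self)).intervalIntegrable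

theorem hasDerivAt_const_div (w : ℝ) {x : ℝ} (hx : x ≠ 0) :
    HasDerivAt (fun x : ℝ => w / x) (-(w / x ^ 2)) x := by
  simpa [div_eq_mul_inv] using (hasDerivAt_inv hx).const_mul w

theorem hasDerivAt_exp_neg_div (w : ℝ) {x : ℝ} (hx : x ≠ 0) :
    HasDerivAt (fun x : ℝ => Real.exp (-w / x)) (Real.exp (-w / x) * (w / x ^ 2)) x := by
  simpa [neg_div] using (hasDerivAt_const_div (-w) hx).exp

theorem hasSum_pow_neg_div_factorial (u : ℝ) :
    HasSum (fun m : ℕ => (-u) ^ m / m !) (Real.exp (-u)) := by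
  rw [Real.exp_eq_exp_ℝ]
  exact NormedSpace.expSeries_div_hasSum_exp (-u)

theorem integral_rpow_mul_pow_neg_div_factorial {a w : ℝ} (ha : 0 < a) (hw : 0 ≤ w) (m : ℕ) :
    ∫ u in (0 : ℝ)..w, u ^ (a - 1) * ((-u) ^ m / m !) =
      (-1) ^ m * w ^ m / (m ! * (a + m)) * w ^ a := by
  have hterm : ∀ u ∈ Set.uIoc 0 w,
      u ^ (a - 1) * ((-u) ^ m / m !) = (-1) ^ m / m ! * u ^ (a - 1 + m) := by
    intro u hu
    rw [Set.uIoc_of_le hw] at hu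
    rw [Real.rpow_add_natCast hu.1.ne', neg_pow]
    ring
  have h0 : a + m ≠ 0 := by positivity
  rw [intervalIntegral.integral_congr_ae (.of_forall hterm), intervalIntegral.integral_const_mul,
    integral_rpow (Or.inl (by linarith [Nat.cast_nonneg (α := ℝ) m])),
    show a - 1 + m + 1 = a + m by ring, Real.zero_rpow h0, Real.rpow_add_natCast' hw h0]
  field_simp
  ring

theorem hasSum_integral_rpow_mul_exp_neg {a w : ℝ} (ha : 0 < a) (hw : 0 ≤ w) :
    HasSum (fun m : ℕ => (-1) ^ m * w ^ m / (m ! * (a + m)) * w ^ a)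
      (∫ u in (0 : ℝ)..w, u ^ (a - 1) * Real.exp (-u)) := by
  simp_rw [← integral_rpow_mul_pow_neg_div_factorial ha hw]
  refine intervalIntegral.hasSum_integral_of_dominated_convergence
    (fun (m : ℕ) u => u ^ (a - 1) * (w ^ m / m !)) (fun m => ?_) (fun m => ?_) ?_ ?_ ?_
  · exact Measurable.aestronglyMeasurable (by fun_prop)
  · refine .of_forall fun u hu => ?_
    rw [Set.uIoc_of_le hw] at hu
    have hu0 := hu.1.le
    rw [norm_mul, norm_div, norm_pow, norm_neg, Real.norm_of_nonneg (Real.rpow_nonneg hu0 _),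
      Real.norm_of_nonneg hu0, Real.norm_natCast]
    gcongr
    exact hu.2
  · exact .of_forall fun u _ => (Real.summable_pow_div_factorial w).mul_left _
  · simp_rw [tsum_mul_left]
    exact (intervalIntegral.intervalIntegrable_rpow' (by linarith)).mul_const _
  · exact .of_forall fun u _ => (hasSum_pow_neg_div_factorial u).mul_left _

theorem tendsto_integral_rpow_mul_exp_neg {a : ℝ} (ha : 0 < a) :
    Tendsto (fun w : ℝ => ∫ u in (0 : ℝ)..w, u ^ (a - 1) * Real.exp (-u)) atTop
      (𝓝 (Real.Gamma a)) := by
  rw [Real.Gamma_eq_integral ha]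
  have h := intervalIntegral_tendsto_integral_Ioi 0 (Real.GammaIntegral_convergent ha) tendsto_id
  simpa only [mul_comm (Real.exp _), id] using h

theorem hasDerivAt_integral_rpow_mul_exp_neg {a y : ℝ} (ha : 0 < a) (hy : 0 < y) :
    HasDerivAt (fun y : ℝ => ∫ u in (0 : ℝ)..y, u ^ (a - 1) * Real.exp (-u))
      (y ^ (a - 1) * Real.exp (-y)) y := by
  refine intervalIntegral.integral_hasDerivAt_right
    ((intervalIntegral.intervalIntegrable_rpow' (by linarith)).mul_continuousOn (by fun_prop)) ?_ ?_
  · exact (Measurable.stronglyMeasurable (by fun_prop)).stronglyMeasurableAtFilter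
  · exact (Real.continuousAt_rpow_const _ _ (Or.inl hy.ne')).mul (by fun_prop)

-- The substitution `u = w / x`, carried out on antiderivatives.
theorem integral_rpow_mul_exp_neg_div {c w : ℝ} (hc : c < -1) (hw : 0 < w) :
    ∫ x in (0 : ℝ)..1, x ^ c * Real.exp (-w / x) =
      w ^ (c + 1) * Real.Gamma (-c - 1) -
        w ^ (c + 1) * ∫ u in (0 : ℝ)..w, u ^ (-c - 1 - 1) * Real.exp (-u) := by
  have ha : 0 < -c - 1 := by linarith
  set P : ℝ → ℝ := fun y => ∫ u in (0 : ℝ)..y, u ^ (-c - 1 - 1) * Real.exp (-u)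
  have hderiv : ∀ x ∈ Set.Ioo (0 : ℝ) 1, HasDerivAt (fun x => -w ^ (c + 1) * P (w / x))
      (x ^ c * Real.exp (-w / x)) x := by
    intro x hx
    have hx0 := hx.1
    have h := ((hasDerivAt_integral_rpow_mul_exp_neg ha (div_pos hw hx0)).comp x
      (hasDerivAt_const_div w hx0.ne')).const_mul (-w ^ (c + 1))
    convert! h using 1
    have hpow : (w / x) ^ (-c - 1 - 1) = w⁻¹ * (w ^ (c + 1))⁻¹ * (x ^ c * x ^ 2) := by
      rw [show -c - 1 - 1 = -(c + 1) + -1 by ring, Real.rpow_add (by positivity),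
        Real.rpow_neg_one, Real.rpow_neg (by positivity), Real.div_rpow hw.le hx0.le,
        Real.rpow_add_one hx0.ne']
      field_simp
    rw [hpow, neg_div]
    field_simp
  have hzero : Tendsto (fun x => -w ^ (c + 1) * P (w / x)) (𝓝[>] 0)
      (𝓝 (-w ^ (c + 1) * Real.Gamma (-c - 1))) := by
    refine Tendsto.const_mul _ ((tendsto_integral_rpow_mul_exp_neg ha).comp ?_)
    exact (tendsto_inv_nhdsGT_zero.const_mul_atTop hw).congr fun x => (div_eq_mul_inv w x).symm
  have hone : Tendsto (fun x => -w ^ (c + 1) * P (w / x)) (𝓝[<] 1)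
      (𝓝 (-w ^ (c + 1) * P (w / 1))) := by
    refine Tendsto.const_mul _ (Tendsto.mono_left ?_ nhdsWithin_le_nhds)
    exact ((hasDerivAt_integral_rpow_mul_exp_neg ha (by simpa using hw)).continuousAt.tendsto).comp
      (continuousAt_const.div continuousAt_id one_ne_zero)
  rw [intervalIntegral.integral_eq_sub_of_hasDerivAt_of_tendsto one_pos hderiv
    (intervalIntegrable_rpow_mul_exp_neg_div (by linarith) hw) hzero hone, div_one]
  ring

theorem integral_rpow_mul_exp_neg_div_recurrence {c w : ℝ} (hc : ∀ k : ℤ, c ≠ k) (hw : 0 < w) :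
    (c + 1) * (∫ x in (0 : ℝ)..1, x ^ c * Real.exp (-w / x)) +
      w * (∫ x in (0 : ℝ)..1, x ^ (c - 1) * Real.exp (-w / x)) = Real.exp (-w) := by
  have h0 : c ≠ 0 := by simpa using hc 0
  have h1 : c - 1 ≠ 0 := fun h => hc 1 (by push_cast; linarith)
  have h2 : c + 1 ≠ 0 := fun h => hc (-1) (by push_cast; linarith)
  have i0 := (intervalIntegrable_rpow_mul_exp_neg_div h0 hw).const_mul (c + 1)
  have i1 := (intervalIntegrable_rpow_mul_exp_neg_div h1 hw).const_mul w
  have hderiv : ∀ x ∈ Set.Ioo (0 : ℝ) 1, HasDerivAt (fun x => x ^ (c + 1) * Real.exp (-w / x))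
      ((c + 1) * (x ^ c * Real.exp (-w / x)) + w * (x ^ (c - 1) * Real.exp (-w / x))) x := by
    intro x hx
    have hx0 := hx.1
    have h := (Real.hasDerivAt_rpow_const (p := c + 1) (Or.inl hx0.ne')).mul
      (hasDerivAt_exp_neg_div w hx0.ne')
    convert! h using 1
    rw [show c + 1 - 1 = c by ring, Real.rpow_add_one hx0.ne', Real.rpow_sub_one hx0.ne']
    field_simp
  rw [← intervalIntegral.integral_const_mul, ← intervalIntegral.integral_const_mul,
    ← intervalIntegral.integral_add i0 i1,
    intervalIntegral.integral_eq_sub_of_hasDerivAt_of_le zero_le_one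
      ((continuousOn_rpow_mul_exp_neg_div h2 hw).mono Set.Icc_subset_Ici_self) hderiv (i0.add i1)]
  simp [Real.zero_rpow h2]

theorem hasSum_integral_rpow_mul_exp_neg_div_of_lt {c w : ℝ} (hc : c < -1) (hw : 0 < w) :
    HasSum (fun m : ℕ => (-1) ^ m * w ^ m / (m ! * (c + 1 - m)))
      ((∫ x in (0 : ℝ)..1, x ^ c * Real.exp (-w / x)) - w ^ (c + 1) * Real.Gamma (-c - 1)) := by
  have ha : 0 < -c - 1 := by linarith
  have h := (hasSum_integral_rpow_mul_exp_neg ha hw.le).mul_left (-w ^ (c + 1))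
  convert! h using 1
  · ext m
    have hinv : w ^ (-c - 1) = (w ^ (c + 1))⁻¹ := by rw [← Real.rpow_neg hw.le]; ring_nf
    have hpow : w ^ (c + 1) ≠ 0 := by positivity
    have hden : -c - 1 + m ≠ 0 := by positivity
    rw [hinv, show c + 1 - m = -(-c - 1 + m) by ring]
    field_simp
  · rw [integral_rpow_mul_exp_neg_div hc hw]
    ring

theorem hasSum_integral_rpow_mul_exp_neg_div_of_sub_one {c w : ℝ} (hc : ∀ k : ℤ, c ≠ k)
    (hw : 0 < w)
    (h : HasSum (fun m : ℕ => (-1) ^ m * w ^ m / (m ! * (c - m)))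
      ((∫ x in (0 : ℝ)..1, x ^ (c - 1) * Real.exp (-w / x)) - w ^ c * Real.Gamma (-c))) :
    HasSum (fun m : ℕ => (-1) ^ m * w ^ m / (m ! * (c + 1 - m)))
      ((∫ x in (0 : ℝ)..1, x ^ c * Real.exp (-w / x)) - w ^ (c + 1) * Real.Gamma (-c - 1)) := by
  have hc1 : c + 1 ≠ 0 := fun h => hc (-1) (by push_cast; linarith)
  have hrec := integral_rpow_mul_exp_neg_div_recurrence hc hw
  have hΓ : Real.Gamma (-c) = (-c - 1) * Real.Gamma (-c - 1) := by
    simpa using Real.Gamma_add_one (s := -c - 1) fun h => hc1 (by linarith)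
  have hexp := hasSum_pow_neg_div_factorial w
  rw [← hasSum_nat_add_iff' 1] at hexp ⊢
  convert! (hexp.sub (h.mul_left w)).div_const (c + 1) using 1
  · ext m
    have hcm : c - m ≠ 0 := fun h => hc m (by push_cast; linarith)
    rw [show c + 1 - (m + 1 : ℕ) = c - m by push_cast; ring, Nat.factorial_succ, neg_pow w,
      pow_succ, pow_succ]
    push_cast
    field_simp
    ring
  · rw [hΓ, Real.rpow_add_one hw.ne', eq_div_iff hc1, ← hrec]
    simp only [Finset.range_one, Finset.sum_singleton, pow_zero, Nat.factorial_zero, Nat.cast_one,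
      Nat.cast_zero, sub_zero, one_mul, div_one]
    field_simp
    ring

theorem hasSum_integral_rpow_mul_exp_neg_div {c w : ℝ} (hc : ∀ k : ℤ, c ≠ k) (hw : 0 < w) :
    HasSum (fun m : ℕ => (-1) ^ m * w ^ m / (m ! * (c + 1 - m)))
      ((∫ x in (0 : ℝ)..1, x ^ c * Real.exp (-w / x)) - w ^ (c + 1) * Real.Gamma (-c - 1)) := by
  obtain ⟨N, hN⟩ := exists_nat_gt (c + 1)
  induction N generalizing c with
  | zero =>
    exact hasSum_integral_rpow_mul_exp_neg_div_of_lt (by push_cast at hN; linarith) hw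
  | succ N ih =>
    refine hasSum_integral_rpow_mul_exp_neg_div_of_sub_one hc hw ?_
    have h := ih (c := c - 1) (fun k hk => hc (k + 1) (by push_cast; linarith))
      (by push_cast at hN; linarith)
    rwa [sub_add_cancel, neg_sub, sub_right_comm, sub_self, zero_sub] at h

end IncompleteGamma

section TruncatedMoments

open Finset (range)
open MeasureTheory

open scoped Nat

/-- `exp (-y)` times the Taylor polynomial of degree `k` of `exp y`. The column operations
`x ^ k ↦ ∑ m ≤ k, t ^ (k - m) / (k - m)! * x ^ m` turn the factor `exp (-t / x)` of the moments
into `truncExp k (t / x)`, which differs from `1` only by `O(t ^ (k + 1))`. -/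
noncomputable def truncExp (k : ℕ) (y : ℝ) : ℝ :=
  Real.exp (-y) * ∑ m ∈ range (k + 1), y ^ m / m !

theorem continuous_truncExp (k : ℕ) : Continuous (truncExp k) := by
  unfold truncExp
  fun_prop

theorem measurable_truncExp_div (k : ℕ) (t : ℝ) : Measurable fun x => truncExp k (t / x) :=
  (continuous_truncExp k).measurable.comp (by fun_prop)

theorem truncExp_zero (k : ℕ) : truncExp k 0 = 1 := by
  simp [truncExp, Finset.sum_range_succ']

theorem truncExp_nonneg (k : ℕ) {y : ℝ} (hy : 0 ≤ y) : 0 ≤ truncExp k y :=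
  mul_nonneg (Real.exp_pos _).le (Finset.sum_nonneg fun _ _ => by positivity)

theorem truncExp_le_one (k : ℕ) {y : ℝ} (hy : 0 ≤ y) : truncExp k y ≤ 1 := by
  rw [truncExp, Real.exp_neg]
  exact inv_mul_le_one_of_le₀ (Real.sum_le_exp_of_nonneg hy _) (Real.exp_pos y).le

theorem abs_truncExp_div_le_one (k : ℕ) {t x : ℝ} (ht : 0 ≤ t) (hx : 0 ≤ x) :
    |truncExp k (t / x)| ≤ 1 := by
  rw [abs_of_nonneg (truncExp_nonneg k (by positivity))]
  exact truncExp_le_one k (by positivity)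

theorem hasDerivAt_truncExp (k : ℕ) (y : ℝ) :
    HasDerivAt (truncExp k) (-(y ^ k / k ! * Real.exp (-y))) y := by
  have hexp : HasDerivAt (fun y : ℝ => Real.exp (-y)) (-Real.exp (-y)) y := by
    simpa using (hasDerivAt_neg y).exp
  induction k with
  | zero =>
    have h0 : truncExp 0 = fun y => Real.exp (-y) := by ext y; simp [truncExp]
    simpa [h0] using hexp
  | succ k ih =>
    have hsucc : truncExp (k + 1) = fun y => truncExp k y +
        Real.exp (-y) * (y ^ (k + 1) / (k + 1)!) := by
      ext y
      rw [truncExp, truncExp, Finset.sum_range_succ _ (k + 1), mul_add]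
    rw [hsucc]
    convert! ih.add (hexp.mul ((hasDerivAt_pow (k + 1) y).div_const ((k + 1)! : ℝ))) using 1
    rw [Nat.factorial_succ]
    push_cast
    field_simp
    ring

theorem integral_pow_mul_exp_neg (k : ℕ) (t : ℝ) :
    ∫ u in (0 : ℝ)..t, u ^ k * Real.exp (-u) = k ! * (1 - truncExp k t) := by
  have h := intervalIntegral.integral_eq_sub_of_hasDerivAt (a := 0) (b := t)
    (fun y _ => hasDerivAt_truncExp k y) (Continuous.intervalIntegrable (by fun_prop) _ _)
  rw [truncExp_zero, intervalIntegral.integral_neg] at h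
  rw [← neg_sub, ← h, neg_neg, ← intervalIntegral.integral_const_mul]
  refine intervalIntegral.integral_congr fun u _ => ?_
  have hk : (k ! : ℝ) ≠ 0 := by positivity
  field_simp

theorem hasSum_one_sub_truncExp (k : ℕ) {t : ℝ} (ht : 0 ≤ t) :
    HasSum (fun m : ℕ => (-1) ^ m * t ^ (k + m + 1) / (k ! * (m ! * (k + m + 1))))
      (1 - truncExp k t) := by
  have hk : (k ! : ℝ) ≠ 0 := by positivity
  have h := (hasSum_integral_rpow_mul_exp_neg (a := k + 1) (by positivity) ht).div_const (k ! : ℝ)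
  simp only [add_sub_cancel_right, Real.rpow_natCast] at h
  rw [integral_pow_mul_exp_neg, mul_div_cancel_left₀ _ hk] at h
  convert! h using 2 with m
  have h1 : (k : ℝ) + 1 + m ≠ 0 := by positivity
  rw [← Nat.cast_add_one, Real.rpow_natCast, show k + m + 1 = m + (k + 1) by ring, pow_add t m,
    add_right_comm (k : ℝ)]
  push_cast
  field_simp

theorem intervalIntegrable_rpow_mul_truncExp {k : ℕ} {b t : ℝ} (hb : 0 ≤ b) (ht : 0 ≤ t) :
    IntervalIntegrable (fun x : ℝ => x ^ b * truncExp k (t / x)) volume 0 1 := by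
  have hone : IntervalIntegrable (fun _ : ℝ => (1 : ℝ)) volume 0 1 := by simp
  refine hone.mono_fun ?_ ?_
  · have := measurable_truncExp_div k t
    exact Measurable.aestronglyMeasurable (by fun_prop)
  · filter_upwards [ae_restrict_mem measurableSet_uIoc] with x hx
    rw [Set.uIoc_of_le zero_le_one] at hx
    rw [norm_one, norm_mul, Real.norm_of_nonneg (Real.rpow_nonneg hx.1.le _)]
    exact mul_le_one₀ (Real.rpow_le_one hx.1.le hx.2 hb) (norm_nonneg _)
      (abs_truncExp_div_le_one k ht hx.1.le)

theorem hasDerivAt_rpow_mul_truncExp (k : ℕ) (c t : ℝ) {x : ℝ} (hx : 0 < x) :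
    HasDerivAt (fun x => x ^ (c + k + 2) * truncExp k (t / x))
      ((c + k + 2) * (x ^ (c + k + 1) * truncExp k (t / x)) +
        t ^ (k + 1) / k ! * (x ^ c * Real.exp (-t / x))) x := by
  have h := (Real.hasDerivAt_rpow_const (p := c + k + 2) (Or.inl hx.ne')).mul
    ((hasDerivAt_truncExp k (t / x)).comp x (hasDerivAt_const_div t hx.ne'))
  convert! h using 1
  rw [show c + k + 2 - 1 = c + k + 1 by ring, show c + k + 2 = c + ((k + 2 : ℕ) : ℝ) by
    push_cast; ring, Real.rpow_add_natCast hx.ne', div_pow, neg_div]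
  simp only [Function.comp]
  field_simp
  push_cast
  ring

theorem tendsto_rpow_mul_truncExp_zero (k : ℕ) {b t : ℝ} (hb : 0 < b) (ht : 0 ≤ t) :
    Tendsto (fun x : ℝ => x ^ b * truncExp k (t / x)) (𝓝[>] 0) (𝓝 0) := by
  refine squeeze_zero_norm' (a := fun x : ℝ => x ^ b) ?_ ?_
  · filter_upwards [self_mem_nhdsWithin] with x hx
    have hx : 0 < x := hx
    rw [norm_mul, Real.norm_of_nonneg (Real.rpow_nonneg hx.le _)]
    exact mul_le_of_le_one_right (by positivity) (abs_truncExp_div_le_one k ht hx.le)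
  · have h := (Real.continuousAt_rpow_const 0 b (Or.inr hb.le)).tendsto
    rw [Real.zero_rpow hb.ne'] at h
    exact h.mono_left nhdsWithin_le_nhds

theorem tendsto_rpow_mul_truncExp_one (k : ℕ) (b t : ℝ) :
    Tendsto (fun x : ℝ => x ^ b * truncExp k (t / x)) (𝓝[<] 1) (𝓝 (truncExp k t)) := by
  have h : ContinuousAt (fun x : ℝ => x ^ b * truncExp k (t / x)) 1 :=
    (Real.continuousAt_rpow_const _ _ (Or.inl one_ne_zero)).mul
      ((continuous_truncExp k).continuousAt.comp
        (continuousAt_const.div continuousAt_id one_ne_zero))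
  simpa using h.tendsto.mono_left nhdsWithin_le_nhds

theorem integral_rpow_mul_truncExp (k : ℕ) {c t : ℝ} (hc1 : -1 < c) (hc0 : c ≠ 0) (ht : 0 < t) :
    (c + k + 2) * ∫ x in (0 : ℝ)..1, x ^ (c + k + 1) * truncExp k (t / x) =
      truncExp k t - t ^ (k + 1) / k ! * ∫ x in (0 : ℝ)..1, x ^ c * Real.exp (-t / x) := by
  have i0 := (intervalIntegrable_rpow_mul_truncExp (k := k) (b := c + k + 1) (t := t)
    (by linarith) ht.le).const_mul (c + k + 2)
  have i1 := (intervalIntegrable_rpow_mul_exp_neg_div hc0 ht).const_mul (t ^ (k + 1) / k !)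
  rw [eq_sub_iff_add_eq, ← intervalIntegral.integral_const_mul,
    ← intervalIntegral.integral_const_mul, ← intervalIntegral.integral_add i0 i1,
    intervalIntegral.integral_eq_sub_of_hasDerivAt_of_tendsto one_pos
      (fun x hx => hasDerivAt_rpow_mul_truncExp k c t hx.1) (i0.add i1)
      (tendsto_rpow_mul_truncExp_zero k (by linarith) ht.le)
      (tendsto_rpow_mul_truncExp_one k _ t), sub_zero]

theorem hasSum_integral_rpow_mul_truncExp (k : ℕ) {c t : ℝ} (hc1 : -1 < c) (hc : ∀ k : ℤ, c ≠ k)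
    (ht : 0 < t) :
    HasSum (fun m : ℕ => (-1) ^ m * t ^ (k + m + 1) / (k ! * (m ! * (k + m + 1))) / (c + 1 - m))
      (1 / (c + k + 2) - (∫ x in (0 : ℝ)..1, x ^ (c + k + 1) * truncExp k (t / x)) -
        t ^ (c + k + 2) * Real.Gamma (-c - 1) / ((c + k + 2) * k !)) := by
  have hck : c + k + 2 ≠ 0 := by linarith
  have h := ((hasSum_one_sub_truncExp k ht.le).add
    ((hasSum_integral_rpow_mul_exp_neg_div hc ht).mul_left (t ^ (k + 1) / k !))).div_const
    (c + k + 2)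
  convert! h using 1
  · ext m
    have hcm : c + 1 - m ≠ 0 := fun h => hc (m - 1) (by push_cast; linarith)
    have hkm : (k : ℝ) + m + 1 ≠ 0 := by positivity
    rw [show k + m + 1 = (k + 1) + m by ring, pow_add t (k + 1)]
    field_simp
    ring
  · have hI := integral_rpow_mul_truncExp k hc1 (by simpa using hc 0) ht
    have hpow : t ^ (c + k + 2) = t ^ (c + 1) * t ^ (k + 1) := by
      rw [← Real.rpow_natCast, ← Real.rpow_add ht]; push_cast; ring_nf
    rw [hpow, eq_div_iff hck]
    field_simp at hI ⊢
    linear_combination -hI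

theorem hasSum_integral_binomial {a β : ℝ} (ha : 0 ≤ a) (hβ : 0 < β) {g : ℝ → ℝ}
    (hg : Measurable g) (hg1 : ∀ x, 0 ≤ x → |g x| ≤ 1) :
    HasSum (fun r : ℕ => binomCoeff β r * ∫ x in (0 : ℝ)..1, x ^ (a + r) * g x)
      (∫ x in (0 : ℝ)..1, x ^ a * (1 - x) ^ β * g x) := by
  simp_rw [← intervalIntegral.integral_const_mul]
  refine intervalIntegral.hasSum_integral_of_dominated_convergence
    (fun (r : ℕ) _ => |binomCoeff β r|) (fun r => ?_) (fun r => ?_) ?_ ?_ ?_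
  · exact Measurable.aestronglyMeasurable (by fun_prop)
  · refine .of_forall fun x hx => ?_
    rw [Set.uIoc_of_le zero_le_one] at hx
    rw [norm_mul, norm_mul, Real.norm_eq_abs, Real.norm_of_nonneg (Real.rpow_nonneg hx.1.le _)]
    exact mul_le_of_le_one_right (abs_nonneg _) (mul_le_one₀
      (Real.rpow_le_one hx.1.le hx.2 (by positivity)) (norm_nonneg _) (hg1 x hx.1.le))
  · exact .of_forall fun _ _ => summable_abs_binomCoeff hβ
  · simp
  · have hne : ∀ᵐ x : ℝ, x ≠ 1 := by simp [ae_iff, measure_singleton]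
    filter_upwards [hne] with x hx1 hx
    rw [Set.uIoc_of_le zero_le_one] at hx
    have hlt : |x| < 1 := by
      rw [abs_of_pos hx.1]
      exact hx.2.lt_of_ne hx1
    convert! ((hasSum_binomCoeff_mul_pow β hlt).mul_left (x ^ a)).mul_right (g x) using 2 with r
    rw [Real.rpow_add_natCast hx.1.ne']
    ring

theorem integral_rpow_mul_one_sub_rpow {a β : ℝ} (ha : 0 ≤ a) (hβ : 0 < β) :
    ∫ x in (0 : ℝ)..1, x ^ a * (1 - x) ^ β = betaSeries β (a + 1) := by
  have h := hasSum_integral_binomial ha hβ (g := fun _ => 1) measurable_const (by simp)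
  simp only [mul_one] at h
  rw [← h.tsum_eq, betaSeries]
  refine tsum_congr fun r => ?_
  rw [integral_rpow (Or.inl (by linarith)), Real.one_rpow, Real.zero_rpow (by linarith),
    show a + r + 1 = a + 1 + r by ring]
  ring

theorem betaSeries_eq_Gamma {β z : ℝ} (hβ : 0 < β) (hz : 1 ≤ z) :
    betaSeries β z = Real.Gamma z * Real.Gamma (β + 1) / Real.Gamma (z + (β + 1)) := by
  have hofReal : ∫ x in (0 : ℝ)..1, (x : ℂ) ^ ((z : ℂ) - 1) *
        (1 - (x : ℂ)) ^ (((β + 1 : ℝ) : ℂ) - 1) =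
      ((∫ x in (0 : ℝ)..1, x ^ (z - 1) * (1 - x) ^ β : ℝ) : ℂ) := by
    rw [← intervalIntegral.integral_ofReal]
    refine intervalIntegral.integral_congr fun x hx => ?_
    rw [Set.uIcc_of_le zero_le_one] at hx
    rw [Complex.ofReal_mul, Complex.ofReal_cpow hx.1, Complex.ofReal_cpow (by linarith [hx.2])]
    push_cast
    rw [add_sub_cancel_right]
  change _ = ProbabilityTheory.beta z (β + 1)
  rw [ProbabilityTheory.beta_eq_betaIntegralReal z (β + 1) (by linarith) (by linarith),
    Complex.betaIntegral, hofReal, Complex.ofReal_re,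
    integral_rpow_mul_one_sub_rpow (by linarith) hβ, sub_add_cancel]

theorem betaSeries_pos {β z : ℝ} (hβ : 0 < β) (hz : 1 ≤ z) : 0 < betaSeries β z := by
  rw [betaSeries_eq_Gamma hβ hz]
  positivity

theorem add_sub_add_natCast_ne_zero {α : ℝ} (hα : ∀ k : ℤ, α ≠ k) (j m r : ℕ) :
    α + j - m + r ≠ 0 := fun h => hα (m - j - r) (by push_cast; linarith)

/-- The double series whose row sums over `r` are the regular terms of the expansion in `t` of a
truncated moment and whose sums over `m` come from the binomial series of `(1 - x) ^ β`. -/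
noncomputable def regTerm (α β t : ℝ) (j k : ℕ) (p : ℕ × ℕ) : ℝ :=
  binomCoeff β p.1 *
    ((-1) ^ p.2 * t ^ (k + p.2 + 1) / (p.2 ! * (k + p.2 + 1)) / (α + j - p.2 + p.1))

theorem summable_regTerm {α β t : ℝ} (hβ : 0 < β) (hα : ∀ k : ℤ, α ≠ k) (ht : 0 ≤ t)
    (j k : ℕ) : Summable (regTerm α β t j k) := by
  obtain ⟨δ, hδ, hdist⟩ := exists_le_abs_sub_int hα
  have hden (p : ℕ × ℕ) : δ ≤ |α + j - p.2 + p.1| := by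
    convert! hdist (p.2 - j - p.1) using 2
    push_cast
    ring
  refine .of_norm_bounded ((summable_abs_binomCoeff hβ).mul_of_nonneg
    ((Real.summable_pow_div_factorial t).mul_left (t ^ (k + 1) / δ))
    (fun _ => abs_nonneg _) (fun _ => by positivity)) fun p => ?_
  have hone : (1 : ℝ) ≤ k + p.2 + 1 := by
    linarith [k.cast_nonneg (α := ℝ), p.2.cast_nonneg (α := ℝ)]
  rw [regTerm, norm_mul, Real.norm_eq_abs]
  gcongr
  simp only [norm_div, norm_mul, norm_pow, norm_neg, norm_one, one_pow, one_mul,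
    Real.norm_natCast, Real.norm_of_nonneg ht, Real.norm_eq_abs (_ + _)]
  rw [abs_of_nonneg (zero_le_one.trans hone), show k + p.2 + 1 = (k + 1) + p.2 by ring, pow_add,
    div_mul_div_comm, div_div, mul_comm δ]
  gcongr
  · exact le_mul_of_one_le_right (by positivity) hone
  · exact hden p

theorem hasSum_regTerm_left {α β : ℝ} (hβ : 0 < β) (hα : ∀ k : ℤ, α ≠ k) (t : ℝ) (j k m : ℕ) :
    HasSum (fun r => regTerm α β t j k (r, m))
      ((-1) ^ m * t ^ (k + m + 1) / (m ! * (k + m + 1)) * betaSeries β (α + j - m)) := by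
  have h := (summable_div_add_natCast (summable_abs_binomCoeff hβ)
    (add_sub_add_natCast_ne_zero hα j m)).hasSum.mul_left
    ((-1) ^ m * t ^ (k + m + 1) / (m ! * (k + m + 1)))
  convert! h using 2 with r
  rw [regTerm]
  ring

theorem hasSum_regTerm_right {α t : ℝ} (hα : 0 < α) (hαZ : ∀ k : ℤ, α ≠ k) (ht : 0 < t) (β : ℝ)
    (j k r : ℕ) :
    HasSum (fun m => regTerm α β t j k (r, m)) (k ! * (binomCoeff β r *
      (1 / (α + 1 + j + k + r) - (∫ x in (0 : ℝ)..1, x ^ (α + j + k + r) * truncExp k (t / x)) -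
        t ^ (α + 1 + k + (j + r : ℕ)) * Real.Gamma (-α - (j + r : ℕ)) /
          ((α + k + (j + r : ℕ) + 1) * k !)))) := by
  have h := ((hasSum_integral_rpow_mul_truncExp k (c := α + j + r - 1) (by linarith)
    (fun l hl => hαZ (l + 1 - j - r) (by push_cast; linarith)) ht).mul_left
    (binomCoeff β r)).mul_left (k ! : ℝ)
  convert! h using 1
  · ext m
    have hkm : (k : ℝ) + m + 1 ≠ 0 := by positivity
    have hden := add_sub_add_natCast_ne_zero hαZ j m r
    rw [regTerm, show α + j + r - 1 + 1 - m = α + j - m + r by ring]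
    field_simp
  · push_cast
    ring_nf

theorem hasSum_tsum_regTerm {α β t : ℝ} (hβ : 0 < β) (hα : ∀ k : ℤ, α ≠ k) (ht : 0 ≤ t) (j k : ℕ) :
    HasSum (fun m : ℕ => (-1) ^ m * t ^ (k + m + 1) / (m ! * (k + m + 1)) *
      betaSeries β (α + j - m)) (∑' p, regTerm α β t j k p) :=
  (((Equiv.prodComm ℕ ℕ).hasSum_iff).2 (summable_regTerm hβ hα ht j k).hasSum).prod_fiberwise
    fun m => hasSum_regTerm_left hβ hα t j k m

theorem hasSum_betaSeries_sub_integral_truncExp {α β t : ℝ} (hα : 0 < α) (hβ : 0 < β)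
    (hαZ : ∀ k : ℤ, α ≠ k) (ht : 0 < t) (j k : ℕ) :
    HasSum (fun R : ℕ => t ^ (α + 1 + k + R) * Real.Gamma (-α - R) / (α + k + R + 1) *
        (if j ≤ R then binomCoeff β (R - j) else 0))
      (k ! * (betaSeries β (α + 1 + j + k) -
        ∫ x in (0 : ℝ)..1, x ^ (α + j + k) * (1 - x) ^ β * truncExp k (t / x)) -
          ∑' p, regTerm α β t j k p) := by
  have hreg := (summable_regTerm hβ hαZ ht.le j k).hasSum.prod_fiberwise
    (hasSum_regTerm_right hα hαZ ht β j k)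
  have hint := hasSum_integral_binomial (a := α + j + k) (by positivity) hβ
    (measurable_truncExp_div k t) fun x hx => abs_truncExp_div_le_one k ht.le hx
  have hbeta := (summable_div_add_natCast (summable_abs_binomCoeff hβ) (z := α + 1 + j + k)
    (fun r => by positivity)).hasSum
  have hinit : ∑ R ∈ range j, t ^ (α + 1 + k + R) * Real.Gamma (-α - R) / (α + k + R + 1) *
      (if j ≤ R then binomCoeff β (R - j) else 0) = 0 :=
    Finset.sum_eq_zero fun R hR => by rw [if_neg (by simpa using hR), mul_zero]
  rw [← hasSum_nat_add_iff' j, hinit, sub_zero]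
  convert! ((hbeta.sub hint).mul_left (k ! : ℝ)).sub hreg using 2 with r
  rw [if_pos (by omega), Nat.add_sub_cancel, add_comm r j]
  have hden : α + k + (j + r : ℕ) + 1 ≠ 0 := by positivity
  field_simp
  ring

end TruncatedMoments

section Coefficients

open Finset (range)
open scoped Nat

/-- The factor depending on the row index `i` in the Taylor coefficients of the scaled matrix
entries; the parameter `x` plays the role of `1 / n`, and `x = 0` gives the limit. -/
noncomputable def rowFactor (α β x : ℝ) (i : ℕ) : ℝ :=
  (-1) ^ i / i ! * ∏ j ∈ range i, (1 + (α + β + (j + 1)) * x) * (1 - (j + 1) * x) / (α + (j + 1))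

/-- The factor depending on the order `m` in the coefficients of the part of the scaled matrix
entries that is a power series in the scaled variable; `x` plays the role of `1 / n`. -/
noncomputable def regFactor (α β x : ℝ) (m : ℕ) : ℝ :=
  1 / m ! * ∏ j ∈ range (m + 1), (1 + (α + β - j) * x) * (1 + j * x) / (α - j)

/-- The factor depending on the order `R` in the coefficients of the part of the scaled matrix
entries that carries the power `σ ^ (α + 1)`; `x` plays the role of `1 / n`. -/
noncomputable def singFactor (α β x : ℝ) (R : ℕ) : ℝ :=
  Real.Gamma (-α) / R ! *
    ∏ j ∈ range R, (1 + (β - (j + 1)) * x) * (1 + (α + (j + 1)) * x) / (α + (j + 1)) ^ 2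

/-- The coefficient of `σ ^ (m + 1)`, up to the factor `σ ^ k`, in the `(i, k)` entry of the matrix
whose Fredholm-type determinant is the scaled ratio of Hankel determinants. -/
noncomputable def regCoeff (α β x : ℝ) (i k m : ℕ) : ℝ :=
  (-1) ^ m * rowFactor α β x i * regFactor α β x m / (k ! * m ! * (k + m + 1) * (m + 1 + i))

/-- The coefficient of `σ ^ (α + 1 + R)`, up to the factor `σ ^ k` and a normalizing constant, in
the `(i, k)` entry of the matrix whose Fredholm-type determinant is the scaled ratio of Hankel
determinants. -/
noncomputable def singCoeff (α β x : ℝ) (i k R : ℕ) : ℝ :=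
  rowFactor α β x i * singFactor α β x R / (k ! * (k + R + 1 + α) * (i + R + 1 + α))

/-- The values of the parameter `x` that occur: reciprocals of positive integers, and their limit
`0`. For these the factors of `rowFactor` are nonnegative up to the first one that vanishes. -/
def IsScale (x : ℝ) : Prop := x = 0 ∨ ∃ n : ℕ, x = ((n : ℝ) + 1)⁻¹

theorem IsScale.nonneg {x : ℝ} (hx : IsScale x) : 0 ≤ x := by
  rcases hx with rfl | ⟨n, rfl⟩
  · exact le_rfl
  · positivity

theorem IsScale.le_one {x : ℝ} (hx : IsScale x) : x ≤ 1 := by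
  rcases hx with rfl | ⟨n, rfl⟩
  · exact zero_le_one
  · exact inv_le_one_of_one_le₀ (by linarith [Nat.cast_nonneg (α := ℝ) n])

variable {α β x : ℝ}

theorem rowFactor_eq_zero (α β : ℝ) {n i : ℕ} (hi : n + 1 ≤ i) :
    rowFactor α β ((n : ℝ) + 1)⁻¹ i = 0 := by
  rw [rowFactor, Finset.prod_eq_zero (i := n) (by simpa using hi), mul_zero]
  rw [mul_inv_cancel₀ (by positivity), sub_self, mul_zero, zero_div]

theorem abs_rowFactor_le_of_forall (hα : 0 ≤ α) (hβ : 0 ≤ β) (hx0 : 0 ≤ x) (hx1 : x ≤ 1) {i : ℕ}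
    (h : ∀ j < i, ((j : ℝ) + 1) * x ≤ 1) :
    |rowFactor α β x i| ≤ (2 + α + β) ^ i / i ! := by
  have factor_le : ∀ j ∈ range i,
      |(1 + (α + β + ((j : ℝ) + 1)) * x) * (1 - ((j : ℝ) + 1) * x) / (α + ((j : ℝ) + 1))| ≤
        2 + α + β := by
    intro j hj
    have hjx : ((j : ℝ) + 1) * x ≤ 1 := h j (Finset.mem_range.1 hj)
    have hjx0 : 0 ≤ ((j : ℝ) + 1) * x := by positivity
    have hfst : 1 + (α + β + (j + 1)) * x ≤ 2 + α + β := by nlinarith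
    rw [abs_div, abs_mul, abs_of_nonneg (by positivity), abs_of_nonneg (by linarith),
      abs_of_nonneg (by positivity), div_le_iff₀ (by positivity)]
    exact mul_le_mul hfst (by linarith) (by linarith) (by positivity)
  rw [rowFactor, abs_mul, abs_div, abs_pow, abs_neg, abs_one, one_pow, Nat.abs_cast,
    Finset.abs_prod, div_mul_eq_mul_div, one_mul]
  gcongr
  simpa using Finset.prod_le_prod (fun _ _ => abs_nonneg _) factor_le

theorem abs_rowFactor_le (hα : 0 ≤ α) (hβ : 0 ≤ β) (hx : IsScale x) (i : ℕ) :
    |rowFactor α β x i| ≤ (2 + α + β) ^ i / i ! := by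
  have small := @abs_rowFactor_le_of_forall α β x hα hβ hx.nonneg hx.le_one i
  rcases hx with rfl | ⟨n, rfl⟩
  · exact small (by simp)
  rcases le_or_gt (n + 1) i with hi | hi
  · rw [rowFactor_eq_zero α β hi, abs_zero]
    positivity
  · refine small fun j hj => ?_
    rw [← div_eq_mul_inv, div_le_one (by positivity)]
    exact_mod_cast (by omega : j + 1 ≤ n + 1)

theorem exists_add_le_mul_abs_sub (hα : 0 ≤ α) (hαZ : ∀ k : ℤ, α ≠ k) (hβ : 0 ≤ β) :
    ∃ K : ℝ, 1 ≤ K ∧ ∀ j : ℕ, 1 + α + β + j ≤ K * |α - j| := by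
  obtain ⟨δ, hδ, h⟩ := exists_le_abs_sub_int hαZ
  have hq : 0 ≤ (1 + 2 * α + β) / δ := by positivity
  refine ⟨1 + (1 + 2 * α + β) / δ, by linarith, fun j => ?_⟩
  have hj : δ ≤ |α - j| := by simpa using h j
  have hsub : (j : ℝ) - α ≤ |α - j| := by rw [abs_sub_comm]; exact le_abs_self _
  have hconst : 1 + 2 * α + β ≤ (1 + 2 * α + β) / δ * |α - j| := by
    rw [div_mul_eq_mul_div, le_div_iff₀ hδ]
    gcongr
  linarith

theorem abs_regFactor_le {K : ℝ} (hα : 0 ≤ α) (hβ : 0 ≤ β) (hx0 : 0 ≤ x) (hx1 : x ≤ 1)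
    (hαZ : ∀ k : ℤ, α ≠ k) (hK : ∀ j : ℕ, 1 + α + β + j ≤ K * |α - j|) (m : ℕ) :
    |regFactor α β x m| ≤ K ^ (m + 1) * (m + 1) := by
  have factor_le : ∀ j ∈ range (m + 1),
      |(1 + (α + β - (j : ℝ)) * x) * (1 + j * x) / (α - j)| ≤ K * ((j + 1 : ℕ) : ℝ) := by
    intro j _
    have hj : α - j ≠ 0 := sub_ne_zero.2 (by simpa using hαZ j)
    have hfst : |1 + (α + β - j) * x| ≤ K * |α - j| := by
      refine le_trans ?_ (hK j)
      rw [abs_le]; constructor <;> nlinarith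
    have hsnd : |1 + j * x| ≤ j + 1 := by
      rw [abs_of_nonneg (by positivity)]; nlinarith
    rw [abs_div, abs_mul, div_le_iff₀ (abs_pos.2 hj), mul_right_comm, Nat.cast_succ]
    exact mul_le_mul hfst hsnd (abs_nonneg _) ((abs_nonneg _).trans hfst)
  rw [regFactor, abs_mul, Finset.abs_prod, abs_div, abs_one, Nat.abs_cast, div_mul_eq_mul_div,
    one_mul, div_le_iff₀ (by positivity)]
  refine (Finset.prod_le_prod (fun _ _ => abs_nonneg _) factor_le).trans_eq ?_
  rw [Finset.prod_mul_distrib, Finset.prod_const, Finset.card_range, ← Nat.cast_prod,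
    Finset.prod_range_add_one_eq_factorial, Nat.factorial_succ]
  push_cast
  ring

theorem abs_singFactor_le (hα : 0 ≤ α) (hβ : 0 ≤ β) (hx0 : 0 ≤ x) (hx1 : x ≤ 1) (R : ℕ) :
    |singFactor α β x R| ≤ |Real.Gamma (-α)| * ((2 * (2 + β)) ^ R / R !) := by
  have factor_le : ∀ j ∈ range R,
      |(1 + (β - ((j : ℝ) + 1)) * x) * (1 + (α + (j + 1)) * x) / (α + (j + 1)) ^ 2| ≤
        2 * (2 + β) := by
    intro j _
    have hj0 : (0 : ℝ) ≤ j := j.cast_nonneg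
    have hfst : |1 + (β - (j + 1)) * x| ≤ (2 + β) * (α + (j + 1)) := by
      have hle : |1 + (β - (j + 1)) * x| ≤ 1 + β + (j + 1) := by
        rw [abs_le]; constructor <;> nlinarith
      nlinarith [mul_nonneg hβ hj0, mul_nonneg hα hβ]
    have hsnd : |1 + (α + (j + 1)) * x| ≤ 2 * (α + (j + 1)) := by
      rw [abs_of_nonneg (by positivity)]; nlinarith
    rw [abs_div, abs_mul, abs_of_nonneg (sq_nonneg (α + ((j : ℝ) + 1))),
      div_le_iff₀ (by positivity)]
    calc _ ≤ ((2 + β) * (α + (j + 1))) * (2 * (α + (j + 1))) := by gcongr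
      _ = _ := by ring
  rw [singFactor, abs_mul, Finset.abs_prod, abs_div, Nat.abs_cast, div_mul_eq_mul_div,
    mul_div_assoc]
  gcongr
  simpa using Finset.prod_le_prod (fun _ _ => abs_nonneg _) factor_le

theorem exists_abs_regCoeff_le (hα : 0 ≤ α) (hβ : 0 ≤ β) (hαZ : ∀ k : ℤ, α ≠ k) :
    ∃ K : ℝ, 0 < K ∧ ∀ x, IsScale x → ∀ i k m : ℕ,
      |regCoeff α β x i k m| ≤ K * ((2 + α + β) ^ i / i !) * (1 / k !) * (K ^ m / m !) := by
  obtain ⟨K, hK1, hK⟩ := exists_add_le_mul_abs_sub hα hαZ hβ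
  refine ⟨K, by linarith, fun x hx i k m => ?_⟩
  have hrow := abs_rowFactor_le hα hβ hx i
  have hreg := abs_regFactor_le hα hβ hx.nonneg hx.le_one hαZ hK m
  have hkm : (1 : ℝ) ≤ k + m + 1 := by linarith [k.cast_nonneg (α := ℝ), m.cast_nonneg (α := ℝ)]
  have hmi : (m : ℝ) + 1 ≤ m + 1 + i := by linarith [i.cast_nonneg (α := ℝ)]
  rw [regCoeff, abs_div, abs_mul, abs_mul, abs_pow, abs_neg, abs_one, one_pow, one_mul,
    abs_of_nonneg (by positivity : (0 : ℝ) ≤ k ! * m ! * (k + m + 1) * (m + 1 + i))]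
  calc _ ≤ (2 + α + β) ^ i / i ! * (K ^ (m + 1) * (m + 1)) / (k ! * m ! * 1 * (m + 1)) :=
        div_le_div₀ (by positivity) (by gcongr) (by positivity) (by gcongr)
    _ = _ := by
      rw [pow_succ]
      field_simp

theorem abs_singCoeff_le (hα : 0 ≤ α) (hβ : 0 ≤ β) (hx : IsScale x) (i k m : ℕ) :
    |singCoeff α β x i k m| ≤
      |Real.Gamma (-α)| * ((2 + α + β) ^ i / i !) * (1 / k !) * ((2 * (2 + β)) ^ m / m !) := by
  have hrow := abs_rowFactor_le hα hβ hx i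
  have hsing := abs_singFactor_le hα hβ hx.nonneg hx.le_one m
  have hkm : (1 : ℝ) ≤ k + m + 1 + α := by
    linarith [k.cast_nonneg (α := ℝ), m.cast_nonneg (α := ℝ)]
  have him : (1 : ℝ) ≤ i + m + 1 + α := by
    linarith [i.cast_nonneg (α := ℝ), m.cast_nonneg (α := ℝ)]
  rw [singCoeff, abs_div, abs_mul,
    abs_of_nonneg (by positivity : (0 : ℝ) ≤ k ! * (k + m + 1 + α) * (i + m + 1 + α))]
  calc _ ≤ (2 + α + β) ^ i / i ! * (|Real.Gamma (-α)| * ((2 * (2 + β)) ^ m / m !)) /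
        (k ! * 1 * 1) := by gcongr
    _ = _ := by field_simp

theorem exists_abs_coeff_le (hα : 0 ≤ α) (hβ : 0 ≤ β) (hαZ : ∀ k : ℤ, α ≠ k) :
    ∃ c C K : ℝ, 0 < c ∧ 0 < C ∧ 0 < K ∧ ∀ x, IsScale x → ∀ i k m : ℕ,
      |regCoeff α β x i k m| ≤ C * (c ^ i / i !) * (1 / k !) * (K ^ m / m !) ∧
      |singCoeff α β x i k m| ≤ C * (c ^ i / i !) * (1 / k !) * (K ^ m / m !) := by
  obtain ⟨K, hK0, hK⟩ := exists_abs_regCoeff_le hα hβ hαZ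
  refine ⟨2 + α + β, K + |Real.Gamma (-α)|, K + 2 * (2 + β), by positivity, by positivity,
    by positivity, fun x hx i k m => ⟨(hK x hx i k m).trans ?_,
      (abs_singCoeff_le hα hβ hx i k m).trans ?_⟩⟩
  · gcongr
    · linarith [abs_nonneg (Real.Gamma (-α))]
    · linarith
  · gcongr <;> linarith

theorem continuous_regCoeff (α β : ℝ) (i k m : ℕ) :
    Continuous fun x => regCoeff α β x i k m := by
  unfold regCoeff rowFactor regFactor
  fun_prop

theorem continuous_singCoeff (α β : ℝ) (i k m : ℕ) :
    Continuous fun x => singCoeff α β x i k m := by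
  unfold singCoeff rowFactor singFactor
  fun_prop

end Coefficients

section Factorization

open Finset (range)
open scoped Nat

variable {α β : ℝ}

theorem pow_two_mul_eq_prod (a : ℝ) (N : ℕ) : a ^ (2 * N) = ∏ _j ∈ range N, a ^ 2 := by
  rw [Finset.prod_const, Finset.card_range, pow_mul]

theorem pow_mul_rowFactor (α β : ℝ) {N i : ℕ} (hi : i ≤ N) :
    ((N : ℝ) + 1) ^ (2 * i) * rowFactor α β ((N : ℝ) + 1)⁻¹ i =
      (-1) ^ i / i ! * (N ! / (N - i)!) *
        (risingFactorial (β + 1 + (α + 1 + N)) i / risingFactorial (α + 1) i) := by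
  have hquot : (N ! / (N - i)! : ℝ) = ∏ j ∈ range i, ((N : ℝ) - j) := by
    have h := factorial_mul_risingFactorial (N - i) i
    rw [Nat.sub_add_cancel hi, Nat.cast_sub hi, sub_add_eq_add_sub,
      risingFactorial_eq_prod_sub] at h
    rw [← h, mul_div_cancel_left₀ _ (by positivity)]
  rw [hquot, risingFactorial_eq_prod, risingFactorial_eq_prod, ← Finset.prod_div_distrib,
    pow_two_mul_eq_prod, rowFactor, mul_assoc, ← Finset.prod_mul_distrib, mul_left_comm,
    ← Finset.prod_mul_distrib]
  congr 1
  refine Finset.prod_congr rfl fun j _ => ?_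
  have hN : (N : ℝ) + 1 ≠ 0 := by positivity
  rw [← add_assoc α, add_right_comm α]
  field_simp
  ring

theorem pow_mul_regFactor (α β : ℝ) (N m : ℕ) :
    ((N : ℝ) + 1) ^ (2 * (m + 1)) * regFactor α β ((N : ℝ) + 1)⁻¹ m =
      1 / m ! * risingFactorial (N + 1) (m + 1) *
        (risingFactorial (β + 1 + (α - m + N)) (m + 1) / risingFactorial (α - m) (m + 1)) := by
  rw [show β + 1 + (α - m + N) = α + β + N + 1 + 1 - (m + 1 : ℕ) by push_cast; ring,
    show α - m = α + 1 - (m + 1 : ℕ) by push_cast; ring, risingFactorial_eq_prod_sub,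
    risingFactorial_eq_prod_sub, ← Finset.prod_div_distrib, risingFactorial_eq_prod, mul_assoc,
    ← Finset.prod_mul_distrib, pow_two_mul_eq_prod, regFactor, mul_left_comm,
    ← Finset.prod_mul_distrib]
  congr 1
  refine Finset.prod_congr rfl fun j _ => ?_
  have hN : (N : ℝ) + 1 ≠ 0 := by positivity
  rw [mul_div_assoc', mul_div_assoc']
  congr 1
  field_simp
  ring

theorem pow_mul_singFactor (α β : ℝ) (N R : ℕ) :
    ((N : ℝ) + 1) ^ (2 * R) * singFactor α β ((N : ℝ) + 1)⁻¹ R =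
      Real.Gamma (-α) / R ! * risingFactorial (β + N + 1 - R) R *
        (risingFactorial (α + 1 + (N + 1)) R / risingFactorial (α + 1) R ^ 2) := by
  rw [risingFactorial_eq_prod_sub, risingFactorial_eq_prod, risingFactorial_eq_prod,
    ← Finset.prod_pow, ← Finset.prod_div_distrib, mul_assoc, ← Finset.prod_mul_distrib,
    pow_two_mul_eq_prod, singFactor, mul_left_comm, ← Finset.prod_mul_distrib]
  congr 1
  refine Finset.prod_congr rfl fun j _ => ?_
  have hN : (N : ℝ) + 1 ≠ 0 := by positivity
  rw [mul_div_assoc', mul_div_assoc', add_right_comm α, add_assoc α]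
  congr 1
  · field_simp
    ring
  · ring

theorem interpConst_pos {z : ℝ} (hβ : 0 < β) (hz : 1 ≤ z) (N : ℕ) : 0 < interpConst β N z :=
  div_pos (betaSeries_pos hβ (by linarith [N.cast_nonneg (α := ℝ)]))
    (risingFactorial_pos (by linarith) N)

theorem Gamma_neg_sub_natCast_mul_risingFactorial (hαZ : ∀ k : ℤ, α ≠ k) (R : ℕ) :
    Real.Gamma (-α - R) * risingFactorial (α + 1) R = (-1) ^ R * Real.Gamma (-α) := by
  induction R with
  | zero => simp [risingFactorial_zero]
  | succ R ih =>
    have hrec := Real.Gamma_add_one (s := -α - (R + 1 : ℕ))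
      (fun h => hαZ (-(R + 1 : ℕ)) (by push_cast at h ⊢; linarith))
    rw [show -α - (R + 1 : ℕ) + 1 = -α - R by push_cast; ring] at hrec
    rw [risingFactorial_succ, pow_succ]
    push_cast at hrec ⊢
    linear_combination -ih + risingFactorial (α + 1) R * hrec

theorem pow_mul_rowFactor_mul_interpConst (hα : 0 ≤ α) (hβ : 0 < β) {N i : ℕ} (hi : i ≤ N) :
    ((N : ℝ) + 1) ^ (2 * i) * rowFactor α β ((N : ℝ) + 1)⁻¹ i * interpConst β N (α + 1 + i) =
      (-1) ^ i / (i ! * (N - i)!) * (N ! * interpConst β N (α + 1)) := by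
  have hrec := risingFactorial_mul_interpConst hβ (z := α + 1) (fun r => by positivity) N i
  have hpos := risingFactorial_pos (z := α + 1) (by positivity) i
  rw [pow_mul_rowFactor α β hi]
  field_simp
  linear_combination -hrec

theorem pow_mul_regFactor_mul_interpConst (hβ : 0 < β) (hαZ : ∀ k : ℤ, α ≠ k) (N m : ℕ) :
    ((N : ℝ) + 1) ^ (2 * (m + 1)) * regFactor α β ((N : ℝ) + 1)⁻¹ m *
        (N ! * interpConst β N (α + 1)) =
      risingFactorial (m + 1) (N + 1) * interpConst β N (α - m) := by
  have hz : ∀ r : ℕ, α - m + r ≠ 0 := fun r h => hαZ (m - r) (by push_cast; linarith)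
  have hrec := risingFactorial_mul_interpConst hβ hz N (m + 1)
  rw [show α - m + (m + 1 : ℕ) = α + 1 by push_cast; ring] at hrec
  have hne := risingFactorial_ne_zero hz (m + 1)
  have hswap : m ! * risingFactorial (m + 1) (N + 1) = N ! * risingFactorial (N + 1) (m + 1) := by
    rw [factorial_mul_risingFactorial, factorial_mul_risingFactorial, add_left_comm,
      add_comm N, add_assoc]
  rw [pow_mul_regFactor]
  field_simp
  linear_combination (-(N ! * risingFactorial (N + 1) (m + 1))) * hrec -
    risingFactorial (α - m) (m + 1) * interpConst β N (α - m) * hswap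

theorem risingFactorial_mul_pow_mul_singFactor (hα : 0 ≤ α) (hαZ : ∀ k : ℤ, α ≠ k) (β : ℝ)
    (N R : ℕ) :
    risingFactorial (α + 1) (N + 1) *
        (((N : ℝ) + 1) ^ (2 * R) * singFactor α β ((N : ℝ) + 1)⁻¹ R) =
      Real.Gamma (-α - R) * ((-1) ^ R / R ! * risingFactorial (β + N + 1 - R) R) *
        risingFactorial (α + 1 + R) (N + 1) := by
  have hGamma := Gamma_neg_sub_natCast_mul_risingFactorial hαZ R
  have hpos := risingFactorial_pos (z := α + 1) (by positivity) R
  have hswap : risingFactorial (α + 1) R * risingFactorial (α + 1 + R) (N + 1) =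
      risingFactorial (α + 1) (N + 1) * risingFactorial (α + 1 + (N + 1)) R := by
    rw [← risingFactorial_add, add_comm R, risingFactorial_add, Nat.cast_succ]
  have hsign : (-1 : ℝ) ^ R * (-1) ^ R = 1 := by rw [← mul_pow, neg_one_mul, neg_neg, one_pow]
  rw [pow_mul_singFactor, ← mul_left_inj' (pow_pos hpos 2).ne']
  field_simp
  linear_combination (-(risingFactorial (β + N + 1 - R) R * (-1) ^ R * Real.Gamma (-α - R) *
      risingFactorial (α + 1) R)) * hswap -
    risingFactorial (β + N + 1 - R) R * risingFactorial (α + 1) (N + 1) *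
      risingFactorial (α + 1 + (N + 1)) R * ((-1) ^ R * hGamma + Real.Gamma (-α) * hsign)

theorem interpConst_mul_eval_interpPoly_eq_sum (hα : 0 ≤ α) (hβ : 0 < β) {N j : ℕ} (hj : j ≤ N)
    {z : ℝ} (hz : ∀ i : ℕ, α + 1 - z + i ≠ 0) :
    N ! * interpConst β N (α + 1) * (interpPoly β N j).eval z =
      ∑ i ∈ range (N + 1), betaSeries β (α + 1 + j + i) *
        (((N : ℝ) + 1) ^ (2 * i) * rowFactor α β ((N : ℝ) + 1)⁻¹ i *
          (risingFactorial (α + 1 - z) (N + 1) / (α + 1 - z + i))) := by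
  rw [eval_eq_sum_eval_add_natCast (degree_interpPoly_lt β hj) hz, Finset.mul_sum]
  refine Finset.sum_congr rfl fun i hi => ?_
  have hrow := pow_mul_rowFactor_mul_interpConst hα hβ (Finset.mem_range_succ_iff.1 hi)
  rw [add_right_comm (α + 1),
    betaSeries_eq_interpConst_mul hβ (z := α + 1 + i) (fun r => by positivity) hj]
  linear_combination (-((interpPoly β N j).eval (α + 1 + i) *
    (risingFactorial (α + 1 - z) (N + 1) / (α + 1 - z + i)))) * hrow

theorem betaSeries_sub_eq_sum (hα : 0 ≤ α) (hβ : 0 < β) (hαZ : ∀ k : ℤ, α ≠ k) {N j : ℕ}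
    (hj : j ≤ N) (m : ℕ) :
    betaSeries β (α + j - m) = ∑ i ∈ range (N + 1), betaSeries β (α + 1 + j + i) *
      (((N : ℝ) + 1) ^ (2 * (m + 1 + i)) * (rowFactor α β ((N : ℝ) + 1)⁻¹ i *
        regFactor α β ((N : ℝ) + 1)⁻¹ m / (m + 1 + i))) := by
  have hz : ∀ r : ℕ, α - m + r ≠ 0 := fun r h => hαZ (m - r) (by push_cast; linarith)
  have hnode : α + 1 - (α - m) = m + 1 := by ring
  have hinterp := interpConst_mul_eval_interpPoly_eq_sum hα hβ hj (z := α - m)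
    (fun i => by rw [hnode]; positivity)
  rw [hnode] at hinterp
  have hpos := risingFactorial_pos (z := (m : ℝ) + 1) (by positivity) (N + 1)
  refine mul_left_cancel₀ hpos.ne' ?_
  calc risingFactorial (m + 1) (N + 1) * betaSeries β (α + j - m)
    _ = ((N : ℝ) + 1) ^ (2 * (m + 1)) * regFactor α β ((N : ℝ) + 1)⁻¹ m *
          (N ! * interpConst β N (α + 1) * (interpPoly β N j).eval (α - m)) := by
      rw [← mul_assoc, pow_mul_regFactor_mul_interpConst hβ hαZ, mul_assoc,
        ← betaSeries_eq_interpConst_mul hβ hz hj, sub_add_eq_add_sub]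
    _ = _ := by
      rw [hinterp, Finset.mul_sum, Finset.mul_sum]
      refine Finset.sum_congr rfl fun i _ => ?_
      rw [mul_add, pow_add]
      ring

/-- The constant by which the singular part of the `(N + 1) × (N + 1)` matrix, before rescaling,
differs from the sum of its `singCoeff` terms. -/
noncomputable def singConst (α β : ℝ) (N : ℕ) : ℝ :=
  risingFactorial (α + 1) (N + 1) / (risingFactorial (β + 1) N * interpConst β N (α + 1) * N !)

theorem binomCoeff_mul_Gamma_eq_sum (hα : 0 ≤ α) (hβ : 0 < β) (hαZ : ∀ k : ℤ, α ≠ k) {N j : ℕ}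
    (hj : j ≤ N) (R : ℕ) :
    Real.Gamma (-α - R) * (if j ≤ R then binomCoeff β (R - j) else 0) =
      ∑ i ∈ range (N + 1), betaSeries β (α + 1 + j + i) *
        (((N : ℝ) + 1) ^ (2 * (R + i)) * (singConst α β N * (rowFactor α β ((N : ℝ) + 1)⁻¹ i *
          singFactor α β ((N : ℝ) + 1)⁻¹ R / (i + R + 1 + α)))) := by
  have hnode : α + 1 - -(R : ℝ) = α + 1 + R := sub_neg_eq_add _ _
  have hinterp := interpConst_mul_eval_interpPoly_eq_sum hα hβ hj (z := -R)
    (fun i => by rw [hnode]; positivity)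
  rw [hnode] at hinterp
  have heval := binomCoeff_mul_eq_eval_interpPoly β hj R
  have hsing := risingFactorial_mul_pow_mul_singFactor hα hαZ β N R
  have hR := risingFactorial_pos (z := α + 1 + R) (by positivity) (N + 1)
  have hb := risingFactorial_pos (z := β + 1) (by positivity) N
  have hconst := interpConst_pos hβ (z := α + 1) (by linarith) N
  refine mul_left_cancel₀ (mul_pos hR hb).ne' ?_
  calc risingFactorial (α + 1 + R) (N + 1) * risingFactorial (β + 1) N *
        (Real.Gamma (-α - R) * (if j ≤ R then binomCoeff β (R - j) else 0))
    _ = risingFactorial (β + 1) N * singConst α β N *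
          (((N : ℝ) + 1) ^ (2 * R) * singFactor α β ((N : ℝ) + 1)⁻¹ R) *
          (N ! * interpConst β N (α + 1) * (interpPoly β N j).eval (-R : ℝ)) := by
      generalize singFactor α β ((N : ℝ) + 1)⁻¹ R = S at hsing ⊢
      rw [singConst]
      field_simp
      linear_combination risingFactorial (α + 1 + R) (N + 1) * Real.Gamma (-α - R) * heval -
        (interpPoly β N j).eval (-R : ℝ) * hsing
    _ = _ := by
      rw [hinterp, Finset.mul_sum, Finset.mul_sum]
      refine Finset.sum_congr rfl fun i _ => ?_
      rw [mul_add, pow_add, show (i : ℝ) + R + 1 + α = α + 1 + R + i by ring]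
      ring

end Factorization

section ScaledMoments

open Finset (range)
open scoped Nat

variable {α β σ : ℝ}

theorem summable_coeff_mul_pow_of_abs_le {a : ℕ → ℝ} {A K : ℝ}
    (h : ∀ m, |a m| ≤ A * (K ^ m / m !)) (σ : ℝ) (q : ℕ) :
    Summable fun m => a m * σ ^ (q + m) := by
  refine .of_norm_bounded
    (((Real.summable_pow_div_factorial (K * |σ|)).mul_left A).mul_right (|σ| ^ q)) fun m => ?_
  rw [norm_mul, norm_pow, Real.norm_eq_abs, Real.norm_eq_abs]
  calc |a m| * |σ| ^ (q + m) ≤ A * (K ^ m / m !) * |σ| ^ (q + m) := by gcongr; exact h m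
    _ = _ := by rw [mul_pow, pow_add]; ring

theorem summable_regCoeff_mul_pow {x : ℝ} (hα : 0 ≤ α) (hβ : 0 ≤ β) (hαZ : ∀ k : ℤ, α ≠ k)
    (hx : IsScale x) (σ : ℝ) (i k : ℕ) :
    Summable fun m => regCoeff α β x i k m * σ ^ (k + m + 1) := by
  obtain ⟨K, -, h⟩ := exists_abs_regCoeff_le hα hβ hαZ
  simpa only [add_right_comm k] using summable_coeff_mul_pow_of_abs_le (h x hx i k) σ (k + 1)

theorem summable_singCoeff_mul_pow {x : ℝ} (hα : 0 ≤ α) (hβ : 0 ≤ β) (hx : IsScale x)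
    (σ : ℝ) (i k : ℕ) : Summable fun m => singCoeff α β x i k m * σ ^ (k + m) :=
  summable_coeff_mul_pow_of_abs_le (abs_singCoeff_le hα hβ hx i k) σ k

/-- The constant multiplying `σ ^ (α + 1)` in the entries of the `(N + 1) × (N + 1)` matrix, where
`σ = (N + 1) ^ 2 * t` is the scaled variable. -/
noncomputable def scaleConst (α β : ℝ) (N : ℕ) : ℝ :=
  singConst α β N / ((N : ℝ) + 1) ^ (2 * (α + 1))

theorem hasSum_sum_betaSeries_mul_tsum_regCoeff (hα : 0 ≤ α) (hβ : 0 < β)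
    (hαZ : ∀ k : ℤ, α ≠ k) (σ : ℝ) {N j : ℕ} (hj : j ≤ N) (k : ℕ) :
    HasSum (fun m : ℕ => (-1) ^ m * (σ / ((N : ℝ) + 1) ^ 2) ^ (k + m + 1) /
        (m ! * (k + m + 1)) * betaSeries β (α + j - m))
      (∑ i ∈ range (N + 1), betaSeries β (α + 1 + j + i) *
        (k ! * (((N : ℝ) + 1) ^ (2 * i) / ((N : ℝ) + 1) ^ (2 * k)) *
          ∑' m, regCoeff α β ((N : ℝ) + 1)⁻¹ i k m * σ ^ (k + m + 1))) := by
  set ν : ℝ := N + 1 with hν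
  have hν0 : 0 < ν := by positivity
  have hsum := hasSum_sum (s := range (N + 1)) fun i _ =>
    ((summable_regCoeff_mul_pow hα hβ.le hαZ (Or.inr ⟨N, rfl⟩) σ i k).hasSum.mul_left
      (k ! * (ν ^ (2 * i) / ν ^ (2 * k)))).mul_left (betaSeries β (α + 1 + j + i))
  convert! hsum using 2 with m
  rw [betaSeries_sub_eq_sum hα hβ hαZ hj m, Finset.mul_sum]
  refine Finset.sum_congr rfl fun i _ => ?_
  rw [← hν, regCoeff, div_pow, ← pow_mul, show 2 * (k + m + 1) = 2 * k + 2 * (m + 1) by ring,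
    show 2 * (m + 1 + i) = 2 * i + 2 * (m + 1) by ring, pow_add ν, pow_add ν]
  field_simp

theorem div_sq_rpow_add {ν : ℝ} (hσ : 0 < σ) (hν : 0 < ν) (a : ℝ) (q : ℕ) :
    (σ / ν ^ 2) ^ (a + q) = σ ^ a * σ ^ q / (ν ^ (2 * a) * ν ^ (2 * q)) := by
  rw [Real.rpow_add_natCast (by positivity), div_pow, Real.div_rpow hσ.le (by positivity),
    ← Real.rpow_natCast ν 2, ← Real.rpow_mul hν.le, Real.rpow_natCast, ← pow_mul, Nat.cast_ofNat]
  field_simp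

theorem hasSum_sum_betaSeries_mul_tsum_singCoeff (hα : 0 ≤ α) (hβ : 0 < β)
    (hαZ : ∀ k : ℤ, α ≠ k) (hσ : 0 < σ) {N j : ℕ} (hj : j ≤ N) (k : ℕ) :
    HasSum (fun R : ℕ => (σ / ((N : ℝ) + 1) ^ 2) ^ (α + 1 + k + R) * Real.Gamma (-α - R) /
        (α + k + R + 1) * (if j ≤ R then binomCoeff β (R - j) else 0))
      (∑ i ∈ range (N + 1), betaSeries β (α + 1 + j + i) *
        (k ! * (((N : ℝ) + 1) ^ (2 * i) / ((N : ℝ) + 1) ^ (2 * k)) *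
          (scaleConst α β N * σ ^ (α + 1)) *
            ∑' m, singCoeff α β ((N : ℝ) + 1)⁻¹ i k m * σ ^ (k + m))) := by
  set ν : ℝ := N + 1 with hν
  have hν0 : 0 < ν := by positivity
  have hsum := hasSum_sum (s := range (N + 1)) fun i _ =>
    ((summable_singCoeff_mul_pow hα hβ.le (Or.inr ⟨N, rfl⟩) σ i k).hasSum.mul_left
      (k ! * (ν ^ (2 * i) / ν ^ (2 * k)) * (scaleConst α β N * σ ^ (α + 1)))).mul_left
        (betaSeries β (α + 1 + j + i))
  convert! hsum using 2 with R
  rw [mul_div_right_comm, mul_assoc, binomCoeff_mul_Gamma_eq_sum hα hβ hαZ hj R, Finset.mul_sum]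
  refine Finset.sum_congr rfl fun i _ => ?_
  rw [← hν, add_assoc (α + 1), ← Nat.cast_add, div_sq_rpow_add hσ hν0, mul_add 2 k R,
    mul_add 2 R i, pow_add ν, pow_add ν, scaleConst, singCoeff, ← hν,
    show α + k + R + 1 = k + R + 1 + α by ring]
  field_simp

theorem integral_truncExp_eq_sum (hα : 0 < α) (hβ : 0 < β) (hαZ : ∀ k : ℤ, α ≠ k)
    (hσ : 0 < σ) {N j : ℕ} (hj : j ≤ N) (k : ℕ) :
    (∫ x in (0 : ℝ)..1, x ^ (α + j + k) * (1 - x) ^ β * truncExp k (σ / ((N : ℝ) + 1) ^ 2 / x)) =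
      betaSeries β (α + 1 + j + k) - ∑ i ∈ range (N + 1), betaSeries β (α + 1 + j + i) *
        (((N : ℝ) + 1) ^ (2 * i) / ((N : ℝ) + 1) ^ (2 * k) *
          (∑' m, regCoeff α β ((N : ℝ) + 1)⁻¹ i k m * σ ^ (k + m + 1) +
            scaleConst α β N * σ ^ (α + 1) *
              ∑' m, singCoeff α β ((N : ℝ) + 1)⁻¹ i k m * σ ^ (k + m))) := by
  have ht : 0 < σ / ((N : ℝ) + 1) ^ 2 := by positivity
  have hreg := (hasSum_tsum_regTerm hβ hαZ ht.le j k).unique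
    (hasSum_sum_betaSeries_mul_tsum_regCoeff hα.le hβ hαZ σ hj k)
  have hsing := (hasSum_betaSeries_sub_integral_truncExp hα hβ hαZ ht j k).unique
    (hasSum_sum_betaSeries_mul_tsum_singCoeff hα.le hβ hαZ hσ hj k)
  rw [hreg, sub_eq_iff_eq_add, ← Finset.sum_add_distrib] at hsing
  rw [eq_sub_iff_add_eq, ← eq_sub_iff_add_eq', ← mul_right_inj' (a := (k ! : ℝ)) (by positivity),
    hsing, Finset.mul_sum]
  exact Finset.sum_congr rfl fun i _ => by ring

end ScaledMoments

section ScaleConst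

open scoped Nat

variable {α β : ℝ}

theorem scaleConst_eq_GammaSeq (hα : 0 ≤ α) (hβ : 0 < β) {N : ℕ} (hN : N ≠ 0) :
    scaleConst α β N = ((0 + 1 * N : ℝ) / (1 + 1 * N)) ^ (2 * (α + 1)) *
      ((β + 1 + 1 * N) / (β + 1 + (α + 1) + 1 * N)) *
      (Real.GammaSeq (β + 1) N / (Real.GammaSeq (α + 1) N *
        Real.GammaSeq (β + 1 + (α + 1)) N * betaSeries β (α + 1))) := by
  have hN0 : (0 : ℝ) < N := by positivity
  have hGammaSeq (z : ℝ) : Real.GammaSeq z N = (N : ℝ) ^ z * N ! / risingFactorial z (N + 1) := by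
    rw [Real.GammaSeq, risingFactorial_eq_prod]
  have hbeta := risingFactorial_mul_betaSeries hβ (z := α + 1) (fun r => by positivity) N
  have hbetaN := betaSeries_pos hβ (z := α + 1 + N) (by linarith)
  have hbeta0 := betaSeries_pos hβ (z := α + 1) (by linarith)
  have hαN := risingFactorial_pos (z := α + 1) (by positivity) (N + 1)
  have hβN := risingFactorial_pos (z := β + 1) (by positivity) N
  have hpow : (N : ℝ) ^ (2 * (α + 1)) * (N : ℝ) ^ (β + 1) =
      (N : ℝ) ^ (α + 1) * (N : ℝ) ^ (β + 1 + (α + 1)) := by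
    rw [← Real.rpow_add hN0, ← Real.rpow_add hN0]
    ring_nf
  rw [scaleConst, singConst, interpConst, hGammaSeq, hGammaSeq, hGammaSeq, zero_add, one_mul,
    add_comm (1 : ℝ), Real.div_rpow hN0.le (by positivity), risingFactorial_succ (β + 1),
    risingFactorial_succ (β + 1 + (α + 1))]
  generalize (N : ℝ) ^ (2 * (α + 1)) = p at hpow ⊢
  field_simp
  linear_combination hbeta * (N : ℝ) ^ (α + 1) * (N : ℝ) ^ (β + 1 + (α + 1)) -
    risingFactorial (β + 1 + (α + 1)) N * betaSeries β (α + 1 + N) * hpow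

theorem tendsto_scaleConst (hα : 0 ≤ α) (hβ : 0 < β) :
    Tendsto (scaleConst α β) atTop (𝓝 (1 / Real.Gamma (α + 1) ^ 2)) := by
  have hbeta := betaSeries_pos hβ (z := α + 1) (by linarith)
  have hratio (a b : ℝ) : Tendsto (fun N : ℕ => (a + 1 * N) / (b + 1 * N)) atTop (𝓝 1) := by
    simpa using tendsto_add_mul_div_add_mul_atTop_nhds a b 1 one_ne_zero
  have hGammaSeq := (Real.GammaSeq_tendsto_Gamma (β + 1)).div
    (((Real.GammaSeq_tendsto_Gamma (α + 1)).mul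
      (Real.GammaSeq_tendsto_Gamma (β + 1 + (α + 1)))).mul_const (betaSeries β (α + 1)))
    (by positivity)
  have hlim := (((hratio 0 1).rpow_const (p := 2 * (α + 1)) (Or.inl one_ne_zero)).mul
    (hratio (β + 1) (β + 1 + (α + 1)))).mul hGammaSeq
  have hval : 1 ^ (2 * (α + 1)) * 1 * (Real.Gamma (β + 1) / (Real.Gamma (α + 1) *
      Real.Gamma (β + 1 + (α + 1)) * betaSeries β (α + 1))) = 1 / Real.Gamma (α + 1) ^ 2 := by
    rw [betaSeries_eq_Gamma hβ (by linarith), Real.one_rpow, add_comm (α + 1)]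
    field_simp
  rw [hval] at hlim
  refine hlim.congr' ?_
  filter_upwards [eventually_ne_atTop 0] with N hN
  exact (scaleConst_eq_GammaSeq hα hβ hN).symm

end ScaleConst

section Hankel

open MeasureTheory Matrix
open scoped Polynomial

section Weight

variable {t α β : ℝ}

theorem pjWeight_pos {x : ℝ} (hx : x ∈ Set.Ioo (0 : ℝ) 1) : 0 < pjWeight t α β x := by
  have hx0 := hx.1
  have hx1 : 0 < 1 - x := by linarith [hx.2]
  unfold pjWeight
  positivity

theorem intervalIntegrable_pjWeight (ht : 0 ≤ t) (hα : 0 ≤ α) (hβ : 0 ≤ β) :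
    IntervalIntegrable (pjWeight t α β) volume 0 1 := by
  refine (intervalIntegrable_const (c := (1 : ℝ))).mono_fun
    (Measurable.aestronglyMeasurable (by unfold pjWeight; fun_prop)) ?_
  filter_upwards [ae_restrict_mem measurableSet_uIoc] with x hx
  rw [Set.uIoc_of_le zero_le_one] at hx
  have hx0 : 0 ≤ x := hx.1.le
  have hx1 : 0 ≤ 1 - x := by linarith [hx.2]
  rw [norm_one, pjWeight, Real.norm_of_nonneg (by positivity)]
  refine mul_le_one₀ (mul_le_one₀ (Real.rpow_le_one hx0 hx.2 hα) (by positivity)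
    (Real.rpow_le_one hx1 (by linarith) hβ)) (by positivity) (Real.exp_le_one_iff.2 ?_)
  exact div_nonpos_of_nonpos_of_nonneg (by linarith) hx0

theorem intervalIntegrable_mul_pjWeight (ht : 0 ≤ t) (hα : 0 ≤ α) (hβ : 0 ≤ β) {f : ℝ → ℝ}
    (hf : Continuous f) : IntervalIntegrable (fun x => f x * pjWeight t α β x) volume 0 1 :=
  (intervalIntegrable_pjWeight ht hα hβ).continuousOn_mul hf.continuousOn

theorem integral_eval_sq_mul_pjWeight_pos (ht : 0 ≤ t) (hα : 0 ≤ α) (hβ : 0 ≤ β) {p : ℝ[X]}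
    (hp : p ≠ 0) : 0 < ∫ x in (0 : ℝ)..1, p.eval x * p.eval x * pjWeight t α β x := by
  rw [intervalIntegral.integral_pos_iff_support_of_nonneg_ae' ?_
    (intervalIntegrable_mul_pjWeight ht hα hβ (by fun_prop))]
  · refine ⟨one_pos, ?_⟩
    have hsupport : Set.Ioo (0 : ℝ) 1 \ p.roots.toFinset ⊆
        Function.support (fun x => p.eval x * p.eval x * pjWeight t α β x) ∩ Set.Ioc 0 1 := by
      intro x ⟨hx, hroot⟩
      have heval : p.eval x ≠ 0 := by simpa [hp] using hroot
      exact ⟨mul_ne_zero (mul_self_ne_zero.2 heval) (pjWeight_pos hx).ne',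
        Set.Ioo_subset_Ioc_self hx⟩
    refine lt_of_lt_of_le ?_ (measure_mono hsupport)
    rw [measure_sdiff_null ((Finset.finite_toSet _).measure_zero _)]
    simp
  · rw [Filter.EventuallyLE, ae_restrict_iff' measurableSet_uIoc]
    filter_upwards [Measure.ae_ne volume (1 : ℝ)] with x hx1 hx
    rw [Set.uIoc_of_le zero_le_one] at hx
    exact mul_nonneg (mul_self_nonneg _) (pjWeight_pos ⟨hx.1, hx.2.lt_of_ne hx1⟩).le

end Weight

section HankelMatrix

variable {t α β : ℝ}

/-- The Hankel matrix of the moments of the weight `pjWeight t α β`, with determinant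
`hankelDet n t α β`. -/
noncomputable def hankelMatrix (n : ℕ) (t α β : ℝ) : Matrix (Fin n) (Fin n) ℝ :=
  Matrix.of fun j k : Fin n => ∫ x in (0 : ℝ)..1, x ^ ((j : ℕ) + (k : ℕ)) * pjWeight t α β x

theorem isHermitian_hankelMatrix (n : ℕ) : (hankelMatrix n t α β).IsHermitian := by
  ext j k
  simp [hankelMatrix, add_comm]

theorem dotProduct_hankelMatrix_mulVec (ht : 0 ≤ t) (hα : 0 ≤ α) (hβ : 0 ≤ β) {n : ℕ}
    (u v : Fin n → ℝ) :
    u ⬝ᵥ (hankelMatrix n t α β *ᵥ v) = ∫ x in (0 : ℝ)..1,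
      (∑ j, u j * x ^ (j : ℕ)) * (∑ k, v k * x ^ (k : ℕ)) * pjWeight t α β x := by
  have hexpand (x : ℝ) :
      (∑ j, u j * x ^ (j : ℕ)) * (∑ k, v k * x ^ (k : ℕ)) * pjWeight t α β x =
        ∑ j : Fin n, ∑ k : Fin n, u j * (x ^ ((j : ℕ) + (k : ℕ)) * pjWeight t α β x * v k) := by
    rw [Finset.sum_mul_sum, Finset.sum_mul]
    refine Finset.sum_congr rfl fun j _ => ?_
    rw [Finset.sum_mul]
    exact Finset.sum_congr rfl fun k _ => by ring
  have hint (j k : Fin n) : IntervalIntegrable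
      (fun x => u j * (x ^ ((j : ℕ) + (k : ℕ)) * pjWeight t α β x * v k)) volume 0 1 :=
    ((intervalIntegrable_mul_pjWeight ht hα hβ (continuous_pow _)).mul_const _).const_mul _
  have hintSum (j : Fin n) : IntervalIntegrable
      (fun x => ∑ k : Fin n, u j * (x ^ ((j : ℕ) + (k : ℕ)) * pjWeight t α β x * v k))
      volume 0 1 := by
    simpa only [Finset.sum_fn] using IntervalIntegrable.sum Finset.univ fun k _ => hint j k
  simp_rw [hexpand]
  rw [intervalIntegral.integral_finsetSum fun j _ => hintSum j]
  simp only [dotProduct, mulVec, Finset.mul_sum]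
  refine Finset.sum_congr rfl fun j _ => ?_
  rw [intervalIntegral.integral_finsetSum fun k _ => hint j k]
  refine Finset.sum_congr rfl fun k _ => ?_
  rw [intervalIntegral.integral_const_mul, intervalIntegral.integral_mul_const]
  rfl

theorem posDef_hankelMatrix (ht : 0 ≤ t) (hα : 0 ≤ α) (hβ : 0 ≤ β) (n : ℕ) :
    (hankelMatrix n t α β).PosDef := by
  refine .of_dotProduct_mulVec_pos (isHermitian_hankelMatrix n) fun u hu => ?_
  set p : ℝ[X] := ∑ j : Fin n, Polynomial.monomial (j : ℕ) (u j) with hp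
  have heval (x : ℝ) : ∑ j, u j * x ^ (j : ℕ) = p.eval x := by
    simp [hp, Polynomial.eval_finsetSum]
  have hp0 : p ≠ 0 := by
    obtain ⟨i, hi⟩ := Function.ne_iff.1 hu
    intro h
    have hcoeff := congrArg (fun q => q.coeff (i : ℕ)) h
    exact hi (by simpa [hp, Polynomial.finsetSum_coeff, Polynomial.coeff_monomial, Fin.val_inj]
      using hcoeff)
  rw [star_trivial, dotProduct_hankelMatrix_mulVec ht hα hβ]
  simp_rw [heval]
  exact integral_eval_sq_mul_pjWeight_pos ht hα hβ hp0

theorem hankelDet_pos (ht : 0 ≤ t) (hα : 0 ≤ α) (hβ : 0 ≤ β) (n : ℕ) : 0 < hankelDet n t α β :=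
  (posDef_hankelMatrix ht hα hβ n).det_pos

end HankelMatrix

section LogConvexity

variable {ι : Type*} [Fintype ι] [DecidableEq ι]

theorem one_le_det_one_add_of_posSemidef {X : Matrix ι ι ℝ} (hX : X.PosSemidef) :
    1 ≤ (1 + X).det := by
  have hH : (1 + X).IsHermitian := isHermitian_one.add hX.1
  rw [hH.det_eq_prod_eigenvalues]
  refine Finset.one_le_prod fun i => ?_
  set e : ι → ℝ := ⇑(hH.eigenvectorBasis i) with he
  have hunit : star e ⬝ᵥ e = 1 := by
    rw [dotProduct_comm, he, ← EuclideanSpace.inner_eq_star_dotProduct, real_inner_self_eq_norm_sq,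
      hH.eigenvectorBasis.orthonormal.1 i, one_pow]
  have hnonneg := hX.dotProduct_mulVec_nonneg e
  rw [RCLike.ofReal_real_eq_id, id, hH.eigenvalues_eq, add_mulVec, one_mulVec, dotProduct_add,
    hunit]
  simpa using hnonneg

open scoped MatrixOrder in
theorem det_le_det_of_posDef {A B : Matrix ι ι ℝ} (hA : A.PosDef) (hAB : (B - A).PosSemidef) :
    A.det ≤ B.det := by
  obtain ⟨C, hC⟩ := CStarAlgebra.nonneg_iff_eq_star_mul_self.mp hA.posSemidef.nonneg
  rw [star_eq_conjTranspose] at hC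
  have hdet : A.det = C.det * C.det := by rw [hC, det_mul, det_conjTranspose, star_trivial]
  have hCdet : IsUnit C.det :=
    isUnit_iff_ne_zero.2 fun h => hA.det_pos.ne' (by rw [hdet, h, zero_mul])
  have hX := hAB.conjTranspose_mul_mul_same C⁻¹
  have hB : B = Cᴴ * (1 + C⁻¹ᴴ * (B - A) * C⁻¹) * C := by
    have hinv : C⁻¹ * C = 1 := nonsing_inv_mul _ hCdet
    have hinvH : Cᴴ * C⁻¹ᴴ = 1 := by
      rw [← conjTranspose_mul, hinv, conjTranspose_one]
    calc B = Cᴴ * C + (Cᴴ * C⁻¹ᴴ) * (B - A) * (C⁻¹ * C) := by rw [hinv, hinvH, ← hC]; simp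
      _ = _ := by noncomm_ring
  rw [hdet, hB, det_mul, det_mul, det_conjTranspose, star_trivial]
  nlinarith [mul_self_nonneg C.det, one_le_det_one_add_of_posSemidef hX]

theorem det_sq_le_of_posSemidef_fromBlocks {A B C : Matrix ι ι ℝ} (hA : A.PosDef)
    (hB : B.PosDef) (h : (fromBlocks A B Bᴴ C).PosSemidef) : B.det ^ 2 ≤ A.det * C.det := by
  have := hA.isUnit.invertible
  have hschur := (PosDef.fromBlocks₁₁ B C hA).1 h
  have hpos : (Bᴴ * A⁻¹ * B).PosDef :=
    hA.inv.conjTranspose_mul_mul_same (mulVec_injective_iff_isUnit.2 hB.isUnit)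
  have hdet := det_le_det_of_posDef hpos hschur
  rw [det_mul, det_mul, det_nonsing_inv, Ring.inverse_eq_inv', det_conjTranspose, star_trivial,
    mul_right_comm, ← sq, ← div_eq_mul_inv, div_le_iff₀ hA.det_pos] at hdet
  linarith

variable {s t α β : ℝ}

theorem mul_pjWeight_add_eq_mul_sq (a b x : ℝ) :
    a * a * pjWeight s α β x + 2 * (a * b * pjWeight ((s + t) / 2) α β x) +
        b * b * pjWeight t α β x =
      x ^ α * (1 - x) ^ β *
        (a * Real.exp (-(s / 2) / x) + b * Real.exp (-(t / 2) / x)) ^ 2 := by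
  have hs : Real.exp (-s / x) = Real.exp (-(s / 2) / x) ^ 2 := by
    rw [← Real.exp_nat_mul]; congr 1; push_cast; ring
  have ht : Real.exp (-t / x) = Real.exp (-(t / 2) / x) ^ 2 := by
    rw [← Real.exp_nat_mul]; congr 1; push_cast; ring
  have hst : Real.exp (-((s + t) / 2) / x) =
      Real.exp (-(s / 2) / x) * Real.exp (-(t / 2) / x) := by
    rw [← Real.exp_add]; congr 1; ring
  rw [pjWeight, pjWeight, pjWeight, hs, ht, hst]
  ring

theorem posSemidef_fromBlocks_hankelMatrix (hs : 0 ≤ s) (ht : 0 ≤ t) (hα : 0 ≤ α) (hβ : 0 ≤ β)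
    (n : ℕ) :
    (fromBlocks (hankelMatrix n s α β) (hankelMatrix n ((s + t) / 2) α β)
      (hankelMatrix n ((s + t) / 2) α β)ᴴ (hankelMatrix n t α β)).PosSemidef := by
  have hst : 0 ≤ (s + t) / 2 := by positivity
  refine .of_dotProduct_mulVec_nonneg (IsHermitian.fromBlocks (isHermitian_hankelMatrix n)
    rfl (isHermitian_hankelMatrix n)) fun w => ?_
  obtain ⟨u, v, rfl⟩ : ∃ u v, w = Sum.elim u v := ⟨_, _, (Sum.elim_comp_inl_inr w).symm⟩
  have hcont (a b : Fin n → ℝ) :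
      Continuous fun x : ℝ => (∑ j, a j * x ^ (j : ℕ)) * ∑ j, b j * x ^ (j : ℕ) := by fun_prop
  have huu := intervalIntegrable_mul_pjWeight hs hα hβ (hcont u u)
  have huv := (intervalIntegrable_mul_pjWeight hst hα hβ (hcont u v)).const_mul 2
  have hvv := intervalIntegrable_mul_pjWeight ht hα hβ (hcont v v)
  have hswap : v ⬝ᵥ hankelMatrix n ((s + t) / 2) α β *ᵥ u =
      u ⬝ᵥ hankelMatrix n ((s + t) / 2) α β *ᵥ v := by
    simp only [dotProduct_hankelMatrix_mulVec hst hα hβ, mul_comm (∑ j, v j * _)]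
  rw [star_trivial, fromBlocks_mulVec, sumElim_dotProduct_sumElim, Sum.elim_comp_inl,
    Sum.elim_comp_inr, isHermitian_hankelMatrix, dotProduct_add, dotProduct_add, hswap,
    ← add_assoc, add_assoc (_ ⬝ᵥ _), ← two_mul, dotProduct_hankelMatrix_mulVec hs hα hβ,
    dotProduct_hankelMatrix_mulVec hst hα hβ, dotProduct_hankelMatrix_mulVec ht hα hβ,
    ← intervalIntegral.integral_const_mul, ← intervalIntegral.integral_add huu huv,
    ← intervalIntegral.integral_add (huu.add huv) hvv]
  refine intervalIntegral.integral_nonneg zero_le_one fun x hx => ?_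
  have hx0 := hx.1
  have hx1 : 0 ≤ 1 - x := by linarith [hx.2]
  rw [mul_pjWeight_add_eq_mul_sq]
  positivity

theorem hankelDet_sq_le (hs : 0 ≤ s) (ht : 0 ≤ t) (hα : 0 ≤ α) (hβ : 0 ≤ β) (n : ℕ) :
    hankelDet n ((s + t) / 2) α β ^ 2 ≤ hankelDet n s α β * hankelDet n t α β :=
  det_sq_le_of_posSemidef_fromBlocks (posDef_hankelMatrix hs hα hβ n)
    (posDef_hankelMatrix (by positivity) hα hβ n)
    (posSemidef_fromBlocks_hankelMatrix hs ht hα hβ n)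

end LogConvexity

end Hankel

section Perturbation

open Finset (range)
open MeasureTheory Matrix
open scoped Nat

variable {α β : ℝ}

theorem hankelMatrix_zero_apply (hα : 0 ≤ α) (hβ : 0 < β) {n : ℕ} (j k : Fin n) :
    hankelMatrix n 0 α β j k = betaSeries β (α + 1 + j + k) := by
  rw [show α + 1 + j + k = α + j + k + 1 by ring,
    ← integral_rpow_mul_one_sub_rpow (by positivity) hβ]
  refine intervalIntegral.integral_congr_ae (.of_forall fun x hx => ?_)
  rw [Set.uIoc_of_le zero_le_one] at hx
  rw [pjWeight, show α + j + k = α + ((j : ℕ) + (k : ℕ) : ℕ) by push_cast; ring,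
    Real.rpow_add_natCast hx.1.ne', neg_zero, zero_div, Real.exp_zero]
  ring

/-- The matrix of the unipotent change of basis `x ^ k ↦ ∑ m ≤ k, t ^ (k - m) / (k - m)! * x ^ m`,
which turns the moments of `pjWeight t α β` into integrals against truncated exponentials. -/
noncomputable def truncMatrix (n : ℕ) (t : ℝ) : Matrix (Fin n) (Fin n) ℝ :=
  Matrix.of fun m k : Fin n => if m ≤ k then t ^ ((k : ℕ) - m) / ((k : ℕ) - m)! else 0

theorem det_truncMatrix (n : ℕ) (t : ℝ) : (truncMatrix n t).det = 1 := by
  have hupper : (truncMatrix n t).IsUpperTriangular := fun i j hij =>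
    if_neg (not_le.2 hij)
  rw [det_of_isUpperTriangular hupper]
  simp [truncMatrix]

theorem sum_mul_truncMatrix {n : ℕ} (t : ℝ) (f : ℕ → ℝ) (k : Fin n) :
    ∑ m : Fin n, f m * truncMatrix n t m k =
      ∑ m ∈ range (k + 1), f (k - m) * (t ^ m / m !) := by
  have hsum := Fin.sum_univ_eq_sum_range
    (fun m => f m * (if m ≤ (k : ℕ) then t ^ ((k : ℕ) - m) / ((k : ℕ) - m)! else 0)) n
  simp only [truncMatrix, of_apply, Fin.le_def]
  rw [hsum, ← Finset.sum_subset (Finset.range_mono (Nat.succ_le_of_lt k.2)) fun m _ hm => by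
    rw [if_neg (by simpa [Nat.lt_succ_iff] using hm), mul_zero], ← Finset.sum_range_reflect]
  refine Finset.sum_congr rfl fun m hm => ?_
  have hmk : m ≤ k := Nat.lt_succ_iff.1 (Finset.mem_range.1 hm)
  rw [Nat.succ_sub_one, if_pos (Nat.sub_le _ _), Nat.sub_sub_self hmk]

theorem hankelMatrix_mul_truncMatrix_apply {t : ℝ} (ht : 0 ≤ t) (hα : 0 ≤ α) (hβ : 0 ≤ β)
    {n : ℕ} (j k : Fin n) : (hankelMatrix n t α β * truncMatrix n t) j k =
      ∫ x in (0 : ℝ)..1, x ^ (α + (j : ℕ) + (k : ℕ)) * (1 - x) ^ β * truncExp k (t / x) := by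
  rw [mul_apply]
  simp only [hankelMatrix, of_apply]
  simp_rw [← intervalIntegral.integral_mul_const]
  rw [← intervalIntegral.integral_finsetSum fun m _ => (intervalIntegrable_mul_pjWeight ht hα hβ
    (continuous_pow _)).mul_const _]
  refine intervalIntegral.integral_congr_ae (.of_forall fun x hx => ?_)
  rw [Set.uIoc_of_le zero_le_one] at hx
  have hx0 := hx.1.ne'
  refine (sum_mul_truncMatrix t (fun m => x ^ ((j : ℕ) + m) * pjWeight t α β x) k).trans ?_
  rw [truncExp, Finset.mul_sum, Finset.mul_sum]
  refine Finset.sum_congr rfl fun m hm => ?_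
  have hmk : m ≤ k := Nat.lt_succ_iff.1 (Finset.mem_range.1 hm)
  obtain ⟨l, hl⟩ := Nat.exists_eq_add_of_le hmk
  rw [hl, Nat.add_sub_cancel_left, pjWeight, div_pow,
    show α + (j : ℕ) + (m + l : ℕ) = α + ((j : ℕ) + l + m : ℕ) by push_cast; ring,
    Real.rpow_add_natCast hx0, pow_add x _ m, neg_div]
  field_simp

/-- The entries of the perturbation of the identity matrix whose determinant is the ratio of the
Hankel determinants, as functions of the inverse size `x` and of `c = scaleConst α β N`. -/
noncomputable def realEntry (α β x c σ : ℝ) (i k : ℕ) : ℝ :=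
  -(∑' m, regCoeff α β x i k m * σ ^ (k + m + 1) +
    c * σ ^ (α + 1) * ∑' m, singCoeff α β x i k m * σ ^ (k + m))

/-- The `(N + 1) × (N + 1)` section of the infinite matrix `realEntry`. -/
noncomputable def realMatrix (α β σ : ℝ) (N : ℕ) : Matrix (Fin (N + 1)) (Fin (N + 1)) ℝ :=
  Matrix.of fun i k => realEntry α β ((N : ℝ) + 1)⁻¹ (scaleConst α β N) σ i k

theorem hankelMatrix_mul_truncMatrix_eq {σ : ℝ} (hα : 0 < α) (hβ : 0 < β)
    (hαZ : ∀ k : ℤ, α ≠ k) (hσ : 0 < σ) (N : ℕ) :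
    hankelMatrix (N + 1) (σ / ((N : ℝ) + 1) ^ 2) α β *
        truncMatrix (N + 1) (σ / ((N : ℝ) + 1) ^ 2) =
      hankelMatrix (N + 1) 0 α β *
        (1 + diagonal (fun i : Fin (N + 1) => ((N : ℝ) + 1) ^ (2 * (i : ℕ))) * realMatrix α β σ N *
          diagonal fun i : Fin (N + 1) => (((N : ℝ) + 1) ^ (2 * (i : ℕ)))⁻¹) := by
  rw [mul_add, mul_one]
  ext j k
  rw [hankelMatrix_mul_truncMatrix_apply (by positivity) hα.le hβ.le,
    integral_truncExp_eq_sum hα hβ hαZ hσ (Nat.lt_succ_iff.1 j.2), Matrix.add_apply,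
    hankelMatrix_zero_apply hα.le hβ, mul_apply, Finset.sum_range, sub_eq_add_neg,
    ← Finset.sum_neg_distrib]
  congr 1
  refine Finset.sum_congr rfl fun i _ => ?_
  rw [hankelMatrix_zero_apply hα.le hβ, mul_diagonal, diagonal_mul, realMatrix, of_apply,
    realEntry]
  ring

theorem det_one_add_diagonal_mul_mul_diagonal_inv {ι : Type*} [Fintype ι] [DecidableEq ι]
    {d : ι → ℝ} (hd : ∀ i, d i ≠ 0) (M : Matrix ι ι ℝ) :
    (1 + diagonal d * M * diagonal fun i => (d i)⁻¹).det = (1 + M).det := by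
  have hinv : (diagonal fun i => (d i)⁻¹) * diagonal d = 1 := by
    rw [diagonal_mul_diagonal, ← diagonal_one]
    exact congrArg diagonal (funext fun i => inv_mul_cancel₀ (hd i))
  rw [mul_assoc, det_one_add_mul_comm, mul_assoc, hinv, mul_one]

theorem hankelDet_eq_mul_det {σ : ℝ} (hα : 0 < α) (hβ : 0 < β) (hαZ : ∀ k : ℤ, α ≠ k)
    (hσ : 0 < σ) (N : ℕ) :
    hankelDet (N + 1) (σ / ((N : ℝ) + 1) ^ 2) α β =
      hankelDet (N + 1) 0 α β * (1 + realMatrix α β σ N).det := by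
  have hdet := congrArg det (hankelMatrix_mul_truncMatrix_eq hα hβ hαZ hσ N)
  rwa [det_mul, det_truncMatrix, mul_one, det_mul,
    det_one_add_diagonal_mul_mul_diagonal_inv fun i => by positivity] at hdet

end Perturbation

section Minors

open Matrix
open scoped Polynomial

/-- The principal minor of a possibly infinite matrix on a finite index set. -/
def minor {ι R : Type*} [DecidableEq ι] [CommRing R] (M : ι → ι → R) (S : Finset ι) : R :=
  (Matrix.of fun i k : S => M i k).det

section Algebra

variable {R : Type*} [CommRing R]

theorem minor_empty {ι : Type*} [DecidableEq ι] (M : ι → ι → R) : minor M ∅ = 1 := det_isEmpty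

theorem minor_singleton {ι : Type*} [DecidableEq ι] (M : ι → ι → R) (k : ι) :
    minor M {k} = M k k :=
  det_eq_elem_of_subsingleton _ (⟨k, Finset.mem_singleton_self k⟩ : ({k} : Finset ι))

theorem minor_eq_zero_of_col {ι : Type*} [DecidableEq ι] {M : ι → ι → R} {S : Finset ι} {k : ι}
    (hk : k ∈ S) (h : ∀ i, M i k = 0) : minor M S = 0 :=
  det_eq_zero_of_column_eq_zero (⟨k, hk⟩ : S) fun i => h i

theorem det_one_add_eq_sum_minor {ι : Type*} [Fintype ι] [DecidableEq ι] (M : Matrix ι ι R) :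
    (1 + M).det = ∑ S, minor M S := by
  set p : R[X] := (1 + (Polynomial.X : R[X]) • M.map Polynomial.C).det with hp
  have hdeg : p.natDegree < Fintype.card ι + 1 := by
    have hle := Polynomial.natDegree_det_X_add_C_le M 1
    rw [Matrix.map_one _ Polynomial.C.map_zero Polynomial.C.map_one, add_comm] at hle
    exact Nat.lt_succ_of_le hle
  have heval : p.eval 1 = (1 + M).det := by
    rw [hp, ← Polynomial.coe_evalRingHom, RingHom.map_det]
    congr 1
    ext i j
    simp [Matrix.one_apply, apply_ite]
  rw [← heval, Polynomial.eval_eq_sum_range' hdeg]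
  simp only [one_pow, mul_one, hp, coeff_det_one_add_X_smul_eq_sum_minors]
  rw [← Finset.powerset_univ, Finset.sum_powerset, Finset.card_univ]
  rfl

theorem minor_map_valEmbedding (M : ℕ → ℕ → R) {n : ℕ} (S : Finset (Fin n)) :
    minor M (S.map Fin.valEmbedding) = minor (fun i k : Fin n => M i k) S := by
  have hbij : Function.Bijective fun i : S =>
      (⟨(i : Fin n), Finset.mem_map_of_mem Fin.valEmbedding i.2⟩ : S.map Fin.valEmbedding) := by
    refine ⟨fun a b h => Subtype.ext (Fin.ext (congrArg Subtype.val h)), ?_⟩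
    rintro ⟨b, hb⟩
    obtain ⟨a, ha, rfl⟩ := Finset.mem_map.1 hb
    exact ⟨⟨a, ha⟩, rfl⟩
  rw [minor, ← det_submatrix_equiv_self (Equiv.ofBijective _ hbij)]
  rfl

theorem det_one_add_eq_tsum_minor [TopologicalSpace R] {M : ℕ → ℕ → R} {n : ℕ}
    (hM : ∀ i k, n ≤ i → M i k = 0) :
    (1 + Matrix.of fun i k : Fin n => M i k).det = ∑' S, minor M S := by
  rw [det_one_add_eq_sum_minor, ← tsum_fintype (L := .unconditional _),
    ← (Finset.map_injective (Fin.valEmbedding (n := n))).tsum_eq]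
  · exact tsum_congr fun S => (minor_map_valEmbedding M S).symm
  · intro S hS
    by_cases h : ∀ i ∈ S, i < n
    · exact ⟨S.attachFin h, Finset.map_valEmbedding_attachFin h⟩
    · push Not at h
      obtain ⟨i, hi, hin⟩ := h
      exact absurd (det_eq_zero_of_row_eq_zero (⟨i, hi⟩ : S) fun k => hM i k hin) hS

theorem tendsto_minor [TopologicalSpace R] [IsTopologicalRing R] {ι κ : Type*} [DecidableEq κ]
    {l : Filter ι} {M : ι → κ → κ → R} {M' : κ → κ → R}
    (h : ∀ i k, Tendsto (fun a => M a i k) l (𝓝 (M' i k))) (S : Finset κ) :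
    Tendsto (fun a => minor (M a) S) l (𝓝 (minor M' S)) :=
  ((continuous_id.matrix_det (R := R)).tendsto _).comp
    (tendsto_pi_nhds.2 fun i => tendsto_pi_nhds.2 fun k => h i k)

end Algebra

section Norm

variable {𝕜 ι : Type*} [DecidableEq ι]

theorem norm_det_le_prod_sum [NormedField 𝕜] [Fintype ι] (A : Matrix ι ι 𝕜) :
    ‖A.det‖ ≤ ∏ k, ∑ i, ‖A i k‖ := by
  rw [det_apply, Finset.prod_univ_sum, Fintype.piFinset_univ]
  calc _ ≤ ∑ σ : Equiv.Perm ι, ∏ k, ‖A (σ k) k‖ := by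
        refine (norm_sum_le _ _).trans (Finset.sum_le_sum fun σ _ => ?_)
        rw [← norm_prod]
        rcases Int.units_eq_one_or (Equiv.Perm.sign σ) with h | h <;> simp [h]
    _ = ∑ f ∈ Finset.univ.map ⟨fun σ : Equiv.Perm ι => (σ : ι → ι), DFunLike.coe_injective⟩,
          ∏ k, ‖A (f k) k‖ := by rw [Finset.sum_map]; rfl
    _ ≤ _ := Finset.sum_le_sum_of_subset_of_nonneg (Finset.subset_univ _)
        fun f _ _ => Finset.prod_nonneg fun _ _ => norm_nonneg _

theorem norm_minor_le [NormedField 𝕜] {M : ι → ι → 𝕜} {u v : ι → ℝ} (hu : ∀ i, 0 ≤ u i)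
    (hv : ∀ i, 0 ≤ v i) (hsum : Summable u) (hM : ∀ i k, ‖M i k‖ ≤ u i * v k) (S : Finset ι) :
    ‖minor M S‖ ≤ ∏ k ∈ S, (∑' i, u i) * v k := by
  refine (norm_det_le_prod_sum _).trans ?_
  rw [← Finset.prod_coe_sort S]
  refine Finset.prod_le_prod (fun _ _ => Finset.sum_nonneg fun _ _ => norm_nonneg _) fun k _ => ?_
  calc _ ≤ ∑ i : S, u i * v k := Finset.sum_le_sum fun i _ => hM i k
    _ = (∑ i ∈ S, u i) * v k := by rw [← Finset.sum_mul, Finset.sum_coe_sort S]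
    _ ≤ _ := mul_le_mul_of_nonneg_right (hsum.sum_le_tsum _ fun i _ => hu i) (hv _)

theorem differentiable_minor [NontriviallyNormedField 𝕜] {M : 𝕜 → ι → ι → 𝕜}
    (h : ∀ i k, Differentiable 𝕜 fun z => M z i k) (S : Finset ι) :
    Differentiable 𝕜 fun z => minor (M z) S := by
  simp only [minor, det_apply, of_apply]
  refine Differentiable.fun_sum fun σ _ => Differentiable.const_smul ?_ _
  exact Differentiable.fun_finsetProd fun i _ => h _ _

end Norm

end Minors

section InfDet

open MeasureTheory Matrix
open scoped Nat

section EntrySeries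

variable {a : ℕ → ℝ} {A K : ℝ}

theorem norm_coeff_mul_pow_le (h : ∀ m, |a m| ≤ A * (K ^ m / m !)) {r : ℝ} {σ : ℂ} (hσ : ‖σ‖ ≤ r)
    (q m : ℕ) : ‖(a m : ℂ) * σ ^ (q + m)‖ ≤ A * r ^ q * ((K * r) ^ m / m !) := by
  have hr : 0 ≤ r := (norm_nonneg σ).trans hσ
  rw [norm_mul, norm_pow, Complex.norm_real, Real.norm_eq_abs]
  calc |a m| * ‖σ‖ ^ (q + m) ≤ |a m| * r ^ (q + m) := by gcongr
    _ ≤ A * (K ^ m / m !) * r ^ (q + m) := by gcongr; exact h m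
    _ = _ := by rw [mul_pow, pow_add]; ring

theorem hasSum_const_mul_pow_div_factorial (b y : ℝ) :
    HasSum (fun m : ℕ => b * (y ^ m / m !)) (b * Real.exp y) := by
  rw [Real.exp_eq_exp_ℝ]
  exact (NormedSpace.expSeries_div_hasSum_exp y).mul_left b

theorem norm_tsum_coeff_mul_pow_le (h : ∀ m, |a m| ≤ A * (K ^ m / m !)) {r : ℝ} {σ : ℂ}
    (hσ : ‖σ‖ ≤ r) (q : ℕ) : ‖∑' m, (a m : ℂ) * σ ^ (q + m)‖ ≤ A * r ^ q * Real.exp (K * r) :=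
  tsum_of_norm_bounded (hasSum_const_mul_pow_div_factorial _ _) (norm_coeff_mul_pow_le h hσ q)

theorem differentiable_tsum_coeff_mul_pow (h : ∀ m, |a m| ≤ A * (K ^ m / m !)) (q : ℕ) :
    Differentiable ℂ fun σ : ℂ => ∑' m, (a m : ℂ) * σ ^ (q + m) := by
  intro z
  have hdiff := Complex.differentiableOn_tsum_of_summable_norm (U := Metric.ball 0 (‖z‖ + 1))
    (hasSum_const_mul_pow_div_factorial _ _).summable
    (F := fun m σ => (a m : ℂ) * σ ^ (q + m)) (fun m => by fun_prop) Metric.isOpen_ball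
    (fun m w hw => norm_coeff_mul_pow_le h (mem_ball_zero_iff.1 hw).le q m)
  exact hdiff.differentiableAt (Metric.isOpen_ball.mem_nhds (by simp))

theorem isBigO_tsum_coeff_mul_pow_sub (h : ∀ m, |a m| ≤ A * (K ^ m / m !)) (q n : ℕ) :
    (fun σ : ℂ => ∑' m, (a m : ℂ) * σ ^ (q + m) -
      ∑ m ∈ Finset.range n, (a m : ℂ) * σ ^ (q + m)) =O[𝓝 0] fun σ => σ ^ (q + n) := by
  have hsum : Summable fun m => |a (m + n)| :=
    (summable_nat_add_iff n).2 (.of_nonneg_of_le (fun _ => abs_nonneg _) h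
      (hasSum_const_mul_pow_div_factorial A K).summable)
  refine IsBigO.of_bound (∑' m, |a (m + n)|) ?_
  filter_upwards [Metric.closedBall_mem_nhds (0 : ℂ) one_pos] with σ hσ
  rw [mem_closedBall_zero_iff] at hσ
  have hs : Summable fun m => (a m : ℂ) * σ ^ (q + m) :=
    .of_norm_bounded (hasSum_const_mul_pow_div_factorial _ _).summable
      (norm_coeff_mul_pow_le h le_rfl q)
  rw [← hs.sum_add_tsum_nat_add n, add_sub_cancel_left, norm_pow]
  refine tsum_of_norm_bounded (hsum.hasSum.mul_right _) fun m => ?_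
  rw [norm_mul, norm_pow, Complex.norm_real, Real.norm_eq_abs]
  exact mul_le_mul_of_nonneg_left (pow_le_pow_of_le_one (norm_nonneg _) hσ (by lia))
    (abs_nonneg _)

theorem tendsto_tsum_coeff_mul_pow {ι : Type*} {l : Filter ι} {a : ι → ℕ → ℝ} {a₀ : ℕ → ℝ}
    (h : ∀ j m, |a j m| ≤ A * (K ^ m / m !)) (ha : ∀ m, Tendsto (fun j => a j m) l (𝓝 (a₀ m)))
    (σ : ℂ) (q : ℕ) :
    Tendsto (fun j => ∑' m, (a j m : ℂ) * σ ^ (q + m)) l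
      (𝓝 (∑' m, (a₀ m : ℂ) * σ ^ (q + m))) :=
  tendsto_tsum_of_dominated_convergence (hasSum_const_mul_pow_div_factorial _ _).summable
    (fun m => ((Complex.continuous_ofReal.tendsto _).comp (ha m)).mul_const _)
    (.of_forall fun j m => norm_coeff_mul_pow_le (h j) le_rfl q m)

end EntrySeries

/-- The part of the perturbation that is a power series in the scaled variable `σ`. -/
noncomputable def regEntry (α β x : ℝ) (i k : ℕ) (σ : ℂ) : ℂ :=
  ∑' m, (regCoeff α β x i k m : ℂ) * σ ^ (k + 1 + m)

/-- The power series in `σ` which multiplies the non-integral power of `σ` in the perturbation. -/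
noncomputable def singEntry (α β x : ℝ) (i k : ℕ) (σ : ℂ) : ℂ :=
  ∑' m, (singCoeff α β x i k m : ℂ) * σ ^ (k + m)

/-- The complexification of `realEntry`, where `τ` stands for `c * σ ^ (α + 1)` and is treated as
a variable independent of `σ`. -/
noncomputable def entry (α β x : ℝ) (σ τ : ℂ) (i k : ℕ) : ℂ :=
  -(regEntry α β x i k σ + τ * singEntry α β x i k σ)

/-- The determinant of the perturbed identity matrix as the sum of all the principal minors of the
perturbation; `x = 1 / n` gives the `n × n` matrices and `x = 0` their limit. -/
noncomputable def infDet (α β x : ℝ) (σ τ : ℂ) : ℂ := ∑' S, minor (entry α β x σ τ) S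

variable {α β : ℝ}

theorem exists_norm_entry_le (hα : 0 ≤ α) (hβ : 0 ≤ β) (hαZ : ∀ k : ℤ, α ≠ k) (r T : ℝ) :
    ∃ c B : ℝ, 0 < c ∧ 0 < B ∧ ∀ x, IsScale x → ∀ σ τ : ℂ, ‖σ‖ ≤ r → ‖τ‖ ≤ T → ∀ i k,
      ‖entry α β x σ τ i k‖ ≤ B * (c ^ i / i !) * ((r + T) * (r ^ k / k !)) := by
  obtain ⟨c, C, K, hc, hC, -, h⟩ := exists_abs_coeff_le hα hβ hαZ
  refine ⟨c, C * Real.exp (K * r), hc, by positivity, fun x hx σ τ hσ hτ i k => ?_⟩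
  have hT : 0 ≤ T := (norm_nonneg τ).trans hτ
  have hreg := norm_tsum_coeff_mul_pow_le (fun m => (h x hx i k m).1) hσ (k + 1)
  have hsing := norm_tsum_coeff_mul_pow_le (fun m => (h x hx i k m).2) hσ k
  rw [entry, norm_neg]
  calc ‖regEntry α β x i k σ + τ * singEntry α β x i k σ‖
      ≤ ‖regEntry α β x i k σ‖ + ‖τ‖ * ‖singEntry α β x i k σ‖ := by
        rw [← norm_mul]; exact norm_add_le _ _
    _ ≤ C * (c ^ i / i !) * (1 / k !) * r ^ (k + 1) * Real.exp (K * r) +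
        T * (C * (c ^ i / i !) * (1 / k !) * r ^ k * Real.exp (K * r)) := by
        gcongr
        exacts [hreg, hsing]
    _ = _ := by rw [pow_succ]; ring

theorem exists_summable_norm_minor_entry_le (hα : 0 ≤ α) (hβ : 0 ≤ β) (hαZ : ∀ k : ℤ, α ≠ k)
    (r T : ℝ) :
    ∃ b : Finset ℕ → ℝ, Summable b ∧ ∀ x, IsScale x → ∀ σ τ : ℂ, ‖σ‖ ≤ r → ‖τ‖ ≤ T →
      ∀ S, ‖minor (entry α β x σ τ) S‖ ≤ b S := by
  obtain ⟨c, B, hc, hB, h⟩ := exists_norm_entry_le hα hβ hαZ |r| |T|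
  have hu : Summable fun i : ℕ => B * (c ^ i / i !) :=
    (Real.summable_pow_div_factorial c).mul_left B
  have hv : Summable fun k : ℕ => (|r| + |T|) * (|r| ^ k / k !) :=
    (Real.summable_pow_div_factorial |r|).mul_left _
  refine ⟨fun S => ∏ k ∈ S, (∑' i : ℕ, B * (c ^ i / i !)) * ((|r| + |T|) * (|r| ^ k / k !)),
    summable_finsetProd_of_summable_nonneg
      (fun k => mul_nonneg (tsum_nonneg fun _ => by positivity) (by positivity)) (hv.mul_left _),
    fun x hx σ τ hσ hτ S => ?_⟩
  exact norm_minor_le (fun i => by positivity) (fun k => by positivity) hu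
    (h x hx σ τ (hσ.trans (le_abs_self r)) (hτ.trans (le_abs_self T))) S

theorem exists_norm_infDet_le (hα : 0 ≤ α) (hβ : 0 ≤ β) (hαZ : ∀ k : ℤ, α ≠ k) (r T : ℝ) :
    ∃ C : ℝ, ∀ x, IsScale x → ∀ σ τ : ℂ, ‖σ‖ ≤ r → ‖τ‖ ≤ T → ‖infDet α β x σ τ‖ ≤ C := by
  obtain ⟨b, hb, h⟩ := exists_summable_norm_minor_entry_le hα hβ hαZ r T
  exact ⟨∑' S, b S, fun x hx σ τ hσ hτ => tsum_of_norm_bounded hb.hasSum (h x hx σ τ hσ hτ)⟩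

theorem differentiable_regEntry (hα : 0 ≤ α) (hβ : 0 ≤ β) (hαZ : ∀ k : ℤ, α ≠ k) {x : ℝ}
    (hx : IsScale x) (i k : ℕ) : Differentiable ℂ (regEntry α β x i k) := by
  obtain ⟨c, C, K, -, -, -, h⟩ := exists_abs_coeff_le hα hβ hαZ
  exact differentiable_tsum_coeff_mul_pow (fun m => (h x hx i k m).1) _

theorem differentiable_singEntry (hα : 0 ≤ α) (hβ : 0 ≤ β) {x : ℝ} (hx : IsScale x) (i k : ℕ) :
    Differentiable ℂ (singEntry α β x i k) :=
  differentiable_tsum_coeff_mul_pow (abs_singCoeff_le hα hβ hx i k) _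

theorem differentiable_infDet_comp (hα : 0 ≤ α) (hβ : 0 ≤ β) (hαZ : ∀ k : ℤ, α ≠ k) {x : ℝ}
    (hx : IsScale x) {σ τ : ℂ → ℂ} (hσ : Differentiable ℂ σ) (hτ : Differentiable ℂ τ) :
    Differentiable ℂ fun z => infDet α β x (σ z) (τ z) := by
  intro z
  obtain ⟨r, hr⟩ := (isCompact_closedBall z 1).exists_bound_of_continuousOn
    hσ.continuous.continuousOn
  obtain ⟨T, hT⟩ := (isCompact_closedBall z 1).exists_bound_of_continuousOn
    hτ.continuous.continuousOn
  obtain ⟨b, hb, h⟩ := exists_summable_norm_minor_entry_le hα hβ hαZ r T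
  have hentry (i k : ℕ) : Differentiable ℂ fun w => entry α β x (σ w) (τ w) i k :=
    (((differentiable_regEntry hα hβ hαZ hx i k).comp hσ).add
      (hτ.mul ((differentiable_singEntry hα hβ hx i k).comp hσ))).neg
  have hdiff := Complex.differentiableOn_tsum_of_summable_norm (U := Metric.ball z 1) hb
    (F := fun S w => minor (entry α β x (σ w) (τ w)) S)
    (fun S => (differentiable_minor hentry S).differentiableOn) Metric.isOpen_ball
    (fun S w hw => h x hx _ _ (hr w (Metric.ball_subset_closedBall hw))
      (hT w (Metric.ball_subset_closedBall hw)) S)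
  exact hdiff.differentiableAt (Metric.isOpen_ball.mem_nhds (by simp))

theorem tendsto_entry (hα : 0 ≤ α) (hβ : 0 ≤ β) (hαZ : ∀ k : ℤ, α ≠ k) (σ : ℂ) {τ : ℕ → ℂ}
    {τ₀ : ℂ} (hτ : Tendsto τ atTop (𝓝 τ₀)) (i k : ℕ) :
    Tendsto (fun N : ℕ => entry α β ((N : ℝ) + 1)⁻¹ σ (τ N) i k) atTop
      (𝓝 (entry α β 0 σ τ₀ i k)) := by
  obtain ⟨c, C, K, -, -, -, h⟩ := exists_abs_coeff_le hα hβ hαZ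
  have hscale (N : ℕ) : IsScale ((N : ℝ) + 1)⁻¹ := Or.inr ⟨N, rfl⟩
  have hzero : Tendsto (fun N : ℕ => ((N : ℝ) + 1)⁻¹) atTop (𝓝 0) := by
    simpa using tendsto_one_div_add_atTop_nhds_zero_nat (𝕜 := ℝ)
  refine ((tendsto_tsum_coeff_mul_pow (fun N m => (h _ (hscale N) i k m).1)
    (fun m => ((continuous_regCoeff α β i k m).tendsto 0).comp hzero) σ _).add
    (hτ.mul (tendsto_tsum_coeff_mul_pow (fun N m => (h _ (hscale N) i k m).2)
      (fun m => ((continuous_singCoeff α β i k m).tendsto 0).comp hzero) σ _))).neg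

theorem tendsto_infDet (hα : 0 ≤ α) (hβ : 0 ≤ β) (hαZ : ∀ k : ℤ, α ≠ k) (σ : ℂ) {τ : ℕ → ℂ}
    {τ₀ : ℂ} (hτ : Tendsto τ atTop (𝓝 τ₀)) :
    Tendsto (fun N : ℕ => infDet α β ((N : ℝ) + 1)⁻¹ σ (τ N)) atTop (𝓝 (infDet α β 0 σ τ₀)) := by
  obtain ⟨T, hT⟩ := hτ.norm.bddAbove_range
  obtain ⟨b, hb, h⟩ := exists_summable_norm_minor_entry_le hα hβ hαZ ‖σ‖ T
  exact tendsto_tsum_of_dominated_convergence hb (tendsto_minor (tendsto_entry hα hβ hαZ σ hτ))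
    (.of_forall fun N S => h _ (Or.inr ⟨N, rfl⟩) _ _ le_rfl (hT ⟨N, rfl⟩) S)

theorem entry_eq_ofReal (x c σ : ℝ) (i k : ℕ) :
    entry α β x (σ : ℂ) (c * σ ^ (α + 1) : ℝ) i k = (realEntry α β x c σ i k : ℂ) := by
  simp only [entry, realEntry, regEntry, singEntry, add_right_comm k]
  push_cast
  rfl

theorem entry_inv_eq_zero {N i : ℕ} (hi : N + 1 ≤ i) (σ τ : ℂ) (k : ℕ) :
    entry α β ((N : ℝ) + 1)⁻¹ σ τ i k = 0 := by
  simp [entry, regEntry, singEntry, regCoeff, singCoeff, rowFactor_eq_zero α β hi]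

theorem hankelDet_div_hankelDet_eq_infDet (hα : 0 < α) (hβ : 0 < β) (hαZ : ∀ k : ℤ, α ≠ k)
    {σ : ℝ} (hσ : 0 < σ) (N : ℕ) :
    ((hankelDet (N + 1) (σ / ((N : ℝ) + 1) ^ 2) α β / hankelDet (N + 1) 0 α β : ℝ) : ℂ) =
      infDet α β ((N : ℝ) + 1)⁻¹ σ (scaleConst α β N * σ ^ (α + 1) : ℝ) := by
  rw [hankelDet_eq_mul_det hα hβ hαZ hσ,
    mul_div_cancel_left₀ _ (hankelDet_pos le_rfl hα.le hβ.le _).ne', infDet,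
    ← det_one_add_eq_tsum_minor fun i k hi => entry_inv_eq_zero hi _ _ k,
    ← Complex.ofRealHom_eq_coe, RingHom.map_det, map_add, map_one]
  congr 2
  ext i k
  exact (entry_eq_ofReal _ _ _ _ _).symm

end InfDet

section Taylor

open scoped Nat

section SecondOrder

variable {f : ℂ → ℂ} {C : ℝ}

theorem differentiable_dslope (hf : Differentiable ℂ f) (c : ℂ) : Differentiable ℂ (dslope f c) :=
  differentiableOn_univ.1 ((Complex.differentiableOn_dslope univ_mem).2 hf.differentiableOn)

theorem norm_dslope_zero_le (hf : Differentiable ℂ f) {R : ℝ} (hR : 0 < R)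
    (hC : ∀ z, ‖z‖ ≤ R → ‖f z‖ ≤ C) {z : ℂ} (hz : ‖z‖ ≤ R) : ‖dslope f 0 z‖ ≤ 2 * C / R := by
  refine Complex.norm_le_of_forall_mem_frontier_norm_le (U := Metric.ball (0 : ℂ) R)
    Metric.isBounded_ball (differentiable_dslope hf 0).diffContOnCl (fun w hw => ?_)
    (by rwa [closure_ball _ hR.ne', mem_closedBall_zero_iff])
  rw [frontier_ball _ hR.ne', mem_sphere_zero_iff_norm] at hw
  have hw0 : w ≠ 0 := norm_pos_iff.1 (hw ▸ hR)
  rw [dslope_of_ne _ hw0, slope_def_module, sub_zero, norm_smul, norm_inv, hw, inv_mul_eq_div]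
  gcongr
  linarith [norm_sub_le (f w) (f 0), hC w hw.le, hC 0 (by simpa using hR.le)]

theorem norm_sub_taylor_le (hf : Differentiable ℂ f) (hC : ∀ z, ‖z‖ ≤ 2 → ‖f z‖ ≤ C) {z : ℂ}
    (hz : ‖z‖ ≤ 2) : ‖f z - f 0 - z * deriv f 0‖ ≤ C * ‖z‖ ^ 2 := by
  have hslope (w : ℂ) (hw : ‖w‖ ≤ 2) : ‖dslope f 0 w‖ ≤ C := by
    simpa using norm_dslope_zero_le hf two_pos hC hw
  have hslope₂ : ‖dslope (dslope f 0) 0 z‖ ≤ C := by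
    simpa using norm_dslope_zero_le (differentiable_dslope hf 0) two_pos hslope hz
  have h₁ := sub_smul_dslope f 0 z
  have h₂ := sub_smul_dslope (dslope f 0) 0 z
  simp only [dslope_same, sub_zero, smul_eq_mul] at h₁ h₂
  have heq : f z - f 0 - z * deriv f 0 = dslope (dslope f 0) 0 z * z ^ 2 := by
    rw [← h₁, ← mul_sub, ← h₂]
    ring
  rw [heq, norm_mul, norm_pow]
  gcongr

/-- `n * (G z n⁻¹ - G z 0)` converges locally uniformly in `z` by the second-order Taylor bound. -/
theorem differentiable_deriv_zero_of_taylor {G : ℂ → ℂ → ℂ}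
    (hG : ∀ w, Differentiable ℂ fun z => G z w)
    (h : ∀ r : ℝ, ∃ C : ℝ, ∀ z w, ‖z‖ ≤ r → ‖w‖ ≤ 1 →
      ‖G z w - G z 0 - w * deriv (G z) 0‖ ≤ C * ‖w‖ ^ 2) :
    Differentiable ℂ fun z => deriv (G z) 0 := by
  intro z
  obtain ⟨C, hC⟩ := h (‖z‖ + 1)
  have hlim : TendstoUniformlyOn
      (fun (n : ℕ) z => ((n + 1 : ℕ) : ℂ) * (G z ((n + 1 : ℕ) : ℂ)⁻¹ - G z 0))
      (fun z => deriv (G z) 0) atTop (Metric.ball 0 (‖z‖ + 1)) := by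
    rw [Metric.tendstoUniformlyOn_iff]
    intro ε hε
    have h0 : Tendsto (fun n : ℕ => C * ((n + 1 : ℕ) : ℝ)⁻¹) atTop (𝓝 0) := by
      simpa using (tendsto_one_div_add_atTop_nhds_zero_nat (𝕜 := ℝ)).const_mul C
    filter_upwards [h0.eventually (gt_mem_nhds hε)] with n hn w hw
    have hne : ((n + 1 : ℕ) : ℂ) ≠ 0 := Nat.cast_ne_zero.2 n.succ_ne_zero
    have htaylor := hC w ((n + 1 : ℕ) : ℂ)⁻¹ (by simpa using (Metric.mem_ball.1 hw).le)
      (by rw [norm_inv, Complex.norm_natCast]; exact Nat.cast_inv_le_one _)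
    rw [dist_comm, dist_eq_norm]
    calc _ = ‖((n + 1 : ℕ) : ℂ) * (G w ((n + 1 : ℕ) : ℂ)⁻¹ - G w 0 -
            ((n + 1 : ℕ) : ℂ)⁻¹ * deriv (G w) 0)‖ := by
          rw [mul_sub _ _ (_ * deriv _ _), mul_inv_cancel_left₀ hne]
      _ ≤ ((n + 1 : ℕ) : ℝ) * (C * ‖((n + 1 : ℕ) : ℂ)⁻¹‖ ^ 2) := by
          rw [norm_mul, Complex.norm_natCast]
          gcongr
      _ = C * ((n + 1 : ℕ) : ℝ)⁻¹ := by rw [norm_inv, Complex.norm_natCast]; field_simp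
      _ < ε := hn
  have hdiff := hlim.tendstoLocallyUniformlyOn.differentiableOn
    (.of_forall fun n => (((hG _).sub (hG 0)).const_mul _).differentiableOn) Metric.isOpen_ball
  exact hdiff.differentiableAt (Metric.isOpen_ball.mem_nhds (by simp))

end SecondOrder

theorem prod_mul_pow_succ_le {v : ℕ → ℝ} (hv : ∀ k, 0 ≤ v k) {r : ℝ} (hr : 0 ≤ r) (hr1 : r ≤ 1)
    {S : Finset ℕ} (hS : S ∉ ({∅, {0}, {1}} : Finset (Finset ℕ))) :
    ∏ k ∈ S, v k * r ^ (k + 1) ≤ (∏ k ∈ S, v k) * r ^ 3 := by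
  rw [Finset.prod_mul_distrib, Finset.prod_pow_eq_pow_sum]
  refine mul_le_mul_of_nonneg_left (pow_le_pow_of_le_one hr hr1 ?_)
    (Finset.prod_nonneg fun k _ => hv k)
  by_contra! hlt
  have hlt2 : ∀ k ∈ S, k < 2 := fun k hk => by
    have hle := Finset.single_le_sum (f := fun k => k + 1) (fun _ _ => Nat.zero_le _) hk
    lia
  have hmem : S ∈ (Finset.range 2).powerset :=
    Finset.mem_powerset.2 fun k hk => Finset.mem_range.2 (hlt2 k hk)
  rw [show (Finset.range 2).powerset = {∅, {0}, {1}, {0, 1}} by decide] at hmem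
  simp only [Finset.mem_insert, Finset.mem_singleton, not_or] at hmem hS
  obtain rfl : S = {0, 1} := by tauto
  simp at hlt

variable {α β : ℝ}

theorem differentiable_infDet_right (hα : 0 ≤ α) (hβ : 0 ≤ β) (hαZ : ∀ k : ℤ, α ≠ k) (σ : ℂ) :
    Differentiable ℂ (infDet α β 0 σ) :=
  differentiable_infDet_comp hα hβ hαZ (Or.inl rfl) (differentiable_const σ) differentiable_id

theorem differentiable_infDet_left (hα : 0 ≤ α) (hβ : 0 ≤ β) (hαZ : ∀ k : ℤ, α ≠ k) (τ : ℂ) :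
    Differentiable ℂ fun σ => infDet α β 0 σ τ :=
  differentiable_infDet_comp hα hβ hαZ (Or.inl rfl) differentiable_id (differentiable_const τ)

theorem exists_norm_infDet_sub_le (hα : 0 ≤ α) (hβ : 0 ≤ β) (hαZ : ∀ k : ℤ, α ≠ k) (r : ℝ) :
    ∃ C : ℝ, ∀ σ τ : ℂ, ‖σ‖ ≤ r → ‖τ‖ ≤ 1 →
      ‖infDet α β 0 σ τ - infDet α β 0 σ 0 - τ * deriv (infDet α β 0 σ) 0‖ ≤ C * ‖τ‖ ^ 2 := by
  obtain ⟨C, hC⟩ := exists_norm_infDet_le hα hβ hαZ r 2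
  exact ⟨C, fun σ τ hσ hτ => norm_sub_taylor_le (differentiable_infDet_right hα hβ hαZ σ)
    (fun z hz => hC 0 (Or.inl rfl) σ z hσ hz) (hτ.trans one_le_two)⟩

theorem differentiable_deriv_infDet (hα : 0 ≤ α) (hβ : 0 ≤ β) (hαZ : ∀ k : ℤ, α ≠ k) :
    Differentiable ℂ fun σ => deriv (infDet α β 0 σ) 0 :=
  differentiable_deriv_zero_of_taylor (differentiable_infDet_left hα hβ hαZ)
    (exists_norm_infDet_sub_le hα hβ hαZ)

theorem singEntry_zero_zero_zero (α β : ℝ) :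
    singEntry α β 0 0 0 0 = (Real.Gamma (-α) / (α + 1) ^ 2 : ℝ) := by
  rw [singEntry, tsum_eq_single 0 fun m hm => by simp [hm]]
  simp [singCoeff, rowFactor, singFactor, sq, add_comm]

theorem infDet_zero_left (α β : ℝ) (τ : ℂ) :
    infDet α β 0 0 τ = 1 - τ * (Real.Gamma (-α) / (α + 1) ^ 2 : ℝ) := by
  have hreg (i k : ℕ) : regEntry α β 0 i k 0 = 0 := by simp [regEntry]
  have hsing (i k : ℕ) (hk : k ≠ 0) : singEntry α β 0 i k 0 = 0 := by simp [singEntry, hk]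
  rw [infDet, tsum_eq_sum (s := {∅, {0}})]
  · rw [Finset.sum_pair (Finset.singleton_ne_empty 0).symm, minor_empty, minor_singleton, entry,
      hreg, singEntry_zero_zero_zero]
    ring
  · intro S hS
    simp only [Finset.mem_insert, Finset.mem_singleton, not_or] at hS
    obtain ⟨k, hk, hk0⟩ : ∃ k ∈ S, k ≠ 0 := by
      by_contra! h
      exact (Finset.subset_singleton_iff.1 fun k hk => Finset.mem_singleton.2 (h k hk)).elim
        hS.1 hS.2
    exact minor_eq_zero_of_col hk fun i => by simp [entry, hreg, hsing i k hk0]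

theorem deriv_infDet_zero_zero (α β : ℝ) :
    deriv (infDet α β 0 0) 0 = -(Real.Gamma (-α) / (α + 1) ^ 2 : ℝ) := by
  rw [funext (infDet_zero_left α β), deriv_const_sub, deriv_mul_const differentiableAt_id]
  simp

theorem isBigO_regEntry_sub (hα : 0 ≤ α) (hβ : 0 ≤ β) (hαZ : ∀ k : ℤ, α ≠ k) (i k n : ℕ) :
    (fun σ => regEntry α β 0 i k σ -
      ∑ m ∈ Finset.range n, (regCoeff α β 0 i k m : ℂ) * σ ^ (k + 1 + m)) =O[𝓝 0]
      fun σ => σ ^ (k + 1 + n) := by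
  obtain ⟨c, C, K, -, -, -, h⟩ := exists_abs_coeff_le hα hβ hαZ
  exact isBigO_tsum_coeff_mul_pow_sub (fun m => (h 0 (Or.inl rfl) i k m).1) _ _

theorem exists_norm_entry_zero_right_le (hα : 0 ≤ α) (hβ : 0 ≤ β) (hαZ : ∀ k : ℤ, α ≠ k) :
    ∃ c B : ℝ, 0 < c ∧ 0 < B ∧ ∀ σ : ℂ, ‖σ‖ ≤ 1 → ∀ i k,
      ‖entry α β 0 σ 0 i k‖ ≤ B * (c ^ i / i !) * (1 / k ! * ‖σ‖ ^ (k + 1)) := by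
  obtain ⟨c, C, K, hc, hC, hK, h⟩ := exists_abs_coeff_le hα hβ hαZ
  refine ⟨c, C * Real.exp K, hc, by positivity, fun σ hσ i k => ?_⟩
  rw [entry, zero_mul, add_zero, norm_neg]
  calc ‖regEntry α β 0 i k σ‖
      ≤ C * (c ^ i / i !) * (1 / k !) * ‖σ‖ ^ (k + 1) * Real.exp (K * ‖σ‖) :=
        norm_tsum_coeff_mul_pow_le (fun m => (h 0 (Or.inl rfl) i k m).1) le_rfl (k + 1)
    _ ≤ C * (c ^ i / i !) * (1 / k !) * ‖σ‖ ^ (k + 1) * Real.exp (K * 1) := by gcongr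
    _ = _ := by rw [mul_one]; ring

theorem exists_norm_minor_entry_zero_right_le (hα : 0 ≤ α) (hβ : 0 ≤ β)
    (hαZ : ∀ k : ℤ, α ≠ k) :
    ∃ b : Finset ℕ → ℝ, Summable b ∧ ∀ σ : ℂ, ‖σ‖ ≤ 1 →
      ∀ S ∉ ({∅, {0}, {1}} : Finset (Finset ℕ)),
        ‖minor (entry α β 0 σ 0) S‖ ≤ b S * ‖σ‖ ^ 3 := by
  obtain ⟨c, B, hc, hB, h⟩ := exists_norm_entry_zero_right_le hα hβ hαZ
  have hu : Summable fun i : ℕ => B * (c ^ i / i !) :=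
    (Real.summable_pow_div_factorial c).mul_left B
  set U := ∑' i : ℕ, B * (c ^ i / i !)
  have hv0 (k : ℕ) : 0 ≤ U * (1 / (k ! : ℝ)) :=
    mul_nonneg (tsum_nonneg fun _ => by positivity) (by positivity)
  have hv : Summable fun k : ℕ => U * (1 / (k ! : ℝ)) := by
    simpa using (Real.summable_pow_div_factorial 1).mul_left U
  refine ⟨_, summable_finsetProd_of_summable_nonneg hv0 hv, fun σ hσ S hS => ?_⟩
  refine le_trans ?_ (prod_mul_pow_succ_le hv0 (norm_nonneg σ) hσ hS)
  simp only [mul_assoc U]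
  exact norm_minor_le (fun i => by positivity) (fun k => by positivity) hu (h σ hσ) S

theorem isBigO_infDet_zero_right_sub_minors (hα : 0 ≤ α) (hβ : 0 ≤ β) (hαZ : ∀ k : ℤ, α ≠ k) :
    (fun σ : ℂ => infDet α β 0 σ 0 - (1 - regEntry α β 0 0 0 σ - regEntry α β 0 1 1 σ)) =O[𝓝 0]
      fun σ => σ ^ 3 := by
  obtain ⟨b, hb, hbound⟩ := exists_norm_minor_entry_zero_right_le hα hβ hαZ
  obtain ⟨b', hb', hbound'⟩ := exists_summable_norm_minor_entry_le hα hβ hαZ 1 0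
  set T : Finset (Finset ℕ) := {∅, {0}, {1}}
  refine IsBigO.of_bound (∑' S : ↥((T : Set (Finset ℕ))ᶜ), b S) ?_
  filter_upwards [Metric.closedBall_mem_nhds (0 : ℂ) one_pos] with σ hσ
  rw [mem_closedBall_zero_iff] at hσ
  have hsum : Summable fun S => minor (entry α β 0 σ 0) S :=
    .of_norm_bounded hb' (hbound' 0 (Or.inl rfl) σ 0 hσ (by simp))
  have hT : ∑ S ∈ T, minor (entry α β 0 σ 0) S =
      1 - regEntry α β 0 0 0 σ - regEntry α β 0 1 1 σ := by
    rw [Finset.sum_insert (by decide), Finset.sum_pair (by decide), minor_empty,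
      minor_singleton, minor_singleton, entry, entry]
    ring
  rw [← hT, infDet, ← hsum.sum_add_tsum_compl (s := T), add_sub_cancel_left, norm_pow]
  exact tsum_of_norm_bounded ((hb.subtype _).hasSum.mul_right _)
    fun S => hbound σ hσ S S.2

theorem isBigO_infDet_zero_right (hα : 0 < α) (hβ : 0 ≤ β) (hαZ : ∀ k : ℤ, α ≠ k) :
    (fun σ : ℂ => infDet α β 0 σ 0 - (1 - σ / α + σ ^ 2 / (2 * ((α : ℂ) ^ 2 - 1)))) =O[𝓝 0]
      fun σ => σ ^ 3 := by
  have hα0 : (α : ℂ) ≠ 0 := by exact_mod_cast hα.ne'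
  have hα1 : (α : ℂ) - 1 ≠ 0 := sub_ne_zero.2 (by exact_mod_cast hαZ 1)
  have hα2 : (α : ℂ) + 1 ≠ 0 := by exact_mod_cast (by positivity : (α + 1 : ℝ) ≠ 0)
  have hα3 : (α : ℂ) ^ 2 - 1 ≠ 0 := by
    rw [show (α : ℂ) ^ 2 - 1 = (α - 1) * (α + 1) by ring]
    exact mul_ne_zero hα1 hα2
  refine (((isBigO_infDet_zero_right_sub_minors hα.le hβ hαZ).sub
    (isBigO_regEntry_sub hα.le hβ hαZ 0 0 2)).sub
    (isBigO_regEntry_sub hα.le hβ hαZ 1 1 1)).congr_left fun σ => ?_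
  simp only [Finset.sum_range_succ, Finset.sum_range_zero, regCoeff, rowFactor, regFactor,
    Finset.prod_range_succ, Finset.prod_range_zero, Nat.factorial]
  push_cast
  simp only [zero_add]
  field_simp
  ring

end Taylor

section ComplexAsymptotics

open MeasureTheory

theorem deriv_eq_integral_circleMap {f : ℂ → ℂ} (hf : Differentiable ℂ f) (z : ℂ) :
    deriv f z = (2 * Real.pi * Complex.I : ℂ)⁻¹ •
      ∫ θ in (0 : ℝ)..2 * Real.pi, (circleMap 0 1 θ * Complex.I * (circleMap 0 1 θ ^ 2)⁻¹) •
        f (circleMap z 1 θ) := by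
  rw [← Complex.two_pi_I_inv_smul_circleIntegral_sub_sq_inv_smul_of_differentiable
    isOpen_univ (Set.subset_univ _) hf.differentiableOn (Metric.mem_ball_self one_pos)]
  simp only [circleIntegral, deriv_circleMap, circleMap_sub_center, smul_smul]

theorem tendsto_deriv_of_tendsto_of_bounded {F : ℕ → ℂ → ℂ} {G : ℂ → ℂ} {z : ℂ} {C : ℝ}
    (hF : ∀ n, Differentiable ℂ (F n)) (hG : Differentiable ℂ G)
    (hbound : ∀ n, ∀ w ∈ Metric.sphere z 1, ‖F n w‖ ≤ C)
    (hlim : ∀ w, Tendsto (fun n => F n w) atTop (𝓝 (G w))) :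
    Tendsto (fun n => deriv (F n) z) atTop (𝓝 (deriv G z)) := by
  simp only [deriv_eq_integral_circleMap (hF _), deriv_eq_integral_circleMap hG]
  refine Tendsto.const_smul
    (intervalIntegral.tendsto_integral_filter_of_dominated_convergence (fun _ => C)
      (.of_forall fun n => Continuous.aestronglyMeasurable ?_)
      (.of_forall fun n => .of_forall fun θ _ => ?_)
      intervalIntegrable_const (.of_forall fun θ _ => (hlim _).const_smul _)) _
  · have hcont : Continuous fun θ => F n (circleMap z 1 θ) :=
      (hF n).continuous.comp (continuous_circleMap z 1)
    have hinv : Continuous fun θ => (circleMap 0 1 θ ^ 2)⁻¹ :=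
      ((continuous_circleMap 0 1).pow 2).inv₀ fun θ =>
        pow_ne_zero 2 (circleMap_ne_center one_ne_zero)
    exact (((continuous_circleMap 0 1).mul continuous_const).mul hinv).smul hcont
  · simpa [norm_smul, norm_circleMap_zero] using
      hbound n _ (circleMap_mem_sphere z zero_le_one θ)

theorem hasDerivAt_of_eq_comp_log {F : ℂ → ℂ} (hF : Differentiable ℂ F) {f : ℝ → ℝ}
    (h : ∀ u : ℝ, 0 < u → (f u : ℂ) = F (Real.log u)) {s : ℝ} (hs : 0 < s) :
    HasDerivAt f ((deriv F (Real.log s)).re / s) s ∧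
      ((deriv F (Real.log s)).re : ℂ) = deriv F (Real.log s) := by
  have hs' : (s : ℂ) ≠ 0 := by exact_mod_cast hs.ne'
  have hcomp : HasDerivAt (fun z => F (Complex.log z)) (deriv F (Real.log s) / s) (s : ℂ) := by
    rw [Complex.ofReal_log hs.le, div_eq_mul_inv]
    exact (hF (Complex.log s)).hasDerivAt.comp (s : ℂ)
      (Complex.hasDerivAt_log (Complex.ofReal_mem_slitPlane.2 hs))
  have hev : ∀ᶠ u : ℝ in 𝓝 s, (f u : ℂ) = F (Complex.log u) := by
    filter_upwards [lt_mem_nhds hs] with u hu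
    rw [h u hu, Complex.ofReal_log hu.le]
  have hf : HasDerivAt f ((deriv F (Real.log s)).re / s) s := by
    rw [← Complex.div_ofReal_re]
    exact hcomp.real_of_complex.congr_of_eventuallyEq
      (hev.mono fun u hu => by simp only [← hu, Complex.ofReal_re])
  refine ⟨hf, ?_⟩
  have huniq := hf.ofReal_comp.unique (hcomp.comp_ofReal.congr_of_eventuallyEq hev)
  rwa [Complex.ofReal_div, div_left_inj' hs'] at huniq

section PowerSeries

variable {f : ℂ → ℂ}

theorem isBigO_mul_deriv_of_isBigO_pow (hf : Differentiable ℂ f) {n : ℕ}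
    (h : f =O[𝓝 0] fun z => z ^ n) : (fun z => z * deriv f z) =O[𝓝 0] fun z => z ^ n := by
  obtain ⟨C, hC0, hC⟩ := h.exists_nonneg
  obtain ⟨ε, hε, hball⟩ := Metric.eventually_nhds_iff_ball.1 hC.bound
  refine IsBigO.of_bound (C * 2 ^ n) ?_
  filter_upwards [Metric.ball_mem_nhds (0 : ℂ) (half_pos hε)] with z hz
  rw [mem_ball_zero_iff] at hz
  rcases eq_or_ne z 0 with rfl | hz0
  · rw [zero_mul, norm_zero]
    positivity
  have hpos := norm_pos_iff.2 hz0
  have hcauchy : ‖deriv f z‖ ≤ C * (2 * ‖z‖) ^ n / ‖z‖ := by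
    refine Complex.norm_deriv_le_of_forall_mem_sphere_norm_le hpos hf.diffContOnCl fun w hw => ?_
    have hw2 : ‖w‖ ≤ 2 * ‖z‖ := by
      linarith [norm_le_norm_add_norm_sub' w z, mem_sphere_iff_norm.1 hw]
    refine (hball w (by rw [mem_ball_zero_iff]; linarith)).trans ?_
    rw [norm_pow]
    gcongr
  rw [le_div_iff₀ hpos] at hcauchy
  rwa [norm_mul, norm_pow, mul_comm, mul_assoc, ← mul_pow]

theorem isBigO_mul_logDeriv_sub (hf : Differentiable ℂ f) {a b : ℂ}
    (h : (fun z => f z - (1 - a * z + b * z ^ 2)) =O[𝓝 0] fun z => z ^ 3) (h0 : f 0 = 1) :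
    (fun z => z * logDeriv f z - (-(a * z) + (2 * b - a ^ 2) * z ^ 2)) =O[𝓝 0]
      fun z => z ^ 3 := by
  have hlim : Tendsto f (𝓝 0) (𝓝 1) := h0 ▸ hf.continuous.tendsto 0
  have hone {q : ℂ → ℂ} (hq : Continuous q) : q =O[𝓝 0] fun _ => (1 : ℂ) :=
    (hq.tendsto 0).isBigO_one ℂ
  have hderiv (z : ℂ) : deriv (fun z => f z - (1 - a * z + b * z ^ 2)) z =
      deriv f z - (-a + 2 * b * z) := by
    have hquad : HasDerivAt (fun z : ℂ => 1 - a * z + b * z ^ 2) (-a + 2 * b * z) z :=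
      ((((hasDerivAt_id z).const_mul a).const_sub 1).add
        ((hasDerivAt_pow 2 z).const_mul b)).congr_deriv (by simp; ring)
    exact ((hf z).hasDerivAt.sub hquad).deriv
  have hnum := ((isBigO_mul_deriv_of_isBigO_pow (by fun_prop) h).sub
    (((hone (q := fun z => -(a * z) + (2 * b - a ^ 2) * z ^ 2) (by fun_prop)).mul h).trans
      (by simp [isBigO_refl]))).add
    (((hone (q := fun z => a * b + a * (2 * b - a ^ 2) - b * (2 * b - a ^ 2) * z)
      (by fun_prop)).mul (isBigO_refl (fun z : ℂ => z ^ 3) (𝓝 0))).trans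
        (by simp [isBigO_refl]))
  have hquot := ((hlim.inv₀ one_ne_zero).isBigO_one ℂ).mul hnum
  simp only [one_mul] at hquot
  refine hquot.congr' ?_ .rfl
  filter_upwards [hlim.eventually_ne one_ne_zero] with z hz
  rw [hderiv, logDeriv_apply]
  field_simp
  ring

end PowerSeries

theorem isBigO_deriv_of_isBigO_exp {f : ℂ → ℂ} (hf : Differentiable ℂ f) {b : ℝ} (hb : 0 ≤ b)
    (h : f =O[comap Complex.re atBot] fun ζ => Real.exp (b * ζ.re)) :
    deriv f =O[comap Complex.re atBot] fun ζ => Real.exp (b * ζ.re) := by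
  obtain ⟨C, hC0, hC⟩ := h.exists_nonneg
  obtain ⟨M, -, hM⟩ := (atBot_basis.comap Complex.re).eventually_iff.1 hC.bound
  refine IsBigO.of_bound (C * Real.exp b)
    ((atBot_basis.comap Complex.re).eventually_iff.2 ⟨M - 1, trivial, fun ζ hζ => ?_⟩)
  have hcauchy : ‖deriv f ζ‖ ≤ C * Real.exp b * Real.exp (b * ζ.re) / 1 := by
    refine Complex.norm_deriv_le_of_forall_mem_sphere_norm_le one_pos hf.diffContOnCl
      fun w hw => ?_
    have hre : w.re - ζ.re ≤ 1 := by
      rw [← Complex.sub_re]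
      exact (Complex.re_le_norm _).trans (mem_sphere_iff_norm.1 hw).le
    have hwM : w.re ≤ M := by linarith [show ζ.re ≤ M - 1 from hζ]
    refine (hM hwM).trans ?_
    rw [Real.norm_eq_abs, Real.abs_exp, mul_assoc, ← Real.exp_add]
    gcongr
    nlinarith
  rwa [div_one, ← Real.abs_exp (b * ζ.re), ← Real.norm_eq_abs] at hcauchy

/-- Multiplying by `f * p ^ 2` turns the difference into
`p ^ 2 * r' - p * p' * r - n * q * t ^ 2 - n * t * r` with `r = f - p - t * q`,
`r' = f' - p' - t * q'` and `n = q' * p - p' * q`. -/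
theorem isBigO_div_sub_of_isBigO_sub {ι : Type*} {l : Filter ι} {f f' p p' q q' t : ι → ℂ}
    {e : ι → ℝ} (hf : Tendsto f l (𝓝 1)) (hp : Tendsto p l (𝓝 1))
    (hp' : p' =O[l] fun _ => (1 : ℝ)) (hq : q =O[l] fun _ => (1 : ℝ))
    (hq' : q' =O[l] fun _ => (1 : ℝ)) (ht : t =O[l] fun _ => (1 : ℝ))
    (ht2 : (fun x => t x * t x) =O[l] e)
    (hr : (fun x => f x - p x - t x * q x) =O[l] e)
    (hr' : (fun x => f' x - p' x - t x * q' x) =O[l] e) :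
    (fun x => f' x / f x - p' x / p x - t x * ((q' x * p x - p' x * q x) / p x ^ 2)) =O[l] e := by
  have hone {u v : ι → ℂ} (hu : u =O[l] fun _ => (1 : ℝ)) (hv : v =O[l] fun _ => (1 : ℝ)) :
      (fun x => u x * v x) =O[l] fun _ => (1 : ℝ) := by simpa using hu.mul hv
  have hmul {u v : ι → ℂ} (hu : u =O[l] fun _ => (1 : ℝ)) (hv : v =O[l] e) :
      (fun x => u x * v x) =O[l] e := by simpa using hu.mul hv
  have hp1 := hp.isBigO_one ℝ
  have hn := (hone hq' hp1).sub (hone hp' hq)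
  have hinv : (fun x => (f x * p x ^ 2)⁻¹) =O[l] fun _ => (1 : ℝ) :=
    ((hf.mul (hp.pow 2)).inv₀ (by simp)).isBigO_one ℝ
  refine (hmul hinv ((((hmul (hone hp1 hp1) hr').sub (hmul (hone hp' hp1) hr)).sub
    (hmul (hone hn hq) ht2)).sub (hmul (hone hn ht) hr))).congr' ?_ .rfl
  filter_upwards [hf.eventually_ne one_ne_zero, hp.eventually_ne one_ne_zero] with x hfx hpx
  field_simp
  ring

section ExpExpansion

variable {F P Q : ℂ → ℂ} {c : ℂ} {a : ℝ}

theorem tendsto_exp_comap_re_atBot : Tendsto Complex.exp (comap Complex.re atBot) (𝓝 0) := by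
  rw [← Complex.comap_exp_nhds_zero]
  exact tendsto_comap

theorem tendsto_exp_mul_re_comap_atBot (ha : 0 < a) :
    Tendsto (fun ζ : ℂ => Real.exp (a * ζ.re)) (comap Complex.re atBot) (𝓝 0) :=
  Real.tendsto_exp_atBot.comp (tendsto_comap.const_mul_atBot ha)

theorem isBigO_const_mul_cexp (c : ℂ) (a : ℝ) (l : Filter ℂ) :
    (fun ζ => c * Complex.exp (a * ζ)) =O[l] fun ζ => Real.exp (a * ζ.re) :=
  IsBigO.of_bound ‖c‖ (.of_forall fun ζ => by
    rw [norm_mul, Complex.norm_exp, Real.norm_eq_abs, Real.abs_exp, Complex.re_ofReal_mul])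

theorem isBigO_one_comp_exp {f : ℂ → ℂ} (hf : Continuous f) :
    (fun ζ => f (Complex.exp ζ)) =O[comap Complex.re atBot] fun _ => (1 : ℝ) :=
  ((hf.tendsto 0).comp tendsto_exp_comap_re_atBot).isBigO_one ℝ

theorem tendsto_one_of_isBigO_exp_sub (ha : 0 < a) (hP : Continuous P) (hQ : Continuous Q)
    (hP0 : P 0 = 1)
    (hR : (fun ζ => F ζ - P (Complex.exp ζ) - c * Complex.exp (a * ζ) * Q (Complex.exp ζ))
      =O[comap Complex.re atBot] fun ζ => Real.exp (2 * a * ζ.re)) :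
    Tendsto F (comap Complex.re atBot) (𝓝 1) := by
  have hPlim := (hP.tendsto 0).comp tendsto_exp_comap_re_atBot
  have hQlim := (hQ.tendsto 0).comp tendsto_exp_comap_re_atBot
  have ht := (isBigO_const_mul_cexp c a _).trans_tendsto (tendsto_exp_mul_re_comap_atBot ha)
  have hRlim := hR.trans_tendsto (tendsto_exp_mul_re_comap_atBot (by positivity))
  have hsum := (hRlim.add hPlim).add (ht.mul hQlim)
  rw [hP0, zero_add, zero_mul, add_zero] at hsum
  exact hsum.congr fun ζ => by simp only [Function.comp_apply]; ring

theorem deriv_sub_exp_expansion (hF : Differentiable ℂ F) (hP : Differentiable ℂ P)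
    (hQ : Differentiable ℂ Q) (ζ : ℂ) :
    deriv (fun ζ => F ζ - P (Complex.exp ζ) - c * Complex.exp (a * ζ) * Q (Complex.exp ζ)) ζ =
      deriv F ζ - Complex.exp ζ * deriv P (Complex.exp ζ) - c * Complex.exp (a * ζ) *
        (a * Q (Complex.exp ζ) + Complex.exp ζ * deriv Q (Complex.exp ζ)) := by
  have hPexp := (hP (Complex.exp ζ)).hasDerivAt.comp ζ (Complex.hasDerivAt_exp ζ)
  have hQexp := (hQ (Complex.exp ζ)).hasDerivAt.comp ζ (Complex.hasDerivAt_exp ζ)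
  have hpow : HasDerivAt (fun ζ : ℂ => c * Complex.exp (a * ζ)) (c * (Complex.exp (a * ζ) * a)) ζ :=
    ((((hasDerivAt_id ζ).const_mul (a : ℂ)).cexp).const_mul c).congr_deriv (by simp)
  refine ((((hF ζ).hasDerivAt.sub hPexp).sub (hpow.mul hQexp)).congr_deriv ?_).deriv
  simp only [Function.comp_apply]
  ring

theorem isBigO_logDeriv_sub (ha : 0 < a) (hF : Differentiable ℂ F) (hP : Differentiable ℂ P)
    (hQ : Differentiable ℂ Q) (hP0 : P 0 = 1)
    (hR : (fun ζ => F ζ - P (Complex.exp ζ) - c * Complex.exp (a * ζ) * Q (Complex.exp ζ))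
      =O[comap Complex.re atBot] fun ζ => Real.exp (2 * a * ζ.re)) :
    (fun ζ => logDeriv F ζ - Complex.exp ζ * deriv P (Complex.exp ζ) / P (Complex.exp ζ) -
      c * Complex.exp (a * ζ) *
        (((a * Q (Complex.exp ζ) + Complex.exp ζ * deriv Q (Complex.exp ζ)) * P (Complex.exp ζ) -
          Complex.exp ζ * deriv P (Complex.exp ζ) * Q (Complex.exp ζ)) / P (Complex.exp ζ) ^ 2))
      =O[comap Complex.re atBot] fun ζ => Real.exp (2 * a * ζ.re) := by
  have hRdiff : Differentiable ℂ fun ζ =>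
      F ζ - P (Complex.exp ζ) - c * Complex.exp (a * ζ) * Q (Complex.exp ζ) :=
    (hF.sub (hP.comp Complex.differentiable_exp)).sub
      (Differentiable.mul (by fun_prop) (hQ.comp Complex.differentiable_exp))
  have ht := isBigO_const_mul_cexp c a (comap Complex.re atBot)
  have ht2 : (fun ζ : ℂ => c * Complex.exp (a * ζ) * (c * Complex.exp (a * ζ)))
      =O[comap Complex.re atBot] fun ζ => Real.exp (2 * a * ζ.re) := by
    simpa only [← Real.exp_add, ← two_mul, ← mul_assoc] using ht.mul ht
  have hPd := hP.deriv.continuous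
  have hQd := hQ.deriv.continuous
  exact isBigO_div_sub_of_isBigO_sub
    (tendsto_one_of_isBigO_exp_sub ha hP.continuous hQ.continuous hP0 hR)
    (hP0 ▸ (hP.continuous.tendsto 0).comp tendsto_exp_comap_re_atBot)
    (isBigO_one_comp_exp (continuous_id.mul hPd)) (isBigO_one_comp_exp hQ.continuous)
    (isBigO_one_comp_exp ((continuous_const.mul hQ.continuous).add (continuous_id.mul hQd)))
    ((ht.trans_tendsto (tendsto_exp_mul_re_comap_atBot ha)).isBigO_one ℝ) ht2 hR
    ((isBigO_deriv_of_isBigO_exp hRdiff (by positivity) hR).congr_left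
      (deriv_sub_exp_expansion hF hP hQ))

end ExpExpansion

end ComplexAsymptotics

section LogVariable

variable {α β : ℝ}

/-- The determinant `infDet` at `σ = s / 2`, `τ = g * s ^ (α + 1)` as a function of `ζ = log s`,
in which it is entire. -/
noncomputable def logDet (α β x g : ℝ) (ζ : ℂ) : ℂ :=
  infDet α β x (Complex.exp ζ / 2) (g * Complex.exp ((α + 1) * ζ))

/-- The coefficient `g` of `logDet` in the limit `n → ∞`. -/
noncomputable def limitScale (α : ℝ) : ℝ :=
  1 / Real.Gamma (α + 1) ^ 2 / 2 ^ (α + 1)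

/-- The limit of `D_n(s / (2 n ^ 2)) / D_n(0)` as a function of `ζ = log s`. -/
noncomputable def limitLogDet (α β : ℝ) : ℂ → ℂ :=
  logDet α β 0 (limitScale α)

/-- The limit `Δ(s)` of `D_n(s / (2 n ^ 2)) / D_n(0)` for `s > 0`. -/
noncomputable def limitRatio (α β s : ℝ) : ℝ :=
  (limitLogDet α β (Real.log s)).re

/-- The limit `s * d/ds log Δ(s)` of the logarithmic derivatives. -/
noncomputable def limitLogDeriv (α β s : ℝ) : ℝ :=
  s * deriv (fun u : ℝ => Real.log (limitRatio α β u)) s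

theorem differentiable_logDet (hα : 0 ≤ α) (hβ : 0 ≤ β) (hαZ : ∀ k : ℤ, α ≠ k) {x : ℝ}
    (hx : IsScale x) (g : ℝ) : Differentiable ℂ (logDet α β x g) :=
  differentiable_infDet_comp hα hβ hαZ hx (by fun_prop) (by fun_prop)

theorem differentiable_limitLogDet (hα : 0 ≤ α) (hβ : 0 ≤ β) (hαZ : ∀ k : ℤ, α ≠ k) :
    Differentiable ℂ (limitLogDet α β) :=
  differentiable_logDet hα hβ hαZ (Or.inl rfl) _

theorem scaledRatio_eq_logDet (hα : 0 < α) (hβ : 0 < β) (hαZ : ∀ k : ℤ, α ≠ k) (N : ℕ) {s : ℝ}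
    (hs : 0 < s) :
    (scaledRatio α β (N + 1) s : ℂ) =
      logDet α β ((N : ℝ) + 1)⁻¹ (scaleConst α β N / 2 ^ (α + 1)) (Real.log s) := by
  have hσ : (Complex.exp (Real.log s) / 2 : ℂ) = (s / 2 : ℝ) := by
    rw [← Complex.ofReal_exp, Real.exp_log hs, Complex.ofReal_div, Complex.ofReal_ofNat]
  have hτ : ((scaleConst α β N / 2 ^ (α + 1) : ℝ) : ℂ) *
      Complex.exp ((α + 1) * (Real.log s : ℂ)) = (scaleConst α β N * (s / 2) ^ (α + 1) : ℝ) := by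
    rw [Real.div_rpow hs.le zero_le_two, Real.rpow_def_of_pos hs, mul_comm (Real.log s)]
    push_cast
    ring
  rw [logDet, hσ, hτ, ← hankelDet_div_hankelDet_eq_infDet hα hβ hαZ (half_pos hs), scaledRatio,
    div_div, Nat.cast_add_one]

theorem tendsto_logDet (hα : 0 ≤ α) (hβ : 0 ≤ β) (hαZ : ∀ k : ℤ, α ≠ k) {g : ℕ → ℝ} {g₀ : ℝ}
    (hg : Tendsto g atTop (𝓝 g₀)) (ζ : ℂ) :
    Tendsto (fun N : ℕ => logDet α β ((N : ℝ) + 1)⁻¹ (g N) ζ) atTop (𝓝 (logDet α β 0 g₀ ζ)) :=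
  tendsto_infDet hα hβ hαZ _ (((Complex.continuous_ofReal.tendsto _).comp hg).mul_const _)

theorem tendsto_deriv_logDet (hα : 0 ≤ α) (hβ : 0 ≤ β) (hαZ : ∀ k : ℤ, α ≠ k) {g : ℕ → ℝ}
    {g₀ : ℝ} (hg : Tendsto g atTop (𝓝 g₀)) (ζ : ℂ) :
    Tendsto (fun N : ℕ => deriv (logDet α β ((N : ℝ) + 1)⁻¹ (g N)) ζ) atTop
      (𝓝 (deriv (logDet α β 0 g₀) ζ)) := by
  have hx (N : ℕ) : IsScale ((N : ℝ) + 1)⁻¹ := Or.inr ⟨N, rfl⟩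
  obtain ⟨G, hG⟩ := hg.norm.bddAbove_range
  obtain ⟨r, hr⟩ := (isCompact_sphere ζ 1).exists_bound_of_continuousOn
    (f := fun w => Complex.exp w / 2) (by fun_prop)
  obtain ⟨T, hT⟩ := (isCompact_sphere ζ 1).exists_bound_of_continuousOn
    (f := fun w => Complex.exp ((α + 1) * w)) (by fun_prop)
  obtain ⟨C, hC⟩ := exists_norm_infDet_le hα hβ hαZ r (G * T)
  refine tendsto_deriv_of_tendsto_of_bounded (C := C)
    (fun N => differentiable_logDet hα hβ hαZ (hx N) _)
    (differentiable_logDet hα hβ hαZ (Or.inl rfl) _) (fun N w hw => ?_)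
    (fun w => tendsto_logDet hα hβ hαZ hg w)
  have hgN : ‖g N‖ ≤ G := hG ⟨N, rfl⟩
  refine hC _ (hx N) _ _ (hr w hw) ?_
  rw [norm_mul, Complex.norm_real]
  exact mul_le_mul hgN (hT w hw) (norm_nonneg _) ((norm_nonneg _).trans hgN)

theorem tendsto_scaleConst_div (hα : 0 ≤ α) (hβ : 0 < β) :
    Tendsto (fun N => scaleConst α β N / 2 ^ (α + 1)) atTop (𝓝 (limitScale α)) :=
  (tendsto_scaleConst hα hβ).div_const _

theorem tendsto_ofReal_scaledRatio (hα : 0 < α) (hβ : 0 < β) (hαZ : ∀ k : ℤ, α ≠ k) {s : ℝ}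
    (hs : 0 < s) :
    Tendsto (fun N : ℕ => (scaledRatio α β (N + 1) s : ℂ)) atTop
      (𝓝 (limitLogDet α β (Real.log s))) := by
  simp only [scaledRatio_eq_logDet hα hβ hαZ _ hs]
  exact tendsto_logDet hα.le hβ.le hαZ (tendsto_scaleConst_div hα.le hβ) _

theorem tendsto_scaledRatio (hα : 0 < α) (hβ : 0 < β) (hαZ : ∀ k : ℤ, α ≠ k) {s : ℝ}
    (hs : 0 < s) : Tendsto (fun n => scaledRatio α β n s) atTop (𝓝 (limitRatio α β s)) :=
  (tendsto_add_atTop_iff_nat 1).1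
    ((Complex.continuous_re.tendsto _).comp (tendsto_ofReal_scaledRatio hα hβ hαZ hs))

theorem ofReal_limitRatio (hα : 0 < α) (hβ : 0 < β) (hαZ : ∀ k : ℤ, α ≠ k) {s : ℝ}
    (hs : 0 < s) : (limitRatio α β s : ℂ) = limitLogDet α β (Real.log s) :=
  tendsto_nhds_unique ((Complex.continuous_ofReal.tendsto _).comp
    ((tendsto_scaledRatio hα hβ hαZ hs).comp (tendsto_add_atTop_nat 1)))
    (tendsto_ofReal_scaledRatio hα hβ hαZ hs)

end LogVariable

section Positivity

variable {α β s : ℝ}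

theorem scaledRatio_pos (hα : 0 ≤ α) (hβ : 0 ≤ β) (n : ℕ) (hs : 0 ≤ s) :
    0 < scaledRatio α β n s :=
  div_pos (hankelDet_pos (by positivity) hα hβ n) (hankelDet_pos le_rfl hα hβ n)

theorem scaledRatio_sq_le (hα : 0 ≤ α) (hβ : 0 ≤ β) (n : ℕ) (hs : 0 ≤ s) :
    scaledRatio α β n s ^ 2 ≤ scaledRatio α β n (2 * s) := by
  have h0 := hankelDet_pos le_rfl hα hβ n
  have hconvex := hankelDet_sq_le (t := 2 * s / (2 * (n : ℝ) ^ 2)) le_rfl (by positivity) hα hβ n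
  rw [zero_add, mul_div_assoc, mul_div_cancel_left₀ _ two_ne_zero] at hconvex
  rw [scaledRatio, scaledRatio, div_pow, div_le_div_iff₀ (by positivity) h0, mul_div_assoc]
  nlinarith

theorem pos_of_sq_le_of_tendsto {f : ℝ → ℝ} (hsq : ∀ s : ℝ, 0 < s → f s ^ 2 ≤ f (2 * s))
    (h0 : Tendsto f (𝓝[>] 0) (𝓝 1)) (hs : 0 < s) : 0 < f s := by
  have hhalf : Tendsto (fun k : ℕ => s / 2 ^ k) atTop (𝓝[>] 0) := by
    refine tendsto_nhdsWithin_iff.2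
      ⟨?_, .of_forall fun k => div_pos hs (pow_pos two_pos k)⟩
    simpa [div_eq_mul_inv] using
      (tendsto_pow_atTop_nhds_zero_of_lt_one (r := (2⁻¹ : ℝ)) (by norm_num)
        (by norm_num)).const_mul s
  have hdouble (k : ℕ) (hk : 0 < f (s / 2 ^ k)) : 0 < f s := by
    induction k with
    | zero => simpa using hk
    | succ k ih =>
      have h := hsq (s / 2 ^ (k + 1)) (by positivity)
      rw [pow_succ (2 : ℝ), ← div_div] at h hk
      rw [mul_div_cancel₀ _ two_ne_zero] at h
      exact ih ((pow_pos hk 2).trans_le h)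
  obtain ⟨k, hk⟩ := ((h0.comp hhalf).eventually (lt_mem_nhds one_pos)).exists
  exact hdouble k hk

theorem limitRatio_sq_le (hα : 0 < α) (hβ : 0 < β) (hαZ : ∀ k : ℤ, α ≠ k) (hs : 0 < s) :
    limitRatio α β s ^ 2 ≤ limitRatio α β (2 * s) :=
  le_of_tendsto_of_tendsto' ((tendsto_scaledRatio hα hβ hαZ hs).pow 2)
    (tendsto_scaledRatio hα hβ hαZ (by positivity))
    fun n => scaledRatio_sq_le hα.le hβ.le n hs.le

end Positivity

section Expansion

variable {α β : ℝ}

/-- The part of the limit determinant that is a power series in `s`. -/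
noncomputable def regDet (α β : ℝ) (s : ℂ) : ℂ :=
  infDet α β 0 (s / 2) 0

/-- The coefficient of `g * s ^ (α + 1)` in the limit determinant, a power series in `s`. -/
noncomputable def singDet (α β : ℝ) (s : ℂ) : ℂ :=
  deriv (infDet α β 0 (s / 2)) 0

theorem differentiable_regDet (hα : 0 ≤ α) (hβ : 0 ≤ β) (hαZ : ∀ k : ℤ, α ≠ k) :
    Differentiable ℂ (regDet α β) :=
  (differentiable_infDet_left hα hβ hαZ 0).comp (differentiable_id.div_const 2)

theorem differentiable_singDet (hα : 0 ≤ α) (hβ : 0 ≤ β) (hαZ : ∀ k : ℤ, α ≠ k) :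
    Differentiable ℂ (singDet α β) :=
  (differentiable_deriv_infDet hα hβ hαZ).comp (differentiable_id.div_const 2)

theorem regDet_zero (α β : ℝ) : regDet α β 0 = 1 := by
  rw [regDet, zero_div, infDet_zero_left, zero_mul, sub_zero]

theorem singDet_zero (α β : ℝ) : singDet α β 0 = -(Real.Gamma (-α) / (α + 1) ^ 2 : ℝ) := by
  rw [singDet, zero_div, deriv_infDet_zero_zero]

theorem isBigO_limitLogDet_sub (hα : 0 ≤ α) (hβ : 0 ≤ β) (hαZ : ∀ k : ℤ, α ≠ k) :
    (fun ζ => limitLogDet α β ζ - regDet α β (Complex.exp ζ) -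
      limitScale α * Complex.exp ((α + 1 : ℝ) * ζ) * singDet α β (Complex.exp ζ))
      =O[comap Complex.re atBot] fun ζ => Real.exp (2 * (α + 1) * ζ.re) := by
  obtain ⟨C, hC⟩ := exists_norm_infDet_sub_le hα hβ hαZ 1
  have hg := isBigO_const_mul_cexp (limitScale α) (α + 1) (comap Complex.re atBot)
  have hτ := hg.trans_tendsto (tendsto_exp_mul_re_comap_atBot (by positivity))
  have hbound : (fun ζ => limitLogDet α β ζ - regDet α β (Complex.exp ζ) -
      limitScale α * Complex.exp ((α + 1 : ℝ) * ζ) * singDet α β (Complex.exp ζ))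
      =O[comap Complex.re atBot]
        fun ζ => ((limitScale α : ℂ) * Complex.exp ((α + 1 : ℝ) * ζ)) ^ 2 := by
    refine IsBigO.of_bound C ?_
    filter_upwards [tendsto_exp_comap_re_atBot.eventually (Metric.closedBall_mem_nhds 0 two_pos),
      hτ.eventually (Metric.closedBall_mem_nhds 0 one_pos)] with ζ hexp hone
    rw [dist_zero_right] at hexp hone
    have hhalf : ‖Complex.exp ζ / 2‖ ≤ 1 := by
      rw [norm_div, Complex.norm_ofNat]
      linarith
    simpa only [limitLogDet, logDet, regDet, singDet, norm_pow, Complex.ofReal_add,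
      Complex.ofReal_one] using hC _ _ hhalf hone
  refine (hbound.trans (hg.pow 2)).congr_right fun ζ => ?_
  rw [← Real.exp_nat_mul, Nat.cast_ofNat, mul_assoc]

theorem tendsto_limitLogDet (hα : 0 ≤ α) (hβ : 0 ≤ β) (hαZ : ∀ k : ℤ, α ≠ k) :
    Tendsto (limitLogDet α β) (comap Complex.re atBot) (𝓝 1) :=
  tendsto_one_of_isBigO_exp_sub (by positivity) (differentiable_regDet hα hβ hαZ).continuous
    (differentiable_singDet hα hβ hαZ).continuous (regDet_zero α β)
    (isBigO_limitLogDet_sub hα hβ hαZ)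

theorem tendsto_ofReal_log :
    Tendsto (fun s : ℝ => (Real.log s : ℂ)) (𝓝[>] 0) (comap Complex.re atBot) :=
  tendsto_comap_iff.2 Real.tendsto_log_nhdsGT_zero

theorem limitRatio_pos (hα : 0 < α) (hβ : 0 < β) (hαZ : ∀ k : ℤ, α ≠ k) {s : ℝ} (hs : 0 < s) :
    0 < limitRatio α β s :=
  pos_of_sq_le_of_tendsto (fun _ => limitRatio_sq_le hα hβ hαZ)
    ((Complex.continuous_re.tendsto 1).comp
      ((tendsto_limitLogDet hα.le hβ.le hαZ).comp tendsto_ofReal_log)) hs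

end Expansion

section LogDerivative

variable {α β s : ℝ}

theorem ofReal_mul_deriv_log_of_eq_comp_log {F : ℂ → ℂ} (hF : Differentiable ℂ F) {f : ℝ → ℝ}
    (h : ∀ u : ℝ, 0 < u → (f u : ℂ) = F (Real.log u)) (hs : 0 < s) (hfs : f s ≠ 0) :
    ((s * deriv (fun u => Real.log (f u)) s : ℝ) : ℂ) = logDeriv F (Real.log s) := by
  obtain ⟨hf, hre⟩ := hasDerivAt_of_eq_comp_log hF h hs
  rw [(hf.log hfs).deriv, div_right_comm, mul_div_cancel₀ _ hs.ne', Complex.ofReal_div, hre,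
    h s hs, logDeriv_apply]

theorem differentiableAt_scaledRatio (hα : 0 < α) (hβ : 0 < β) (hαZ : ∀ k : ℤ, α ≠ k) (n : ℕ)
    (hs : 0 < s) : DifferentiableAt ℝ (scaledRatio α β n) s := by
  rcases n with _ | N
  · have hone : scaledRatio α β 0 = fun _ => 1 := by
      ext u
      simp [scaledRatio, hankelDet]
    simp [hone]
  · exact (hasDerivAt_of_eq_comp_log (differentiable_logDet hα.le hβ.le hαZ (Or.inr ⟨N, rfl⟩) _)
      (fun u hu => scaledRatio_eq_logDet hα hβ hαZ N hu) hs).1.differentiableAt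

theorem differentiableAt_limitRatio (hα : 0 < α) (hβ : 0 < β) (hαZ : ∀ k : ℤ, α ≠ k)
    (hs : 0 < s) : DifferentiableAt ℝ (limitRatio α β) s :=
  (hasDerivAt_of_eq_comp_log (differentiable_limitLogDet hα.le hβ.le hαZ)
    (fun _ hu => ofReal_limitRatio hα hβ hαZ hu) hs).1.differentiableAt

theorem ofReal_limitLogDeriv (hα : 0 < α) (hβ : 0 < β) (hαZ : ∀ k : ℤ, α ≠ k) (hs : 0 < s) :
    (limitLogDeriv α β s : ℂ) = logDeriv (limitLogDet α β) (Real.log s) :=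
  ofReal_mul_deriv_log_of_eq_comp_log (differentiable_limitLogDet hα.le hβ.le hαZ)
    (fun _ hu => ofReal_limitRatio hα hβ hαZ hu) hs (limitRatio_pos hα hβ hαZ hs).ne'

theorem ofReal_scaledLogDeriv (hα : 0 < α) (hβ : 0 < β) (hαZ : ∀ k : ℤ, α ≠ k) (N : ℕ)
    (hs : 0 < s) :
    (scaledLogDeriv α β (N + 1) s : ℂ) =
      logDeriv (logDet α β ((N : ℝ) + 1)⁻¹ (scaleConst α β N / 2 ^ (α + 1))) (Real.log s) :=
  ofReal_mul_deriv_log_of_eq_comp_log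
    (differentiable_logDet hα.le hβ.le hαZ (Or.inr ⟨N, rfl⟩) _)
    (fun _ hu => scaledRatio_eq_logDet hα hβ hαZ N hu) hs
    (scaledRatio_pos hα.le hβ.le _ hs.le).ne'

theorem tendsto_scaledLogDeriv (hα : 0 < α) (hβ : 0 < β) (hαZ : ∀ k : ℤ, α ≠ k) (hs : 0 < s) :
    Tendsto (fun n => scaledLogDeriv α β n s) atTop (𝓝 (limitLogDeriv α β s)) := by
  have hne : limitLogDet α β (Real.log s) ≠ 0 := by
    rw [← ofReal_limitRatio hα hβ hαZ hs]
    exact_mod_cast (limitRatio_pos hα hβ hαZ hs).ne'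
  have hg := tendsto_scaleConst_div hα.le hβ
  have hlim := (tendsto_deriv_logDet hα.le hβ.le hαZ hg (Real.log s)).div
    (tendsto_logDet hα.le hβ.le hαZ hg (Real.log s)) hne
  have hcast : Tendsto (fun N : ℕ => (scaledLogDeriv α β (N + 1) s : ℂ)) atTop
      (𝓝 (limitLogDeriv α β s : ℂ)) := by
    simp only [ofReal_scaledLogDeriv hα hβ hαZ _ hs, ofReal_limitLogDeriv hα hβ hαZ hs]
    exact hlim
  exact (tendsto_add_atTop_iff_nat 1).1 ((Complex.continuous_re.tendsto _).comp hcast)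

end LogDerivative

section Asymptotics

variable {α β : ℝ}

/-- The analytic factor that multiplies `g * s ^ (α + 1)` in the logarithmic derivative of the
limit determinant. -/
noncomputable def singLogDerivCoeff (α β : ℝ) (s : ℂ) : ℂ :=
  (((α + 1 : ℝ) * singDet α β s + s * deriv (singDet α β) s) * regDet α β s -
    s * deriv (regDet α β) s * singDet α β s) / regDet α β s ^ 2

theorem specialCoeff_eq (hα : 0 < α + 1) :
    specialCoeff α = limitScale α * ((α + 1) * -(Real.Gamma (-α) / (α + 1) ^ 2)) := by
  have hG : Real.Gamma (α + 1) ≠ 0 := (Real.Gamma_pos_of_pos hα).ne'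
  have hreflection : Real.Gamma (-α) = Real.pi / -Real.sin (α * Real.pi) / Real.Gamma (α + 1) := by
    rw [eq_div_iff hG, ← Real.sin_neg, ← neg_mul, mul_comm (-α),
      ← Real.Gamma_mul_Gamma_one_sub (-α), sub_neg_eq_add, add_comm]
  rw [hreflection, specialCoeff, limitScale, div_neg]
  rcases eq_or_ne (Real.sin (α * Real.pi)) 0 with hsin | _
  · simp [hsin]
  · field_simp

theorem specialCoeff_ne_zero (hα : 0 < α + 1) (hαZ : ∀ k : ℤ, α ≠ k) : specialCoeff α ≠ 0 := by
  have hsin : Real.sin (α * Real.pi) ≠ 0 := fun h => by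
    obtain ⟨k, hk⟩ := Real.sin_eq_zero_iff.1 h
    exact hαZ k (mul_right_cancel₀ Real.pi_ne_zero hk).symm
  unfold specialCoeff
  positivity

theorem limitScale_mul_singLogDerivCoeff_zero (hα : 0 < α + 1) :
    (limitScale α : ℂ) * singLogDerivCoeff α β 0 = specialCoeff α := by
  rw [specialCoeff_eq hα, singLogDerivCoeff, regDet_zero, singDet_zero]
  push_cast
  ring

theorem singLogDerivCoeff_zero_ne_zero (hα : 0 < α + 1) (hαZ : ∀ k : ℤ, α ≠ k) :
    singLogDerivCoeff α β 0 ≠ 0 :=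
  right_ne_zero_of_mul ((limitScale_mul_singLogDerivCoeff_zero hα).trans_ne
    (Complex.ofReal_ne_zero.2 (specialCoeff_ne_zero hα hαZ)))

theorem analyticAt_regDet (hα : 0 ≤ α) (hβ : 0 ≤ β) (hαZ : ∀ k : ℤ, α ≠ k) :
    AnalyticAt ℂ (regDet α β) 0 :=
  (differentiable_regDet hα hβ hαZ).analyticAt 0

theorem analyticAt_singLogDerivCoeff (hα : 0 ≤ α) (hβ : 0 ≤ β) (hαZ : ∀ k : ℤ, α ≠ k) :
    AnalyticAt ℂ (singLogDerivCoeff α β) 0 := by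
  have hP := analyticAt_regDet hα hβ hαZ
  have hQ := (differentiable_singDet hα hβ hαZ).analyticAt 0
  exact ((((analyticAt_const.mul hQ).add (analyticAt_id.mul hQ.deriv)).mul hP).sub
    ((analyticAt_id.mul hP.deriv).mul hQ)).div (hP.pow 2) (by simp [regDet_zero])

theorem analyticAt_mul_logDeriv_regDet (hα : 0 ≤ α) (hβ : 0 ≤ β) (hαZ : ∀ k : ℤ, α ≠ k) :
    AnalyticAt ℂ (fun s => s * logDeriv (regDet α β) s) 0 :=
  have hP := analyticAt_regDet hα hβ hαZ
  analyticAt_id.mul (hP.deriv.div hP (by simp [regDet_zero]))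

theorem isBigO_regDet_sub (hα : 0 < α) (hβ : 0 ≤ β) (hαZ : ∀ k : ℤ, α ≠ k) :
    (fun s => regDet α β s - (1 - 1 / (2 * α) * s + 1 / (8 * ((α : ℂ) ^ 2 - 1)) * s ^ 2))
      =O[𝓝 0] fun s => s ^ 3 := by
  have hhalf : Tendsto (fun s : ℂ => s / 2) (𝓝 0) (𝓝 0) := by
    simpa using (continuous_id.div_const (2 : ℂ)).tendsto 0
  have hcube : (fun s : ℂ => (s / 2) ^ 3) =O[𝓝 0] fun s => s ^ 3 := by
    simp only [div_eq_inv_mul, mul_pow]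
    exact isBigO_const_mul_self _ _ _
  refine (((isBigO_infDet_zero_right hα hβ hαZ).comp_tendsto hhalf).trans hcube).congr_left
    fun s => ?_
  simp only [Function.comp_apply, regDet]
  generalize (α : ℂ) ^ 2 - 1 = w
  ring

theorem isBigO_mul_logDeriv_regDet_sub (hα : 0 < α) (hβ : 0 ≤ β) (hαZ : ∀ k : ℤ, α ≠ k) :
    (fun s => s * logDeriv (regDet α β) s -
      (-s / (2 * (α : ℂ)) + s ^ 2 / (4 * (α : ℂ) ^ 2 * ((α : ℂ) ^ 2 - 1)))) =O[𝓝 0]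
      fun s => s ^ 3 := by
  have hα0 : (α : ℂ) ≠ 0 := Complex.ofReal_ne_zero.2 hα.ne'
  have hα1 : (α : ℂ) ^ 2 - 1 ≠ 0 := by
    rw [sub_ne_zero, sq_ne_one_iff]
    exact ⟨by exact_mod_cast hαZ 1, by exact_mod_cast hαZ (-1)⟩
  refine (isBigO_mul_logDeriv_sub (differentiable_regDet hα.le hβ hαZ)
    (isBigO_regDet_sub hα hβ hαZ) (regDet_zero α β)).congr_left fun s => ?_
  field_simp
  ring

theorem isBigO_singLogDerivCoeff_div_sub_one (hα : 0 ≤ α) (hβ : 0 ≤ β)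
    (hαZ : ∀ k : ℤ, α ≠ k) :
    (fun s => singLogDerivCoeff α β s / singLogDerivCoeff α β 0 - 1) =O[𝓝 0] fun s => s := by
  have hK0 := singLogDerivCoeff_zero_ne_zero (β := β) (by positivity) hαZ
  simpa [div_self hK0] using ((analyticAt_singLogDerivCoeff hα hβ hαZ).differentiableAt.div_const
    (singLogDerivCoeff α β 0)).isBigO_sub

theorem tendsto_log_slitPlane :
    Tendsto Complex.log (𝓝[Complex.slitPlane] 0) (comap Complex.re atBot) := by
  have hnorm : Tendsto (fun s : ℂ => ‖s‖) (𝓝[Complex.slitPlane] 0) (𝓝[>] 0) := by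
    refine tendsto_nhdsWithin_iff.2 ⟨?_, ?_⟩
    · simpa using (continuous_norm.tendsto (0 : ℂ)).mono_left nhdsWithin_le_nhds
    · filter_upwards [self_mem_nhdsWithin] with s hs
      exact norm_pos_iff.2 (Complex.slitPlane_ne_zero hs)
  exact tendsto_comap_iff.2
    ((Real.tendsto_log_nhdsGT_zero.comp hnorm).congr fun s => (Complex.log_re s).symm)

theorem isBigO_logDeriv_limitLogDet_log_sub (hα : 0 ≤ α) (hβ : 0 ≤ β) (hαZ : ∀ k : ℤ, α ≠ k) :
    (fun s => logDeriv (limitLogDet α β) (Complex.log s) - s * logDeriv (regDet α β) s -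
      specialCoeff α * s ^ ((α : ℂ) + 1) * (singLogDerivCoeff α β s / singLogDerivCoeff α β 0))
      =O[𝓝[Complex.slitPlane] 0] fun s : ℂ => ‖s‖ ^ (2 * (α + 1)) := by
  have hα1 : 0 < α + 1 := by positivity
  have hK0 := singLogDerivCoeff_zero_ne_zero (β := β) hα1 hαZ
  refine ((isBigO_logDeriv_sub hα1 (differentiable_limitLogDet hα hβ hαZ)
    (differentiable_regDet hα hβ hαZ) (differentiable_singDet hα hβ hαZ) (regDet_zero α β)
    (isBigO_limitLogDet_sub hα hβ hαZ)).comp_tendsto tendsto_log_slitPlane).congr' ?_ ?_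
  · filter_upwards [self_mem_nhdsWithin] with s hs
    have hs0 := Complex.slitPlane_ne_zero hs
    have hpow : Complex.exp ((α + 1 : ℝ) * Complex.log s) = s ^ ((α : ℂ) + 1) := by
      rw [Complex.cpow_def_of_ne_zero hs0, mul_comm, Complex.ofReal_add, Complex.ofReal_one]
    simp only [Function.comp_apply, hpow, Complex.exp_log hs0]
    rw [← limitScale_mul_singLogDerivCoeff_zero (β := β) hα1, ← singLogDerivCoeff,
      logDeriv_apply (regDet α β)]
    field_simp
  · filter_upwards [self_mem_nhdsWithin] with s hs
    rw [Function.comp_apply, Complex.log_re, mul_comm,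
      Real.rpow_def_of_pos (norm_pos_iff.2 (Complex.slitPlane_ne_zero hs))]

theorem exists_differentiableOn_logDeriv_comp_log {F : ℂ → ℂ} (hF : Differentiable ℂ F)
    (hne : ∀ᶠ ζ in comap Complex.re atBot, F ζ ≠ 0) :
    ∃ ρ : ℝ, 0 < ρ ∧ DifferentiableOn ℂ (fun s => logDeriv F (Complex.log s))
      (Complex.slitPlane ∩ Metric.ball 0 ρ) := by
  obtain ⟨M, -, hM⟩ := (atBot_basis.comap Complex.re).eventually_iff.1 hne
  refine ⟨Real.exp M, Real.exp_pos M, fun s ⟨hslit, hball⟩ => ?_⟩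
  have hre : (Complex.log s).re ≤ M := by
    rw [Complex.log_re, Real.log_le_iff_le_exp (norm_pos_iff.2 (Complex.slitPlane_ne_zero hslit))]
    exact (mem_ball_zero_iff.1 hball).le
  have hlogDeriv : DifferentiableAt ℂ (logDeriv F) (Complex.log s) :=
    (hF.deriv _).div (hF _) (hM hre)
  exact (hlogDeriv.comp s (Complex.differentiableAt_log hslit)).differentiableWithinAt

end Asymptotics

theorem corollary3 (α β : ℝ) (hα : 0 < α) (hβ : 0 < β) (hαZ : ∀ k : ℤ, α ≠ (k : ℝ)) :
    (∀ (n : ℕ) (t : ℝ), 0 ≤ t → 0 < hankelDet n t α β) ∧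
    (∀ (n : ℕ) (s : ℝ), 0 < s →
      DifferentiableAt ℝ (fun u : ℝ => Real.log (scaledRatio α β n u)) s) ∧
    ∃ Δ H : ℝ → ℝ,
      (∀ s : ℝ, 0 < s →
        Tendsto (fun n : ℕ => scaledRatio α β n s) atTop (𝓝 (Δ s)) ∧
        0 < Δ s ∧
        DifferentiableAt ℝ Δ s ∧
        Tendsto (fun n : ℕ => scaledLogDeriv α β n s) atTop (𝓝 (H s)) ∧
        H s = s * deriv (fun u : ℝ => Real.log (Δ u)) s) ∧
      -- `Hc` is the analytic continuation of `H` to `|arg s| < π`, `|s| < ρ`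
      ∃ ρ : ℝ, 0 < ρ ∧ ∃ Hc R₁ R₂ R₃ : ℂ → ℂ,
        DifferentiableOn ℂ Hc (Complex.slitPlane ∩ Metric.ball 0 ρ) ∧
        (∀ s : ℝ, 0 < s → s < ρ → Hc (s : ℂ) = (H s : ℂ)) ∧
        AnalyticAt ℂ R₁ 0 ∧ (R₁ =O[𝓝 0] fun s : ℂ => s ^ 3) ∧
        AnalyticAt ℂ R₂ 0 ∧ (R₂ =O[𝓝 0] fun s : ℂ => s) ∧
        (R₃ =O[𝓝[Complex.slitPlane] 0] fun s : ℂ => ‖s‖ ^ (2 * (α + 1))) ∧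
        ∀ s ∈ Complex.slitPlane ∩ Metric.ball 0 ρ,
          Hc s = -s / (2 * (α : ℂ)) + s ^ 2 / (4 * (α : ℂ) ^ 2 * ((α : ℂ) ^ 2 - 1)) + R₁ s
            + (specialCoeff α : ℂ) * s ^ ((α : ℂ) + 1) * (1 + R₂ s) + R₃ s := by
  obtain ⟨ρ, hρ, hdiff⟩ := exists_differentiableOn_logDeriv_comp_log
    (differentiable_limitLogDet hα.le hβ.le hαZ)
    ((tendsto_limitLogDet hα.le hβ.le hαZ).eventually_ne one_ne_zero)
  refine ⟨fun n t ht => hankelDet_pos ht hα.le hβ.le n,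
    fun n s hs => (differentiableAt_scaledRatio hα hβ hαZ n hs).log
      (scaledRatio_pos hα.le hβ.le n hs.le).ne',
    limitRatio α β, limitLogDeriv α β,
    fun s hs => ⟨tendsto_scaledRatio hα hβ hαZ hs, limitRatio_pos hα hβ hαZ hs,
      differentiableAt_limitRatio hα hβ hαZ hs, tendsto_scaledLogDeriv hα hβ hαZ hs, rfl⟩,
    ρ, hρ, fun s => logDeriv (limitLogDet α β) (Complex.log s),
    fun s => s * logDeriv (regDet α β) s -
      (-s / (2 * (α : ℂ)) + s ^ 2 / (4 * (α : ℂ) ^ 2 * ((α : ℂ) ^ 2 - 1))),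
    fun s => singLogDerivCoeff α β s / singLogDerivCoeff α β 0 - 1,
    fun s => logDeriv (limitLogDet α β) (Complex.log s) - s * logDeriv (regDet α β) s -
      specialCoeff α * s ^ ((α : ℂ) + 1) * (singLogDerivCoeff α β s / singLogDerivCoeff α β 0),
    hdiff, fun s hs _ => by rw [ofReal_limitLogDeriv hα hβ hαZ hs, Complex.ofReal_log hs.le],
    (analyticAt_mul_logDeriv_regDet hα.le hβ.le hαZ).sub (by fun_prop),
    isBigO_mul_logDeriv_regDet_sub hα hβ.le hαZ,
    (analyticAt_singLogDerivCoeff hα.le hβ.le hαZ).div_const.sub analyticAt_const,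
    isBigO_singLogDerivCoeff_div_sub_one hα.le hβ.le hαZ,
    isBigO_logDeriv_limitLogDet_log_sub hα.le hβ.le hαZ, fun s _ => by ring⟩
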